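/- **Setting.** For a state $W=(\tau,u,E,z)$ put $e=E-\tfrac12u^2$, $p=\Gamma e/\tau$, $T=e/c$, $\phi(T)=e^{-\mathcal E/T}$, where $\Gamma>0$, $c>0$, $\mathcal E\ge 0$. In Lagrangian coordinates moving with speed $s=1$ and with reaction rate $k=1$ the ZND equations read $W_t+F(W)_x=R(W)$, with $$F(W)=(-u-\tau,\;p-u,\;up-E,\;-z),\qquad R(W)=(0,\;0,\;q\phi(T)z,\;-\phi(T)z).$$ The constant $c$ is fixed. The parameters are $(e_+,q,\mathcal E,\Gamma)$ with $0<\Gamma<\infty$, $0\le\mathcal E<\infty$, $0\le e_+\le\frac1{\Gamma(\Gamma+1)}$ and $0\le q\le q_{cj}$, where $$q_{cj}(e_+,\Gamma)=\frac{(\Gamma+1)^2(\Gamma e_++1)^2-\Gamma(\Gamma+2)(1+2(\Gamma+1)e_+)}{2\Gamma(\Gamma+2)}.$$ A *ZND detonation* with these parameters is a profile $\bar W$ with $\bar W\equiv W_+:=(1,0,e_+,1)$ for $x>0$ which, on $x\le0$ (with $\bar W(0):=\bar W(0^-)$), is smooth, satisfies $\bar\tau,\bar e>0$, $0\le\bar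 z\le1$ and $F(\bar W)'=R(\bar W)$, and converges as $x\to-\infty$ to a state with $\tau,e>0$, $z=0$; the jump at $x=0$ is a gas-dynamical shock: $F(\bar W(0^-))=F(W_+)$ and $C(W_+)<1<C(\bar W(0^-))$, where $C(W)=\sqrt{\Gamma(\Gamma+1)e}/\tau$. Let $A=dF(\bar W(x))$, $\mathbb E=dR(\bar W(x))$, $G(\lambda,x)=(-\lambda I+\mathbb E)A^{-1}$, and consider $Z'=GZ$ on $x\le0$. An *admissible basis* consists of $Z_1,Z_2,Z_3(\lambda,x)$ that are, for each $\Re\lambda\ge0$, linearly independent solutions, whose values at $x=0$ are analytic in $\lambda$ in a neighborhood of $\{\Re\lambda\ge0\}$, and which for $\Re\lambda>0$ decay exponentially as $x\to-\infty$ and span all solutions bounded on $x\le 0$. The *Evans–Lopatinski determinant* is $$D(\lambda)=\det\big(Z_1(\lambda,0),Z_2(\lambda,0),Z_3(\lambda,0),\;\lambda[\bar W]+R(\bar W(0^-))\big),\qquad[\bar W]=W_+-\bar W(0^-).$$ The detonation is *spectrally stable* if an admissible basis exists and, for every admissible basis, the only zero of $D$ on $\{\Re\lambda\ge0\}$ is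 $\lambda=0$, and this zero has multiplicity one. **Theorem.** Fix $c>0$. 1. (Small heat release limit.) For all $M\in\mathbb R$ and $\delta>0$ there is $q_*>0$ such that for all parameters in the above range with $\Gamma,\mathcal E,e_+\le M$, $q\le q_{cj}(e_+,\Gamma)-\delta$ and $q\le q_*$, a ZND detonation exists and every ZND detonation with these parameters is spectrally stable. 2. (High-overdrive limit.) For every $\Gamma>0$ there is $\varepsilon>0$ such that, whenever $0\le e_+,q,\mathcal E\le\varepsilon$, the parameters $(e_+,q,\mathcal E,\Gamma)$ lie in the above range, $q<q_{cj}(e_+,\Gamma)$, a ZND detonation exists, and every one is spectrally stable. In particular, in Erpenbeck's scaling: for all $\Gamma>0$, $q_0\ge0$, $\mathcal E_0\ge0$, the same conclusions hold for $q=q_0e_+$, $\mathcal E=\mathcal E_0e_+$ and all sufficiently small $e_+>0$. -/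

import Mathlib

open Set Filter Topology

noncomputable section

namespace ZND

/-- Parameters of the normalized ZND model (wave speed `s = 1`, unburned specific volume
`τ₊ = 1`, unburned velocity `u₊ = 0`, reaction rate `k = 1`): the unburned internal energy
`e₊`, the heat release `q`, the activation energy `ℰ`, the Gruneisen constant `Γ`, and the
specific heat constant `c`. -/
structure Params where
  ePlus : ℝ
  q : ℝ
  actE : ℝ
  Gam : ℝ
  cv : ℝ

/-- The Chapman--Jouguet heat release `q_cj(e₊, Γ)`. -/
def Params.qCJ (P : Params) : ℝ :=
  ((P.Gam + 1) ^ 2 * (P.Gam * P.ePlus + 1) ^ 2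
      - P.Gam * (P.Gam + 2) * (1 + 2 * (P.Gam + 1) * P.ePlus))
    / (2 * P.Gam * (P.Gam + 2))

/-- The parameter range `0 ≤ e₊ ≤ 1/(Γ(Γ+1))`, `0 ≤ q ≤ q_cj`, `0 ≤ ℰ`, `0 < Γ`, `0 < c`. -/
structure Params.InRange (P : Params) : Prop where
  gam_pos : 0 < P.Gam
  cv_pos : 0 < P.cv
  actE_nonneg : 0 ≤ P.actE
  ePlus_nonneg : 0 ≤ P.ePlus
  ePlus_le : P.ePlus ≤ 1 / (P.Gam * (P.Gam + 1))
  q_nonneg : 0 ≤ P.q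
  q_le : P.q ≤ P.qCJ

/-- A state `W = (τ, u, E, z)`: specific volume, velocity, gas-dynamical energy
`E = e + u²/2`, and mass fraction of reactant. -/
abbrev State : Type := Fin 4 → ℝ

/-- Specific internal energy `e = E - u²/2`. -/
def internalEnergy (W : State) : ℝ := W 2 - W 1 ^ 2 / 2

/-- Ideal gas pressure `p = Γ e / τ`. -/
def pressure (P : Params) (W : State) : ℝ := P.Gam * internalEnergy W / W 0

/-- Temperature `T = e / c`. -/
def temperature (P : Params) (W : State) : ℝ := internalEnergy W / P.cv

/-- Arrhenius ignition function `φ(T) = exp (-ℰ / T)`. -/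
def ignition (P : Params) (T : ℝ) : ℝ := Real.exp (-P.actE / T)

/-- Derivative of the ignition function: `φ'(T) = (ℰ / T²) exp (-ℰ / T)`. -/
def ignitionDeriv (P : Params) (T : ℝ) : ℝ := P.actE / T ^ 2 * Real.exp (-P.actE / T)

/-- Flux `F(W)` in the frame moving with speed `s = 1`; the ZND equations are
`W_t + F(W)_x = R(W)`. -/
def flux (P : Params) (W : State) : State :=
  ![-W 1 - W 0, pressure P W - W 1, W 1 * pressure P W - W 2, -W 3]

/-- Reaction source `R(W) = (0, 0, q φ(T) z, -φ(T) z)` (with `k = 1`). -/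
def source (P : Params) (W : State) : State :=
  ![0, 0, P.q * ignition P (temperature P W) * W 3, -(ignition P (temperature P W) * W 3)]

/-- The unburned state `W₊ = (1, 0, e₊, 1)`. -/
def unburned (P : Params) : State := ![1, 0, P.ePlus, 1]

/-- Lagrangian sound speed `√(Γ (Γ + 1) e) / τ = √(-p_τ + p p_e)`. -/
def soundSpeed (P : Params) (W : State) : ℝ :=
  Real.sqrt (P.Gam * (P.Gam + 1) * internalEnergy W) / W 0

/-- Physical states: `τ > 0`, `e > 0`, `0 ≤ z ≤ 1`. -/
structure IsPhysical (W : State) : Prop where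
  tau_pos : 0 < W 0
  energy_pos : 0 < internalEnergy W
  z_nonneg : 0 ≤ W 3
  z_le_one : W 3 ≤ 1

/-- `W` is a right-going strong detonation profile (a standing wave in the moving frame).
The value `W 0` is the left trace `W(0⁻)` at the Neumann shock; the right trace is the
unburned state. -/
structure IsDetonation (P : Params) (W : ℝ → State) : Prop where
  /-- constant unburned state ahead of the shock -/
  ahead : ∀ x, 0 < x → W x = unburned P
  /-- smooth, up to the shock, behind it -/
  smooth : ContDiffOn ℝ (⊤ : ℕ∞) W (Iic 0)
  physical : ∀ x, x ≤ 0 → IsPhysical (W x)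
  /-- the profile equation `F(W)_x = R(W)` behind the shock -/
  profile_eq : ∀ x, x ≤ 0 →
    HasDerivWithinAt (fun y => flux P (W y)) (source P (W x)) (Iic 0) x
  /-- Rankine--Hugoniot condition at the Neumann shock -/
  rankine_hugoniot : flux P (W 0) = flux P (unburned P)
  /-- Lax condition for a right-going gas-dynamical shock of speed `1` -/
  lax_ahead : soundSpeed P (unburned P) < 1
  lax_behind : 1 < soundSpeed P (W 0)
  /-- completely burned end state -/
  burned : ∃ Wm : State, IsPhysical Wm ∧ Wm 3 = 0 ∧ Tendsto W atBot (𝓝 Wm)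

/-- `A = dF(W)`; see `hasFDerivAt_flux`. -/
def fluxJac (P : Params) (W : State) : Matrix (Fin 4) (Fin 4) ℝ :=
  let p := pressure P W
  let u := W 1
  let τ := W 0
  !![-1, -1, 0, 0;
     -(p / τ), -(P.Gam * u / τ) - 1, P.Gam / τ, 0;
     -(u * p / τ), p - P.Gam * u ^ 2 / τ, P.Gam * u / τ - 1, 0;
     0, 0, 0, -1]

/-- `E = dR(W)`; see `hasFDerivAt_source`. -/
def sourceJac (P : Params) (W : State) : Matrix (Fin 4) (Fin 4) ℝ :=
  let T := temperature P W
  let u := W 1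
  let z := W 3
  !![0, 0, 0, 0;
     0, 0, 0, 0;
     0, -(P.q * ignitionDeriv P T * u * z / P.cv), P.q * ignitionDeriv P T * z / P.cv,
       P.q * ignition P T;
     0, ignitionDeriv P T * u * z / P.cv, -(ignitionDeriv P T * z / P.cv), -ignition P T]

theorem hasFDerivAt_coord (i : Fin 4) (W : State) :
    HasFDerivAt (fun V : State => V i)
      (ContinuousLinearMap.proj (R := ℝ) (φ := fun _ : Fin 4 => ℝ) i) W :=
  (ContinuousLinearMap.proj (R := ℝ) (φ := fun _ : Fin 4 => ℝ) i).hasFDerivAt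

theorem hasFDerivAt_flux (P : Params) (W : State) (hτ : W 0 ≠ 0) :
    HasFDerivAt (flux P) (LinearMap.toContinuousLinearMap (Matrix.toLin' (fluxJac P W))) W := by
  have h0 := hasFDerivAt_coord 0 W
  have h1 := hasFDerivAt_coord 1 W
  have h2 := hasFDerivAt_coord 2 W
  have h3 := hasFDerivAt_coord 3 W
  have hp := (((h2.sub ((h1.pow 2).mul_const (1 / 2))).const_mul P.Gam).mul
    ((hasDerivAt_inv hτ).comp_hasFDerivAt W h0))
  have hp' : HasFDerivAt (pressure P) _ W :=
    hp.congr_of_eventuallyEq (Eventually.of_forall fun V => by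
      simp [pressure, internalEnergy, div_eq_mul_inv])
  rw [hasFDerivAt_pi']
  intro i
  fin_cases i
  · refine ((h1.neg.sub h0).congr_fderiv ?_)
    ext v
    simp [fluxJac, dotProduct, Fin.sum_univ_four]
    ring
  · refine ((hp'.sub h1).congr_fderiv ?_)
    ext v
    simp [fluxJac, dotProduct, Fin.sum_univ_four, pressure, internalEnergy]
    field_simp
    ring
  · refine (((h1.mul hp').sub h2).congr_fderiv ?_)
    ext v
    simp [fluxJac, dotProduct, Fin.sum_univ_four, pressure, internalEnergy]
    field_simp
    ring
  · refine (h3.neg.congr_fderiv ?_)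
    ext v
    simp [fluxJac, dotProduct, Fin.sum_univ_four]

theorem hasFDerivAt_source (P : Params) (W : State) (hc : P.cv ≠ 0)
    (he : internalEnergy W ≠ 0) :
    HasFDerivAt (source P)
      (LinearMap.toContinuousLinearMap (Matrix.toLin' (sourceJac P W))) W := by
  have h1 := hasFDerivAt_coord 1 W
  have h2 := hasFDerivAt_coord 2 W
  have h3 := hasFDerivAt_coord 3 W
  have hT : temperature P W ≠ 0 := div_ne_zero he hc
  have hT' : HasFDerivAt (temperature P) _ W :=
    ((h2.sub ((h1.pow 2).mul_const (1 / 2))).mul_const (P.cv)⁻¹).congr_of_eventuallyEq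
      (Eventually.of_forall fun V => by
        simp [temperature, internalEnergy, div_eq_mul_inv])
  have hφ : HasDerivAt (ignition P) (ignitionDeriv P (temperature P W)) (temperature P W) := by
    have h := (((hasDerivAt_inv hT).const_mul (-P.actE)).exp).congr_of_eventuallyEq
      (f₁ := ignition P) (Eventually.of_forall fun T => by simp [ignition, div_eq_mul_inv])
    refine h.congr_deriv ?_
    simp only [ignitionDeriv, div_eq_mul_inv]
    ring
  have hr := (hφ.comp_hasFDerivAt W hT').mul h3
  rw [hasFDerivAt_pi']
  intro i
  fin_cases i
  · refine ((hasFDerivAt_const (0 : ℝ) W).congr_fderiv ?_)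
    ext v
    simp [sourceJac, dotProduct, Fin.sum_univ_four]
  · refine ((hasFDerivAt_const (0 : ℝ) W).congr_fderiv ?_)
    ext v
    simp [sourceJac, dotProduct, Fin.sum_univ_four]
  · refine (((hr.const_mul P.q).congr_of_eventuallyEq
      (Eventually.of_forall fun V => ?_)).congr_fderiv ?_)
    · simp [source, mul_assoc]
    · ext v
      simp [sourceJac, dotProduct, Fin.sum_univ_four]
      field_simp
      ring
  · refine ((hr.neg.congr_of_eventuallyEq
      (Eventually.of_forall fun V => ?_)).congr_fderiv ?_)
    · simp [source]
    · ext v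
      simp [sourceJac, dotProduct, Fin.sum_univ_four]
      field_simp
      ring

/-- Coefficient matrix `G = (-λ I + E) A⁻¹` of the generalized eigenvalue equation. -/
def coeffG (P : Params) (W : ℝ → State) (lam : ℂ) (x : ℝ) : Matrix (Fin 4) (Fin 4) ℂ :=
  (-(lam • (1 : Matrix (Fin 4) (Fin 4) ℂ)) + (sourceJac P (W x)).map Complex.ofReal)
    * ((fluxJac P (W x)).map Complex.ofReal)⁻¹

/-- `Z` solves the generalized eigenvalue equation `Z' = G Z` on `x ≤ 0`. -/
def SolvesEigenvalueODE (P : Params) (W : ℝ → State) (lam : ℂ) (Z : ℝ → Fin 4 → ℂ) : Prop :=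
  ∀ x, x ≤ 0 → HasDerivWithinAt Z ((coeffG P W lam x).mulVec (Z x)) (Iic 0) x

/-- `Z j lam x`, `j = 1, 2, 3`, is an analytic choice of a basis of the decaying solutions
`Z_j^-(λ, x)` of `Z' = G Z` on `x ≤ 0`: for `Re λ > 0` the `Z_j` decay exponentially and span
all bounded solutions, and, as a family of linearly independent solutions, they extend
analytically to a neighborhood of `Re λ ≥ 0`. (Analyticity is asked of the initial data at
`x = 0`, the only values that enter the determinant; by the flow of the ODE it passes to
every `x`.) -/
structure IsDecayingBasis (P : Params) (W : ℝ → State) (Z : Fin 3 → ℂ → ℝ → Fin 4 → ℂ) :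
    Prop where
  solves : ∀ lam : ℂ, 0 ≤ lam.re → ∀ j, SolvesEigenvalueODE P W lam (Z j lam)
  analytic : ∀ j, AnalyticOnNhd ℂ (fun lam => Z j lam 0) {lam : ℂ | 0 ≤ lam.re}
  independent : ∀ lam : ℂ, 0 ≤ lam.re → LinearIndependent ℂ (fun j => Z j lam 0)
  decays : ∀ lam : ℂ, 0 < lam.re → ∀ j, ∃ C θ : ℝ, 0 < θ ∧
    ∀ x, x ≤ 0 → ‖Z j lam x‖ ≤ C * Real.exp (θ * x)
  spans : ∀ lam : ℂ, 0 < lam.re → ∀ Y : ℝ → Fin 4 → ℂ, SolvesEigenvalueODE P W lam Y →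
    (∃ C : ℝ, ∀ x, x ≤ 0 → ‖Y x‖ ≤ C) →
    ∃ a : Fin 3 → ℂ, ∀ x, x ≤ 0 → Y x = ∑ j, a j • Z j lam x

/-- The column `λ [W] + R(W)(0⁻)`, where `[W] = W(0⁺) - W(0⁻)`. -/
def shockColumn (P : Params) (W : ℝ → State) (lam : ℂ) : Fin 4 → ℂ :=
  fun i => lam * ((unburned P i - W 0 i : ℝ) : ℂ) + ((source P (W 0) i : ℝ) : ℂ)

/-- The Evans--Lopatinski determinant
`D(λ) = det (Z₁(λ,0), Z₂(λ,0), Z₃(λ,0), λ [W] + R(W)(0⁻))`. -/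
def evansLopatinski (P : Params) (W : ℝ → State) (Z : Fin 3 → ℂ → ℝ → Fin 4 → ℂ)
    (lam : ℂ) : ℂ :=
  (Matrix.of ![Z 0 lam 0, Z 1 lam 0, Z 2 lam 0, shockColumn P W lam]).transpose.det

/-- Spectral (normal modes) stability: the Evans--Lopatinski determinant is defined, and,
for every admissible choice of the basis of decaying solutions, its only zero on `Re λ ≥ 0`
is a zero of multiplicity one at `λ = 0`. -/
def SpectrallyStable (P : Params) (W : ℝ → State) : Prop :=
  (∃ Z, IsDecayingBasis P W Z) ∧
    ∀ Z, IsDecayingBasis P W Z →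
      (∀ lam : ℂ, 0 ≤ lam.re → (evansLopatinski P W Z lam = 0 ↔ lam = 0)) ∧
      analyticOrderAt (evansLopatinski P W Z) 0 = 1

/-- For the parameters `P` a ZND detonation exists, and every one is spectrally stable. -/
def DetonationStable (P : Params) : Prop :=
  (∃ W, IsDetonation P W) ∧ ∀ W, IsDetonation P W → SpectrallyStable P W

end ZND

end

open Set Filter Topology

noncomputable section

/-! ### Neumann series for exponentially decaying kernels that are holomorphic in a parameter. -/

namespace ZND

open MeasureTheory

/-! For `Re λ > 0` the initial data of bounded solutions of `Z' = GZ` form a hyperplane, so the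
determinant is governed by one covector. Let `Y(λ)` be the value at the shock of the decaying
solution of the adjoint equation. Its pairing with any solution is constant in `x`, hence zero on
bounded ones, and linear algebra gives `D(λ) Y₀ = -(minor) · Y·(λ[W] + R)` with `Y₀` and the minor
nonzero (`det_mul_eq_minor_mul`, `minor_ne_zero`). Everything reduces to the scalar `Y·(λ[W] + R)`.

The adjoint mode is found by perturbation in `q`. A moving frame of left eigenvectors of `A`
(`charMat`) turns the equation into diagonal transport plus a coupling of size `ρ`, where `q ≤ ρ²`
and the reactant is rescaled by `ρ`. The coupling columns decay like `e^{ηx}`, except the reactant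
column, where the damping `φ` replaces the decay. After the phase of the acoustic mode with positive
slowness is factored out, the adjoint equation becomes an integral equation `f = e₀ + ∫ k f`. Its
kernel is bounded uniformly for `Re λ` above a small negative number, whatever `Im λ`. Hence `f`
stays close to `e₀` at all frequencies, with no separate high-frequency analysis, and is holomorphic
across the imaginary axis (`ProfileBounds.exists_dualMode`).

Then `Y·[W]` is close to `ℓ₀·[W]`, with `ℓ₀` the corresponding row of the frame: this is the
Lopatinski quantity of the inert gas-dynamical shock, and it is bounded away from zero. The source
`R(W) = A W'` solves the equation with `λ = 0`, so `Y·R` is only `O(|λ| ρ/η)`. Together `|Y·(λ[W] +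
R)| ≥ |λ|/(2K²)` (`IsDualMode.le_norm_pairing_shockColumn`), and the only zero is `λ = 0`, simple.

An admissible basis comes from solving with data in the hyperplane orthogonal to `Y`; an energy
estimate (`IsDualMode.exp_decay`) gives the decay. Profiles exist because the conservation laws
express the state through `z`, leaving a scalar equation. The constants are uniform because the
margin `δ` keeps `1 - Γ(Γ+1)e₊` away from zero (`Params.exists_le_excess`); high overdrive is a
special case of small heat release. -/

/-- A parameter integral of holomorphic functions with an integrable bound is holomorphic. -/
theorem differentiableOn_integral_of_bound {α E : Type*} [MeasurableSpace α] {μ : Measure α}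
    [NormedAddCommGroup E] [NormedSpace ℂ E] [CompleteSpace E] {U : Set ℂ} (hU : IsOpen U)
    {F : ℂ → α → E} {bound : α → ℝ}
    (hmeas : ∀ lam ∈ U, AEStronglyMeasurable (F lam) μ)
    (hdiff : ∀ᵐ a ∂μ, DifferentiableOn ℂ (fun lam => F lam a) U)
    (hbound : ∀ᵐ a ∂μ, ∀ lam ∈ U, ‖F lam a‖ ≤ bound a) (hint : Integrable bound μ) :
    DifferentiableOn ℂ (fun lam => ∫ a, F lam a ∂μ) U := by
  intro lam hlam
  obtain ⟨R, hR, hball⟩ := Metric.isOpen_iff.1 hU lam hlam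
  -- Halving the radius keeps every closed disc of radius `r` centred in `ball lam r` inside `U`, as
  -- the Cauchy estimate for the derivative requires.
  set r := R / 2 with hr
  have hr0 : 0 < r := by positivity
  have hsub : ∀ w ∈ Metric.ball lam r, Metric.closedBall w r ⊆ U := by
    intro w hw y hy
    apply hball
    rw [Metric.mem_ball] at *
    rw [Metric.mem_closedBall] at hy
    linarith [dist_triangle y w lam]
  have hself : ∀ w ∈ Metric.ball lam r, w ∈ U := fun w hw =>
    hsub w hw (Metric.mem_closedBall_self hr0.le)
  refine ((hasDerivAt_integral_of_dominated_loc_of_deriv_le (μ := μ) (F := F)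
    (F' := fun w a => deriv (fun l => F l a) w) (bound := fun a => bound a / r)
    (Metric.ball_mem_nhds lam hr0) ?_ ?_ ?_ ?_ ?_ ?_).2).differentiableAt.differentiableWithinAt
  · filter_upwards [Metric.ball_mem_nhds lam hr0] with w hw using hmeas w (hself w hw)
  · exact hint.mono' (hmeas lam hlam) (hbound.mono fun a ha => ha lam hlam)
  -- The derivative at `lam` is measurable in `a` as an a.e. limit of difference quotients along one
  -- sequence in the ball.
  · let w : ℕ → ℂ := fun n => lam + ((r / (n + 2) : ℝ) : ℂ)
    have hpos : ∀ n : ℕ, 0 < r / ((n : ℝ) + 2) := fun n => by positivity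
    have hw : ∀ n, w n ∈ Metric.ball lam r := by
      intro n
      rw [Metric.mem_ball, dist_eq_norm]
      simp only [w, add_sub_cancel_left, Complex.norm_real, Real.norm_eq_abs, abs_of_pos (hpos n)]
      rw [div_lt_iff₀ (by positivity)]
      nlinarith [(Nat.cast_nonneg n : (0 : ℝ) ≤ n)]
    have hlim : Tendsto w atTop (𝓝[≠] lam) := by
      rw [tendsto_nhdsWithin_iff]
      constructor
      · have h1 : Tendsto (fun n : ℕ => r / ((n : ℝ) + 2)) atTop (𝓝 0) :=
          Tendsto.div_atTop tendsto_const_nhds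
            (tendsto_atTop_add_const_right _ _ tendsto_natCast_atTop_atTop)
        have h2 := (Complex.continuous_ofReal.tendsto 0).comp h1
        simpa [w, Function.comp_def] using h2.const_add lam
      · refine Eventually.of_forall fun n => ?_
        simp only [w, mem_compl_iff, mem_singleton_iff, add_eq_left, Complex.ofReal_eq_zero]
        exact (hpos n).ne'
    refine aestronglyMeasurable_of_tendsto_ae atTop
      (f := fun n a => (w n - lam)⁻¹ • (F (w n) a - F lam a)) (fun n => ?_) ?_
    · exact ((hmeas _ (hself _ (hw n))).sub (hmeas _ hlam)).const_smul _
    · filter_upwards [hdiff] with a ha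
      have hd := ((ha lam hlam).differentiableAt (hU.mem_nhds hlam)).hasDerivAt.tendsto_slope
      exact hd.comp hlim
  · filter_upwards [hdiff, hbound] with a ha hb w hw
    refine Complex.norm_deriv_le_of_forall_mem_sphere_norm_le hr0 ?_ fun z hz =>
      hb z (hsub w hw (Metric.sphere_subset_closedBall hz))
    refine DifferentiableOn.diffContOnCl ?_
    rw [closure_ball _ hr0.ne']
    exact ha.mono (hsub w hw)
  · exact hint.div_const r
  · filter_upwards [hdiff] with a ha w hw
    exact ((ha w (hself w hw)).differentiableAt (hU.mem_nhds (hself w hw))).hasDerivAt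

theorem norm_mulVec_le_card {ι : Type*} [Fintype ι] (A : Matrix ι ι ℂ) (v : ι → ℂ) {c : ℝ}
    (hc : 0 ≤ c) (hA : ∀ i j, ‖A i j‖ ≤ c) : ‖A.mulVec v‖ ≤ Fintype.card ι * c * ‖v‖ := by
  refine (pi_norm_le_iff_of_nonneg (by positivity)).2 fun i => ?_
  calc ‖A.mulVec v i‖ ≤ ∑ j, ‖A i j * v j‖ := norm_sum_le _ _
    _ ≤ ∑ _j : ι, c * ‖v‖ := by
        refine Finset.sum_le_sum fun j _ => ?_
        rw [norm_mul]
        exact mul_le_mul (hA i j) (norm_le_pi_norm v j) (norm_nonneg _) hc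
    _ = Fintype.card ι * c * ‖v‖ := by simp [mul_assoc]

/-- Families of functions on the half-line, holomorphic in the parameter and bounded by `C`. -/
structure HoloBounded {ι : Type*} [Fintype ι] (U : Set ℂ) (g : ℂ → ℝ → ι → ℂ) (C : ℝ) : Prop where
  cont : ∀ lam ∈ U, ContinuousOn (g lam) (Iic 0)
  diff : ∀ x ≤ 0, DifferentiableOn ℂ (fun lam => g lam x) U
  bound : ∀ lam ∈ U, ∀ x ≤ 0, ‖g lam x‖ ≤ C

/-- Exponentially decaying convolution-type kernels, holomorphic in the parameter. -/
structure HoloKernel {ι : Type*} [Fintype ι] (U : Set ℂ) (k : ℂ → ℝ → ℝ → Matrix ι ι ℂ)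
    (ε η : ℝ) : Prop where
  isOpen : IsOpen U
  eta_pos : 0 < η
  eps_nonneg : 0 ≤ ε
  cont : ∀ lam ∈ U, ∀ i j, ContinuousOn (fun y : ℝ × ℝ => k lam y.1 y.2 i j) (Iic 0 ×ˢ Iic 0)
  diff : ∀ x ≤ 0, ∀ t ≤ 0, ∀ i j, DifferentiableOn ℂ (fun lam => k lam x t i j) U
  -- The variable `t` is the offset from `x`, so that all integrals run over one fixed half-line.
  bound : ∀ lam ∈ U, ∀ x ≤ 0, ∀ t ≤ 0, ∀ i j, ‖k lam x t i j‖ ≤ ε * Real.exp (η * t)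

theorem integral_exp_mul_Iic_zero {η : ℝ} (hη : 0 < η) :
    ∫ t in Iic (0 : ℝ), Real.exp (η * t) = η⁻¹ := by
  rw [integral_exp_mul_Iic hη]; simp

section Kernel

variable {ι : Type*} [Fintype ι] {U : Set ℂ} {k : ℂ → ℝ → ℝ → Matrix ι ι ℂ} {ε η : ℝ}
  {g : ℂ → ℝ → ι → ℂ} {C : ℝ}

theorem HoloKernel.continuousOn_integrand (hk : HoloKernel U k ε η) (hg : HoloBounded U g C)
    {lam : ℂ} (hl : lam ∈ U) :
    ContinuousOn (fun y : ℝ × ℝ => (k lam y.1 y.2).mulVec (g lam (y.1 + y.2)))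
      (Iic 0 ×ˢ Iic 0) := by
  refine continuousOn_pi.2 fun i => ?_
  simp only [Matrix.mulVec, dotProduct]
  refine continuousOn_finsetSum _ fun j _ => (hk.cont lam hl i j).mul ?_
  have h1 : ContinuousOn (fun y : ℝ × ℝ => g lam (y.1 + y.2)) (Iic 0 ×ˢ Iic 0) :=
    (hg.cont lam hl).comp (by fun_prop) fun y hy => by
      simp only [mem_prod, mem_Iic] at hy ⊢; linarith [hy.1, hy.2]
  exact continuousOn_pi.1 h1 j

theorem HoloKernel.norm_integrand_le (hk : HoloKernel U k ε η) (hg : HoloBounded U g C)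
    {lam : ℂ} (hl : lam ∈ U) {x t : ℝ} (hx : x ≤ 0) (ht : t ≤ 0) :
    ‖(k lam x t).mulVec (g lam (x + t))‖
      ≤ (Fintype.card ι * ε * C) * Real.exp (η * t) := by
  have h1 := norm_mulVec_le_card (k lam x t) (g lam (x + t))
    (mul_nonneg hk.eps_nonneg (Real.exp_pos _).le) (hk.bound lam hl x hx t ht)
  refine h1.trans ?_
  have h2 := hg.bound lam hl (x + t) (by linarith)
  have h3 : 0 ≤ (Fintype.card ι : ℝ) * (ε * Real.exp (η * t)) := by
    have := hk.eps_nonneg; positivity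
  calc _ ≤ (Fintype.card ι : ℝ) * (ε * Real.exp (η * t)) * C := mul_le_mul_of_nonneg_left h2 h3
    _ = _ := by ring

theorem HoloKernel.aestronglyMeasurable (hk : HoloKernel U k ε η) (hg : HoloBounded U g C)
    {lam : ℂ} (hl : lam ∈ U) {x : ℝ} (hx : x ≤ 0) :
    AEStronglyMeasurable (fun t => (k lam x t).mulVec (g lam (x + t)))
      (volume.restrict (Iic (0 : ℝ))) := by
  refine ContinuousOn.aestronglyMeasurable ?_ measurableSet_Iic
  exact (hk.continuousOn_integrand hg hl).comp (f := fun t : ℝ => (x, t)) (by fun_prop)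
    fun t ht => ⟨hx, ht⟩

theorem HoloKernel.integrable_bound (hk : HoloKernel U k ε η) (c : ℝ) :
    Integrable (fun t => c * Real.exp (η * t)) (volume.restrict (Iic (0 : ℝ))) :=
  (integrableOn_exp_mul_Iic hk.eta_pos 0).const_mul c

theorem HoloKernel.integrable (hk : HoloKernel U k ε η) (hg : HoloBounded U g C)
    {lam : ℂ} (hl : lam ∈ U) {x : ℝ} (hx : x ≤ 0) :
    Integrable (fun t => (k lam x t).mulVec (g lam (x + t))) (volume.restrict (Iic (0 : ℝ))) :=
  (hk.integrable_bound _).mono' (hk.aestronglyMeasurable hg hl hx)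
    ((ae_restrict_iff' measurableSet_Iic).2 (Eventually.of_forall fun _ ht =>
      hk.norm_integrand_le hg hl hx ht))

theorem HoloKernel.integral_norm_le (hk : HoloKernel U k ε η) (hg : HoloBounded U g C)
    {lam : ℂ} (hl : lam ∈ U) {x : ℝ} (hx : x ≤ 0) :
    ∫ t in Iic (0 : ℝ), ‖(k lam x t).mulVec (g lam (x + t))‖
      ≤ Fintype.card ι * ε / η * C := by
  calc _ ≤ ∫ t in Iic (0 : ℝ), (Fintype.card ι * ε * C) * Real.exp (η * t) :=
        setIntegral_mono_on (hk.integrable hg hl hx).norm (hk.integrable_bound _) measurableSet_Iic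
          fun t ht => hk.norm_integrand_le hg hl hx ht
    _ = _ := by
        rw [integral_const_mul, integral_exp_mul_Iic_zero hk.eta_pos]; ring

/-- One Picard iteration: the bound is multiplied by the mass of the kernel, while dominated
convergence keeps continuity in `x` and holomorphy in the parameter. -/
theorem HoloKernel.step (hk : HoloKernel U k ε η) (hg : HoloBounded U g C) :
    HoloBounded U (fun lam x => ∫ t in Iic (0 : ℝ), (k lam x t).mulVec (g lam (x + t)))
      (Fintype.card ι * ε / η * C) where
  cont lam hl := by
    refine continuousOn_of_dominated
      (bound := fun t => (Fintype.card ι * ε * C) * Real.exp (η * t)) ?_ ?_ ?_ ?_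
    · exact fun x hx => hk.aestronglyMeasurable hg hl hx
    · exact fun x hx => (ae_restrict_iff' measurableSet_Iic).2 (Eventually.of_forall fun t ht =>
        hk.norm_integrand_le hg hl hx ht)
    · exact hk.integrable_bound _
    · refine (ae_restrict_iff' measurableSet_Iic).2 (Eventually.of_forall fun t ht => ?_)
      exact (hk.continuousOn_integrand hg hl).comp (f := fun x : ℝ => (x, t)) (by fun_prop)
        fun x hx => ⟨hx, ht⟩
  diff x hx := by
    refine differentiableOn_integral_of_bound hk.isOpen
      (bound := fun t => (Fintype.card ι * ε * C) * Real.exp (η * t)) ?_ ?_ ?_ ?_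
    · exact fun lam hl => hk.aestronglyMeasurable hg hl hx
    · refine (ae_restrict_iff' measurableSet_Iic).2 (Eventually.of_forall fun t ht => ?_)
      refine differentiableOn_pi.2 fun i => ?_
      simp only [Matrix.mulVec, dotProduct]
      refine DifferentiableOn.fun_sum fun j _ => (hk.diff x hx t ht i j).mul ?_
      exact differentiableOn_pi.1 (hg.diff (x + t) (by simp only [mem_Iic] at ht; linarith)) j
    · exact (ae_restrict_iff' measurableSet_Iic).2 (Eventually.of_forall fun t ht lam hl =>
        hk.norm_integrand_le hg hl hx ht)
    · exact hk.integrable_bound _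
  bound lam hl x hx := (norm_integral_le_integral_norm _).trans (hk.integral_norm_le hg hl hx)

/-- Solution of `f = b + ∫ k f`, holomorphic in the parameter, by Neumann series. -/
theorem HoloKernel.exists_fixedPoint (hk : HoloKernel U k ε η) (b : ι → ℂ) {θ : ℝ}
    (hθ : Fintype.card ι * ε / η ≤ θ) (hθ1 : θ < 1) :
    ∃ f : ℂ → ℝ → ι → ℂ, HoloBounded U f (‖b‖ * (1 - θ)⁻¹) ∧
      (∀ lam ∈ U, ∀ x ≤ 0,
        f lam x = b + ∫ t in Iic (0 : ℝ), (k lam x t).mulVec (f lam (x + t))) ∧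
      ∀ lam ∈ U, ∀ x ≤ 0, ‖f lam x - b‖ ≤ θ * (‖b‖ * (1 - θ)⁻¹) := by
  have hθ0 : 0 ≤ θ := le_trans (by have := hk.eps_nonneg; have := hk.eta_pos; positivity) hθ
  -- `G n` is the `n`-th term of the Neumann series, of size at most `‖b‖ θ ^ n`.
  let G : ℕ → ℂ → ℝ → ι → ℂ := fun n => Nat.rec (fun _ _ => b)
    (fun _ g lam x => ∫ t in Iic (0 : ℝ), (k lam x t).mulVec (g lam (x + t))) n
  have hG0 : G 0 = fun _ _ => b := rfl
  have hGs : ∀ n, G (n + 1) = fun lam x =>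
      ∫ t in Iic (0 : ℝ), (k lam x t).mulVec (G n lam (x + t)) := fun n => rfl
  have hG : ∀ n, HoloBounded U (G n) (‖b‖ * θ ^ n) := by
    intro n
    induction n with
    | zero =>
      rw [hG0]
      exact ⟨fun _ _ => continuousOn_const, fun _ _ => differentiableOn_const _, fun _ _ _ _ => by
        simp⟩
    | succ n ih =>
      rw [hGs]
      have h := hk.step ih
      refine ⟨h.cont, h.diff, fun lam hl x hx => (h.bound lam hl x hx).trans ?_⟩
      rw [pow_succ]
      calc _ ≤ θ * (‖b‖ * θ ^ n) := mul_le_mul_of_nonneg_right hθ (by positivity)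
        _ = _ := by ring
  have hsum : Summable fun n => ‖b‖ * θ ^ n := (summable_geometric_of_lt_one hθ0 hθ1).mul_left _
  have hval : ∑' n, ‖b‖ * θ ^ n = ‖b‖ * (1 - θ)⁻¹ := by
    rw [tsum_mul_left, tsum_geometric_of_lt_one hθ0 hθ1]
  have hs : ∀ lam ∈ U, ∀ x ≤ 0, Summable fun n => G n lam x := fun lam hl x hx =>
    Summable.of_norm_bounded hsum fun n => (hG n).bound lam hl x hx
  have hf : HoloBounded U (fun lam x => ∑' n, G n lam x) (‖b‖ * (1 - θ)⁻¹) := by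
    refine ⟨fun lam hl => ?_, fun x hx => ?_, fun lam hl x hx => ?_⟩
    · exact continuousOn_tsum (fun n => (hG n).cont lam hl) hsum
        fun n x hx => (hG n).bound lam hl x hx
    · exact Complex.differentiableOn_tsum_of_summable_norm hsum (fun n => (hG n).diff x hx)
        hk.isOpen fun n lam hl => (hG n).bound lam hl x hx
    · rw [← hval]
      exact tsum_of_norm_bounded hsum.hasSum fun n => (hG n).bound lam hl x hx
  have heq : ∀ lam ∈ U, ∀ x ≤ 0, (∑' n, G n lam x)
      = b + ∫ t in Iic (0 : ℝ), (k lam x t).mulVec (∑' n, G n lam (x + t)) := by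
    intro lam hl x hx
    rw [(hs lam hl x hx).tsum_eq_zero_add]
    congr 1
    have hint := hasSum_integral_of_summable_integral_norm
      (μ := volume.restrict (Iic (0 : ℝ)))
      (F := fun n t => (k lam x t).mulVec (G n lam (x + t)))
      (fun n => hk.integrable (hG n) hl hx)
      (Summable.of_nonneg_of_le (fun n => integral_nonneg fun _ => norm_nonneg _)
        (fun n => hk.integral_norm_le (hG n) hl hx) (hsum.mul_left _))
    simp only [hGs]
    rw [hint.tsum_eq]
    refine setIntegral_congr_fun measurableSet_Iic fun t ht => ?_
    have h1 : Summable fun n => G n lam (x + t) := hs lam hl _ (by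
      simp only [mem_Iic] at ht; linarith)
    exact (h1.hasSum.mapL (LinearMap.toContinuousLinearMap (k lam x t).mulVecLin)).tsum_eq
  refine ⟨_, hf, heq, fun lam hl x hx => ?_⟩
  rw [heq lam hl x hx, add_sub_cancel_left]
  refine ((hk.step hf).bound lam hl x hx).trans ?_
  have : 0 ≤ ‖b‖ * (1 - θ)⁻¹ := by have := sub_pos.2 hθ1; positivity
  exact mul_le_mul_of_nonneg_right hθ this

end Kernel

end ZND

/-! ### Calculus and linear differential equations on the half-line. -/

namespace ZND

open MeasureTheory

section HalfLine

variable {E : Type*} [NormedAddCommGroup E] [NormedSpace ℝ E]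

/-- Freezing a function at its end value to the right of `0` makes it continuous on all of `ℝ`, so
that two-sided calculus theorems apply. -/
theorem continuous_comp_min_zero {X : Type*} [TopologicalSpace X] {h : ℝ → X}
    (hc : ContinuousOn h (Iic 0)) : Continuous fun x => h (min x 0) :=
  hc.comp_continuous (by fun_prop) fun x => mem_Iic.2 (min_le_right x 0)

theorem hasDerivWithinAt_intervalIntegral_zero [CompleteSpace E] {h : ℝ → E}
    (hc : ContinuousOn h (Iic 0)) {x : ℝ} (hx : x ≤ 0) :
    HasDerivWithinAt (fun y => ∫ s in (0 : ℝ)..y, h s) (h x) (Iic 0) x := by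
  have hc' := continuous_comp_min_zero hc
  have h1 := intervalIntegral.integral_hasDerivAt_right (a := 0) (b := x)
    (hc'.intervalIntegrable _ _) (hc'.stronglyMeasurableAtFilter _ _) hc'.continuousAt
  have h2 := h1.hasDerivWithinAt (s := Iic 0)
  rw [min_eq_left hx] at h2
  have hcongr : ∀ y ≤ (0 : ℝ), (∫ s in (0 : ℝ)..y, h s) = ∫ s in (0 : ℝ)..y, h (min s 0) := by
    intro y hy
    refine intervalIntegral.integral_congr fun s hs => ?_
    rw [uIcc_of_ge hy] at hs
    simp only [min_eq_left hs.2]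
  exact h2.congr (fun y hy => hcongr y hy) (hcongr x hx)

theorem hasDerivWithinAt_integral_Iic [CompleteSpace E] {h : ℝ → E}
    (hc : ContinuousOn h (Iic 0)) (hi : IntegrableOn h (Iic 0)) {x : ℝ} (hx : x ≤ 0) :
    HasDerivWithinAt (fun y => ∫ s in Iic y, h s) (h x) (Iic 0) x := by
  have h1 := (hasDerivWithinAt_intervalIntegral_zero hc hx).add_const (∫ s in Iic (0 : ℝ), h s)
  have hcongr : ∀ y ≤ (0 : ℝ), (∫ s in Iic y, h s)
      = (∫ s in (0 : ℝ)..y, h s) + ∫ s in Iic (0 : ℝ), h s := by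
    intro y hy
    rw [← intervalIntegral.integral_Iic_sub_Iic hi (hi.mono_set (Iic_subset_Iic.2 hy))]
    abel
  exact h1.congr (fun y hy => hcongr y hy) (hcongr x hx)

theorem integral_Iic_comp_add_left (h : ℝ → E) (x : ℝ) :
    ∫ t in Iic (0 : ℝ), h (x + t) = ∫ s in Iic x, h s := by
  rw [← (measurePreserving_add_left volume x).setIntegral_preimage_emb
    (measurableEmbedding_addLeft x) h (Iic x)]
  congr 2
  ext t
  simp

theorem eq_of_hasDerivWithinAt_zero {g : ℝ → E}
    (hg : ∀ x ≤ 0, HasDerivWithinAt g 0 (Iic 0) x) {x : ℝ} (hx : x ≤ 0) : g x = g 0 := by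
  refine (convex_Iic (0 : ℝ)).is_const_of_fderivWithin_eq_zero (𝕜 := ℝ)
    (fun y hy => (hg y hy).differentiableWithinAt) (fun y hy => ?_) hx (mem_Iic.2 le_rfl)
  have h := (hg y hy).hasFDerivWithinAt.fderivWithin ((uniqueDiffOn_Iic 0) y hy)
  rw [h]; ext; simp

/-- Integrate from `-∞`, where `g` vanishes: `c e^{ηx}` has mass `c/η` on the half-line. This will
bound the pairing of the dual mode with the source. -/
theorem norm_le_of_tendsto_zero_of_deriv_le {g g' : ℝ → E} {c η : ℝ} (hη : 0 < η)
    (hg : ∀ x ≤ 0, HasDerivWithinAt g (g' x) (Iic 0) x)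
    (hb : ∀ x ≤ 0, ‖g' x‖ ≤ c * Real.exp (η * x)) (h0 : Tendsto g atBot (𝓝 0)) :
    ‖g 0‖ ≤ c / η := by
  have key : ∀ x ≤ 0, ‖g 0 - g x‖ ≤ c / η - c / η * Real.exp (η * x) := by
    intro x hx
    have hBd : ∀ y, HasDerivAt (fun y => c / η * Real.exp (η * y) - c / η * Real.exp (η * x))
        (c * Real.exp (η * y)) y := by
      intro y
      have := ((((hasDerivAt_id y).const_mul η).exp).const_mul (c / η)).sub_const
        (c / η * Real.exp (η * x))
      refine this.congr_deriv ?_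
      simp only [id]
      field_simp
    have h := image_norm_le_of_norm_deriv_right_le_deriv_boundary' (f := fun y => g y - g x)
      (f' := g') (a := x) (b := 0)
      (B := fun y => c / η * Real.exp (η * y) - c / η * Real.exp (η * x))
      (B' := fun y => c * Real.exp (η * y))
      (fun y hy => ((hg y hy.2).continuousWithinAt.mono Icc_subset_Iic_self).sub
        continuousWithinAt_const)
      (fun y hy => ?_) (by simp) (fun y _ => (hBd y).continuousAt.continuousWithinAt)
      (fun y _ => (hBd y).hasDerivWithinAt) (fun y hy => hb y hy.2.le)
      (right_mem_Icc.2 hx)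
    · simpa using h
    · exact (((hg y hy.2.le).hasDerivAt (Iic_mem_nhds hy.2)).hasDerivWithinAt).sub_const _
  have hlim : Tendsto (fun x => ‖g 0 - g x‖) atBot (𝓝 ‖g 0‖) := by
    simpa using (h0.const_sub (g 0)).norm
  have hlim2 : Tendsto (fun x => c / η - c / η * Real.exp (η * x)) atBot (𝓝 (c / η)) := by
    have : Tendsto (fun x => Real.exp (η * x)) atBot (𝓝 0) :=
      Real.tendsto_exp_atBot.comp (tendsto_id.const_mul_atBot hη)
    simpa using (this.const_mul (c / η)).const_sub (c / η)
  exact le_of_tendsto_of_tendsto hlim hlim2 ((eventually_le_atBot 0).mono key)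

theorem monotoneOn_Iic_of_hasDerivWithinAt_nonneg {N N' : ℝ → ℝ}
    (hN : ∀ x ≤ 0, HasDerivWithinAt N (N' x) (Iic 0) x) (h0 : ∀ x ≤ 0, 0 ≤ N' x) :
    MonotoneOn N (Iic 0) := by
  have hd : ∀ x ∈ interior (Iic (0 : ℝ)), HasDerivAt N (N' x) x := fun x hx => by
    rw [interior_Iic] at hx
    exact (hN x hx.le).hasDerivAt (Iic_mem_nhds hx)
  refine monotoneOn_of_deriv_nonneg (convex_Iic 0) (fun x hx => (hN x hx).continuousWithinAt)
    (fun x hx => (hd x hx).differentiableAt.differentiableWithinAt) fun x hx => ?_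
  rw [(hd x hx).deriv]
  exact h0 x (interior_subset hx : x ∈ Iic 0)

/-- Grönwall with integrating factor `exp (-θx + (k/η) e^{ηx})`: an integrable perturbation of the
rate costs only the constant `exp (k/η)`. -/
theorem decay_of_deriv_ge {N N' : ℝ → ℝ} {θ k η : ℝ} (hη : 0 < η) (hk : 0 ≤ k)
    (hN : ∀ x ≤ 0, HasDerivWithinAt N (N' x) (Iic 0) x) (hN0 : ∀ x ≤ 0, 0 ≤ N x)
    (h : ∀ x ≤ 0, (θ - k * Real.exp (η * x)) * N x ≤ N' x) {x : ℝ} (hx : x ≤ 0) :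
    N x ≤ N 0 * Real.exp (k / η) * Real.exp (θ * x) := by
  set Q : ℝ → ℝ := fun x => -θ * x + k / η * Real.exp (η * x) with hQ
  have hQd : ∀ x, HasDerivAt Q (-θ + k * Real.exp (η * x)) x := by
    intro x
    have := ((hasDerivAt_id x).const_mul (-θ)).add
      ((((hasDerivAt_id x).const_mul η).exp).const_mul (k / η))
    refine this.congr_deriv ?_
    simp only [id]
    field_simp
  have hmono := monotoneOn_Iic_of_hasDerivWithinAt_nonneg
    (N := fun x => N x * Real.exp (Q x))
    (fun x hx => (hN x hx).mul ((hQd x).exp.hasDerivWithinAt)) (fun x hx => by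
      have := h x hx
      have h2 := (Real.exp_pos (Q x)).le
      nlinarith [mul_nonneg (sub_nonneg.2 this) h2])
  have h1 := hmono hx (mem_Iic.2 le_rfl) hx
  have hQ0 : Q 0 = k / η := by simp [hQ]
  simp only [hQ0] at h1
  have h2 : -θ * x ≤ Q x := by
    have : 0 ≤ k / η * Real.exp (η * x) := by positivity
    simp only [hQ]; linarith
  have h3 : N x * Real.exp (-θ * x) ≤ N 0 * Real.exp (k / η) :=
    (mul_le_mul_of_nonneg_left (Real.exp_le_exp.2 h2) (hN0 x hx)).trans h1
  calc N x = N x * Real.exp (-θ * x) * Real.exp (θ * x) := by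
        rw [mul_assoc, ← Real.exp_add]; simp
    _ ≤ _ := mul_le_mul_of_nonneg_right h3 (Real.exp_pos _).le

end HalfLine

section LinearODE

variable {ι : Type*} [Fintype ι] {M : ℝ → Matrix ι ι ℂ}

theorem exists_bound_on_Icc (hM : ∀ i j, ContinuousOn (fun x => M x i j) (Iic 0)) (a : ℝ) :
    ∃ K : ℝ, 0 ≤ K ∧ ∀ x ∈ Icc a 0, ∀ i j, ‖M x i j‖ ≤ K := by
  have h : ∀ i j, ∃ K, ∀ x ∈ Icc a 0, ‖M x i j‖ ≤ K := fun i j =>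
    isCompact_Icc.exists_bound_of_continuousOn ((hM i j).mono Icc_subset_Iic_self)
  choose K hK using h
  refine ⟨∑ i, ∑ j, |K i j|, Finset.sum_nonneg fun i _ => Finset.sum_nonneg fun j _ =>
    abs_nonneg _, fun x hx i j => ?_⟩
  calc ‖M x i j‖ ≤ |K i j| := (hK i j x hx).trans (le_abs_self _)
    _ ≤ ∑ j, |K i j| := Finset.single_le_sum (f := fun j => |K i j|)
        (fun j _ => abs_nonneg _) (Finset.mem_univ j)
    _ ≤ _ := Finset.single_le_sum (f := fun i => ∑ j, |K i j|)
        (fun i _ => Finset.sum_nonneg fun j _ => abs_nonneg _) (Finset.mem_univ i)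

/-- Uniqueness for linear systems on the half-line with data at its end point. -/
theorem linearODE_unique (hM : ∀ i j, ContinuousOn (fun x => M x i j) (Iic 0)) {Y Z : ℝ → ι → ℂ}
    (hY : ∀ x ≤ 0, HasDerivWithinAt Y ((M x).mulVec (Y x)) (Iic 0) x)
    (hZ : ∀ x ≤ 0, HasDerivWithinAt Z ((M x).mulVec (Z x)) (Iic 0) x) (h0 : Y 0 = Z 0)
    {x : ℝ} (hx : x ≤ 0) : Y x = Z x := by
  obtain ⟨K, hK0, hK⟩ := exists_bound_on_Icc hM x
  refine ODE_solution_unique_of_mem_Icc_left (v := fun t y => (M t).mulVec y) (s := fun _ => univ)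
    (K := (Fintype.card ι * K).toNNReal) (a := x) (b := 0) (fun t ht => ?_)
    (fun t ht => (hY t ht.2).continuousWithinAt.mono Icc_subset_Iic_self)
    (fun t ht => (hY t ht.2).mono (Iic_subset_Iic.2 ht.2)) (fun _ _ => mem_univ _)
    (fun t ht => (hZ t ht.2).continuousWithinAt.mono Icc_subset_Iic_self)
    (fun t ht => (hZ t ht.2).mono (Iic_subset_Iic.2 ht.2)) (fun _ _ => mem_univ _) h0
    (left_mem_Icc.2 hx)
  refine (LipschitzWith.of_dist_le_mul fun y z => ?_).lipschitzOnWith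
  rw [dist_eq_norm, dist_eq_norm, ← Matrix.mulVec_sub, Real.coe_toNNReal _ (by positivity)]
  exact norm_mulVec_le_card _ _ hK0 (hK t ⟨ht.1.le, ht.2⟩)

/-- Global existence for linear systems on the half-line with data at its end point. -/
theorem exists_linearODE_solution (hM : ∀ i j, ContinuousOn (fun x => M x i j) (Iic 0))
    (v : ι → ℂ) : ∃ Y : ℝ → ι → ℂ, Y 0 = v ∧
      ∀ x ≤ 0, HasDerivWithinAt Y ((M x).mulVec (Y x)) (Iic 0) x := by
  let A : ℝ → Matrix ι ι ℂ := fun x => M (min x 0)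
  have hA : ∀ i j, Continuous fun x => A x i j := fun i j => continuous_comp_min_zero (hM i j)
  let g : ℕ → ℝ → ι → ℂ := fun n => Nat.rec (fun _ => v)
    (fun _ g x => ∫ s in (0 : ℝ)..x, (A s).mulVec (g s)) n
  have hmul : ∀ {h : ℝ → ι → ℂ}, Continuous h → Continuous fun s => (A s).mulVec (h s) := by
    intro h hh
    refine continuous_pi fun i => ?_
    simp only [Matrix.mulVec, dotProduct]
    exact continuous_finsetSum _ fun j _ => (hA i j).mul ((continuous_apply j).comp hh)
  have hprim : ∀ {h : ℝ → ι → ℂ}, Continuous h → ∀ x,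
      HasDerivAt (fun x => ∫ s in (0 : ℝ)..x, h s) (h x) x := fun hh x =>
    intervalIntegral.integral_hasDerivAt_right (hh.intervalIntegrable _ _)
      (hh.stronglyMeasurableAtFilter _ _) hh.continuousAt
  have hg : ∀ n, Continuous (g n) := by
    intro n
    induction n with
    | zero => exact continuous_const
    | succ n ih =>
      exact continuous_iff_continuousAt.2 fun x => (hprim (hmul ih) x).continuousAt
  let g' : ℕ → ℝ → ι → ℂ := fun n x => n.casesOn 0 fun n => (A x).mulVec (g n x)
  have hg' : ∀ n x, HasDerivAt (g n) (g' n x) x := by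
    intro n x
    cases n with
    | zero => exact hasDerivAt_const x v
    | succ n => exact hprim (hmul (hg n)) x
  have hbd : ∀ R : ℝ, 0 ≤ R → ∃ K, 0 ≤ K ∧ ∀ n, ∀ x, |x| ≤ R →
      ‖g n x‖ ≤ ‖v‖ * ((K * |x|) ^ n / n.factorial) ∧ ‖(A x).mulVec (g n x)‖ ≤ K * ‖g n x‖ := by
    intro R hR
    obtain ⟨K, hK0, hK⟩ := exists_bound_on_Icc hM (-R)
    have hAb : ∀ x, |x| ≤ R → ∀ w : ι → ℂ, ‖(A x).mulVec w‖ ≤ Fintype.card ι * K * ‖w‖ :=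
      fun x hx w => norm_mulVec_le_card _ _ hK0
        (hK _ ⟨le_min (abs_le.1 hx).1 (by linarith), min_le_right _ _⟩)
    refine ⟨Fintype.card ι * K, by positivity, fun n => ?_⟩
    induction n with
    | zero => exact fun x hx => ⟨by simp [g], hAb x hx _⟩
    | succ n ih =>
      refine fun x hx => ⟨?_, hAb x hx _⟩
      -- Rescaling to `[0, 1]` treats both signs of `x` at once, and `∫ t ^ n` supplies the factor
      -- `1/(n+1)` of the factorial.
      have hsub : g (n + 1) x = x • ∫ t in (0 : ℝ)..1, (A (t * x)).mulVec (g n (t * x)) := by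
        rw [intervalIntegral.smul_integral_comp_mul_right (fun s => (A s).mulVec (g n s)) x]
        simp [g]
      set L := (Fintype.card ι : ℝ) * K with hL
      have hL0 : 0 ≤ L := by positivity
      have hint : ‖∫ t in (0 : ℝ)..1, (A (t * x)).mulVec (g n (t * x))‖
          ≤ ∫ t in (0 : ℝ)..1, L * (‖v‖ * ((L * |x|) ^ n / n.factorial)) * t ^ n := by
        refine intervalIntegral.norm_integral_le_of_norm_le zero_le_one
          (Eventually.of_forall fun t ht => ?_) (Continuous.intervalIntegrable (by fun_prop) _ _)
        have htx : |t * x| ≤ R := by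
          rw [abs_mul, abs_of_pos ht.1]
          nlinarith [abs_nonneg x, ht.2]
        refine (hAb _ htx _).trans ?_
        have h2 := (ih (t * x) htx).1
        rw [abs_mul, abs_of_pos ht.1] at h2
        calc _ ≤ L * (‖v‖ * ((L * (t * |x|)) ^ n / n.factorial)) :=
              mul_le_mul_of_nonneg_left h2 hL0
          _ = _ := by rw [mul_left_comm L t, mul_pow]; ring
      rw [hsub, norm_smul, Real.norm_eq_abs]
      refine (mul_le_mul_of_nonneg_left hint (abs_nonneg x)).trans (le_of_eq ?_)
      rw [intervalIntegral.integral_const_mul, integral_pow, Nat.factorial_succ]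
      push_cast
      have : (n.factorial : ℝ) ≠ 0 := by positivity
      field_simp
      ring
  have hderiv : ∀ x, HasDerivAt (fun y => ∑' n, g n y) ((A x).mulVec (∑' n, g n x)) x := by
    intro x
    set R := |x| + 1 with hR
    have hR0 : 0 ≤ R := by positivity
    obtain ⟨K, hK0, hK⟩ := hbd R hR0
    have hs : Summable fun n : ℕ => ‖v‖ * ((K * R) ^ n / n.factorial) :=
      (Real.summable_pow_div_factorial _).mul_left _
    have hle : ∀ n, ∀ y, |y| ≤ R → ‖g n y‖ ≤ ‖v‖ * ((K * R) ^ n / n.factorial) := by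
      intro n y hy
      refine ((hK n y hy).1).trans ?_
      gcongr
    let u : ℕ → ℝ := fun n => n.casesOn 0 fun n => K * (‖v‖ * ((K * R) ^ n / n.factorial))
    have hu : Summable u := (summable_nat_add_iff 1).1 (hs.mul_left K)
    have hsum : ∀ y, |y| ≤ R → Summable fun n => g n y := fun y hy =>
      Summable.of_norm_bounded hs fun n => hle n y hy
    have hxR : |x| ≤ R := by linarith
    have h := hasDerivAt_tsum_of_isPreconnected (t := Ioo (-R) R) hu isOpen_Ioo isPreconnected_Ioo
      (g := g) (g' := g') (y₀ := x) (y := x) (fun n y _ => hg' n y) (fun n y hy => ?_)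
      (by rw [mem_Ioo, ← abs_lt]; linarith) (hsum x hxR) (by rw [mem_Ioo, ← abs_lt]; linarith)
    · refine h.congr_deriv ?_
      have hsg : Summable fun n => (A x).mulVec (g n x) :=
        (hsum x hxR).mapL (LinearMap.toContinuousLinearMap (A x).mulVecLin)
      have hsg' : Summable fun n => g' n x := (summable_nat_add_iff 1).1 hsg
      rw [hsg'.tsum_eq_zero_add]
      refine (zero_add _).trans ?_
      exact ((hsum x hxR).hasSum.mapL
        (LinearMap.toContinuousLinearMap (A x).mulVecLin)).tsum_eq
    · have hyR : |y| ≤ R := (abs_lt.2 hy).le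
      cases n with
      | zero => simp [g', u]
      | succ n =>
        exact ((hK n y hyR).2).trans (mul_le_mul_of_nonneg_left (hle n y hyR) hK0)
  refine ⟨fun y => ∑' n, g n y, ?_, fun x hx => ?_⟩
  · have h0 : ∀ n ≠ 0, g n 0 = 0 := fun n hn => by
      obtain ⟨m, rfl⟩ := Nat.exists_eq_succ_of_ne_zero hn
      simp [g]
    exact tsum_eq_single 0 h0
  · have h := (hderiv x).hasDerivWithinAt (s := Iic 0)
    simpa only [A, min_eq_left hx] using h

end LinearODE

end ZND

/-! ### Weakly coupled damped systems, solved as integral equations from `-∞`. -/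

namespace ZND

open MeasureTheory

section DampedSystem

variable {ι : Type*}

/-- Coefficients of the system `f_k' = -(λ μ_k + d_k) f_k - ∑ j, B_jk f_j` on the half-line:
transport speeds `μ`, damping `d`, and a coupling `B` whose `k`-th column decays exponentially
unless the `k`-th component is damped. -/
structure DampedSystem (μ d : ι → ℝ → ℝ) (B : ℝ → Matrix ι ι ℝ) (K ε η : ℝ) : Prop where
  eta_pos : 0 < η
  eps_nonneg : 0 ≤ ε
  K_pos : 0 < K
  mu_cont : ∀ k, ContinuousOn (μ k) (Iic 0)
  d_cont : ∀ k, ContinuousOn (d k) (Iic 0)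
  B_cont : ∀ j k, ContinuousOn (fun x => B x j k) (Iic 0)
  mu_nonneg : ∀ k, ∀ x ≤ 0, 0 ≤ μ k x
  mu_le : ∀ k, ∀ x ≤ 0, μ k x ≤ K
  d_nonneg : ∀ k, ∀ x ≤ 0, 0 ≤ d k x
  coupling : ∀ k, (∀ j, ∀ x ≤ 0, |B x j k| ≤ ε * Real.exp (η * x)) ∨
    ((∀ j, ∀ x ≤ 0, |B x j k| ≤ ε) ∧ ∀ x ≤ 0, η ≤ d k x)

/-- Primitive vanishing at `0`. -/
def prim (h : ℝ → ℝ) (x : ℝ) : ℝ := ∫ s in (0 : ℝ)..x, h s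

theorem prim_zero (h : ℝ → ℝ) : prim h 0 = 0 := by simp [prim]

theorem hasDerivWithinAt_prim {h : ℝ → ℝ} (hc : ContinuousOn h (Iic 0)) {x : ℝ} (hx : x ≤ 0) :
    HasDerivWithinAt (prim h) (h x) (Iic 0) x :=
  hasDerivWithinAt_intervalIntegral_zero hc hx

theorem continuousOn_prim {h : ℝ → ℝ} (hc : ContinuousOn h (Iic 0)) :
    ContinuousOn (prim h) (Iic 0) := fun _ hx =>
  (hasDerivWithinAt_prim hc hx).continuousWithinAt

theorem prim_add_sub_le {h : ℝ → ℝ} (hc : ContinuousOn h (Iic 0)) {c : ℝ}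
    (hle : ∀ x ≤ 0, c ≤ h x) {x t : ℝ} (hx : x ≤ 0) (ht : t ≤ 0) :
    prim h (x + t) - prim h x ≤ c * t := by
  have hm := monotoneOn_Iic_of_hasDerivWithinAt_nonneg (N := fun x => prim h x - c * x)
    (N' := fun x => h x - c)
    (fun x hx => ((hasDerivWithinAt_prim hc hx).sub
      ((hasDerivWithinAt_id x _).const_mul c)).congr_deriv (by simp))
    fun x hx => sub_nonneg.2 (hle x hx)
  have := hm (show x + t ∈ Iic 0 by simp only [mem_Iic]; linarith) hx (by linarith)
  simp only at this
  linarith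

theorem le_prim_add_sub {h : ℝ → ℝ} (hc : ContinuousOn h (Iic 0)) {c : ℝ}
    (hle : ∀ x ≤ 0, h x ≤ c) {x t : ℝ} (hx : x ≤ 0) (ht : t ≤ 0) :
    c * t ≤ prim h (x + t) - prim h x := by
  have hm := monotoneOn_Iic_of_hasDerivWithinAt_nonneg (N := fun x => c * x - prim h x)
    (N' := fun x => c - h x)
    (fun x hx => (((hasDerivWithinAt_id x _).const_mul c).sub
      (hasDerivWithinAt_prim hc hx)).congr_deriv (by simp))
    fun x hx => sub_nonneg.2 (hle x hx)
  have := hm (show x + t ∈ Iic 0 by simp only [mem_Iic]; linarith) hx (by linarith)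
  simp only at this
  linarith

variable {μ d : ι → ℝ → ℝ} {B : ℝ → Matrix ι ι ℝ} {K ε η : ℝ}

/-- Phase `λ m_k + Δ_k`, where `m_k' = μ_k` and `Δ_k' = d_k`. -/
def phase (μ d : ι → ℝ → ℝ) (lam : ℂ) (k : ι) (x : ℝ) : ℂ :=
  lam * (prim (μ k) x : ℂ) + (prim (d k) x : ℂ)

/-- Kernel of the integral form of the damped system. -/
def dampedKernel (μ d : ι → ℝ → ℝ) (B : ℝ → Matrix ι ι ℝ) (lam : ℂ) (x t : ℝ) : Matrix ι ι ℂ :=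
  Matrix.of fun k j =>
    -(Complex.exp (phase μ d lam k (x + t) - phase μ d lam k x) * (B (x + t) j k : ℂ))

theorem DampedSystem.continuousOn_phase (h : DampedSystem μ d B K ε η) (lam : ℂ) (k : ι) :
    ContinuousOn (phase μ d lam k) (Iic 0) :=
  (continuousOn_const.mul (Complex.continuous_ofReal.comp_continuousOn
    (continuousOn_prim (h.mu_cont k)))).add (Complex.continuous_ofReal.comp_continuousOn
    (continuousOn_prim (h.d_cont k)))

theorem DampedSystem.hasDerivWithinAt_phase (h : DampedSystem μ d B K ε η) (lam : ℂ) (k : ι)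
    {x : ℝ} (hx : x ≤ 0) :
    HasDerivWithinAt (phase μ d lam k) (lam * (μ k x : ℂ) + (d k x : ℂ)) (Iic 0) x :=
  ((hasDerivWithinAt_prim (h.mu_cont k) hx).ofReal_comp.const_mul lam).add
    (hasDerivWithinAt_prim (h.d_cont k) hx).ofReal_comp

/-- A factor `e^{ηt}` is available, from the decay of the coupling or from the damping. Half of it
pays for a slightly negative `Re λ`: since `0 ≤ μ ≤ K`, the transport factor is at most `e^{-ηt/2}`
when `Re λ > -η/(2K)`. Nothing depends on `Im λ`. -/
theorem DampedSystem.norm_kernel_le (h : DampedSystem μ d B K ε η) {lam : ℂ}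
    (hl : -(η / (2 * K)) < lam.re) {x t : ℝ} (hx : x ≤ 0) (ht : t ≤ 0) (k j : ι) :
    ‖dampedKernel μ d B lam x t k j‖ ≤ ε * Real.exp (η / 2 * t) := by
  have hη := h.eta_pos
  have hK := h.K_pos
  have hre : (phase μ d lam k (x + t) - phase μ d lam k x).re
      = lam.re * (prim (μ k) (x + t) - prim (μ k) x)
        + (prim (d k) (x + t) - prim (d k) x) := by
    simp [phase, Complex.add_re, Complex.mul_re]; ring
  have hm1 := prim_add_sub_le (h.mu_cont k) (h.mu_nonneg k) hx ht
  have hm2 := le_prim_add_sub (h.mu_cont k) (h.mu_le k) hx ht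
  have hlam : lam.re * (prim (μ k) (x + t) - prim (μ k) x) ≤ -(η / 2 * t) := by
    set m := prim (μ k) (x + t) - prim (μ k) x
    have e1 : η / (2 * K) * (K * t) = η / 2 * t := by field_simp
    have h2 : 0 < η / (2 * K) := by positivity
    nlinarith [mul_nonneg (by linarith : (0 : ℝ) ≤ lam.re + η / (2 * K))
      (by linarith : (0 : ℝ) ≤ -m), mul_nonneg h2.le (by linarith : (0 : ℝ) ≤ m - K * t)]
  rw [dampedKernel, Matrix.of_apply, norm_neg, norm_mul, Complex.norm_exp, hre, Complex.norm_real,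
    Real.norm_eq_abs]
  have hxt : x + t ≤ 0 := by linarith
  rcases h.coupling k with hB | ⟨hB, hd⟩
  · have hd1 := prim_add_sub_le (h.d_cont k) (h.d_nonneg k) hx ht
    calc _ ≤ Real.exp (-(η / 2 * t)) * (ε * Real.exp (η * (x + t))) :=
          mul_le_mul (Real.exp_le_exp.2 (by linarith)) (hB j _ hxt) (abs_nonneg _)
            (Real.exp_pos _).le
      _ = ε * Real.exp (-(η / 2 * t) + η * (x + t)) := by rw [Real.exp_add]; ring
      _ ≤ _ := mul_le_mul_of_nonneg_left (Real.exp_le_exp.2 (by nlinarith)) h.eps_nonneg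
  · have hd1 := prim_add_sub_le (h.d_cont k) hd hx ht
    calc _ ≤ Real.exp (η / 2 * t) * ε :=
          mul_le_mul (Real.exp_le_exp.2 (by linarith)) (hB j _ hxt) (abs_nonneg _)
            (Real.exp_pos _).le
      _ = _ := mul_comm _ _

variable [Fintype ι]

theorem DampedSystem.holoKernel (h : DampedSystem μ d B K ε η) :
    HoloKernel {lam : ℂ | -(η / (2 * K)) < lam.re} (dampedKernel μ d B) ε (η / 2) where
  isOpen := isOpen_lt continuous_const Complex.continuous_re
  eta_pos := half_pos h.eta_pos
  eps_nonneg := h.eps_nonneg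
  cont lam _ k j := by
    have hadd : MapsTo (fun y : ℝ × ℝ => y.1 + y.2) (Iic 0 ×ˢ Iic 0) (Iic 0) := fun y hy => by
      simp only [mem_prod, mem_Iic] at hy ⊢; linarith [hy.1, hy.2]
    have hph := h.continuousOn_phase lam k
    have h1 := hph.comp (f := fun y : ℝ × ℝ => y.1 + y.2) (by fun_prop) hadd
    have h2 := hph.comp (f := fun y : ℝ × ℝ => y.1) (by fun_prop)
      fun y (hy : y ∈ Iic (0 : ℝ) ×ˢ Iic (0 : ℝ)) => hy.1
    have h3 := Complex.continuous_ofReal.comp_continuousOn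
      ((h.B_cont j k).comp (f := fun y : ℝ × ℝ => y.1 + y.2) (by fun_prop) hadd)
    exact ((Complex.continuous_exp.comp_continuousOn (h1.sub h2)).mul h3).neg
  diff x _ t _ k j := by
    simp only [dampedKernel, Matrix.of_apply, phase]
    fun_prop
  bound lam hl x hx t ht k j := h.norm_kernel_le hl hx ht k j

/-- Solutions of a weakly coupled damped system that stay close to a constant vector supported on
the neutral components, holomorphic in the spectral parameter. -/
theorem DampedSystem.exists_solution (h : DampedSystem μ d B K ε η) (b : ι → ℂ)
    (hb : ∀ k, b k = 0 ∨ ∀ x ≤ 0, μ k x = 0 ∧ d k x = 0) {θ : ℝ}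
    (hθ : Fintype.card ι * ε / (η / 2) ≤ θ) (hθ1 : θ < 1) :
    ∃ f : ℂ → ℝ → ι → ℂ,
      (∀ x ≤ 0, DifferentiableOn ℂ (fun lam => f lam x) {lam : ℂ | -(η / (2 * K)) < lam.re}) ∧
      ∀ lam : ℂ, -(η / (2 * K)) < lam.re → ∀ x ≤ 0,
        ‖f lam x - b‖ ≤ θ * (‖b‖ * (1 - θ)⁻¹) ∧
        ∀ k, HasDerivWithinAt (fun x => f lam x k)
          (-((lam * (μ k x : ℂ) + (d k x : ℂ)) * f lam x k) - ∑ j, (B x j k : ℂ) * f lam x j)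
          (Iic 0) x := by
  obtain ⟨f, hf, heq, hest⟩ := h.holoKernel.exists_fixedPoint b hθ hθ1
  refine ⟨f, hf.diff, fun lam hl x hx => ⟨hest lam hl x hx, fun k => ?_⟩⟩
  set ph := phase μ d lam k with hph
  let n : ℝ → ℂ := fun s => ∑ j, (B s j k : ℂ) * f lam s j
  let g : ℝ → ℂ := fun s => Complex.exp (ph s) * n s
  have hphc := h.continuousOn_phase lam k
  have hn : ContinuousOn n (Iic 0) := continuousOn_finsetSum _ fun j _ =>
    (Complex.continuous_ofReal.comp_continuousOn (h.B_cont j k)).mul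
      (continuousOn_pi.1 (hf.cont lam hl) j)
  have hg : ContinuousOn g (Iic 0) := (Complex.continuous_exp.comp_continuousOn hphc).mul hn
  have hker : ∀ y ≤ 0, ∀ t, (dampedKernel μ d B lam y t).mulVec (f lam (y + t)) k
      = -Complex.exp (-ph y) * g (y + t) := by
    intro y _ t
    simp only [Matrix.mulVec, dotProduct, dampedKernel, Matrix.of_apply, g, n, Finset.mul_sum]
    refine Finset.sum_congr rfl fun j _ => ?_
    rw [← hph, sub_eq_add_neg, Complex.exp_add]
    ring
  have hci : ∀ y ≤ 0, ∀ i, Integrable (fun t => (dampedKernel μ d B lam y t).mulVec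
      (f lam (y + t)) i) (volume.restrict (Iic (0 : ℝ))) := fun y hy i =>
    (h.holoKernel.integrable hf hl hy).eval i
  have hgi : IntegrableOn g (Iic 0) := by
    refine ((hci 0 le_rfl k).const_mul (-Complex.exp (ph 0))).congr
      (Eventually.of_forall fun t => ?_)
    simp only
    rw [hker 0 le_rfl, zero_add, ← mul_assoc, neg_mul_neg, ← Complex.exp_add]
    simp
  -- Undoing the translation gives the variation-of-constants formula, which can be differentiated
  -- in its upper limit.
  have hrep : ∀ y ≤ 0, f lam y k = b k - Complex.exp (-ph y) * ∫ s in Iic y, g s := by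
    intro y hy
    have h1 := congrFun (heq lam hl y hy) k
    rw [Pi.add_apply, eval_integral (hci y hy)] at h1
    simp only [hker y hy] at h1
    rw [h1, integral_const_mul, integral_Iic_comp_add_left]
    ring
  have hI := hasDerivWithinAt_integral_Iic hg hgi hx
  have hE := ((h.hasDerivWithinAt_phase lam k hx).neg.cexp).mul hI
  have hD := (hE.const_sub (b k)).congr (fun y hy => hrep y hy) (hrep x hx)
  refine hD.congr_deriv ?_
  have hxk := hrep x hx
  have hexp : Complex.exp (-ph x) * g x = n x := by
    simp only [g]
    rw [← mul_assoc, ← Complex.exp_add]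
    simp
  -- The constant vector solves the uncoupled system because it lives on components with neither
  -- transport nor damping.
  have hbk : (lam * (μ k x : ℂ) + (d k x : ℂ)) * b k = 0 := by
    rcases hb k with h0 | h0
    · rw [h0, mul_zero]
    · rw [(h0 x hx).1, (h0 x hx).2]; simp
  change _ = -((lam * (μ k x : ℂ) + (d k x : ℂ)) * f lam x k) - n x
  rw [← hexp, hxk]
  simp only [← hph, Pi.neg_apply]
  linear_combination hbk

end DampedSystem

end ZND

/-! ### Algebra of the characteristic frame. -/

namespace ZND

/-- `(Γ + 1) p - τ`, positive exactly when the flow is subsonic relative to the shock. -/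
def gap (P : Params) (V : State) : ℝ := (P.Gam + 1) * pressure P V - V 0

/-- Acoustic impedance `√((Γ + 1) p τ) = τ C`. -/
def impedance (P : Params) (V : State) : ℝ := Real.sqrt ((P.Gam + 1) * pressure P V * V 0)

/-- Arrhenius rate at a state. -/
def rate (P : Params) (V : State) : ℝ := ignition P (temperature P V)

/-- Derivative of the reaction rate with respect to the internal energy. -/
def rateEnergyDeriv (P : Params) (V : State) : ℝ :=
  ignitionDeriv P (temperature P V) * V 3 / P.cv

/-- `u' / Γ` along a profile. -/
def strain (P : Params) (V : State) : ℝ := P.q * rate P V * V 3 / gap P V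

/-- Left eigenvectors of the flux Jacobian (two acoustic ones, entropy, reactant), as rows. -/
def charMat (P : Params) (ρ : ℝ) (V : State) : Matrix (Fin 4) (Fin 4) ℝ :=
  !![-pressure P V, impedance P V - P.Gam * V 1, P.Gam, 0;
     -pressure P V, -impedance P V - P.Gam * V 1, P.Gam, 0;
     pressure P V, -V 1, 1, 0;
     -- The weight balances the two reaction couplings: the effect of the reactant on the gas
     -- becomes `q/ρ ≤ ρ` when `q ≤ ρ²`, and that of the gas on the reactant becomes `O(ρ)`.
     0, 0, 0, ρ]

/-- Reciprocals of the characteristic speeds. -/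
def slowness (P : Params) (V : State) : Fin 4 → ℝ :=
  ![(impedance P V + V 0) / gap P V, -((impedance P V - V 0) / gap P V), -1, -1]

/-- Derivative of the impedance along a profile. -/
def impedanceDer (P : Params) (V : State) : ℝ :=
  (P.Gam + 1) * P.Gam * strain P V * (V 0 - pressure P V) / (2 * impedance P V)

/-- Derivative of `charMat` along a profile. -/
def charMatDer (P : Params) (V : State) : Matrix (Fin 4) (Fin 4) ℝ :=
  !![-(P.Gam * strain P V), impedanceDer P V - P.Gam * (P.Gam * strain P V), 0, 0;
     -(P.Gam * strain P V), -impedanceDer P V - P.Gam * (P.Gam * strain P V), 0, 0;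
     P.Gam * strain P V, -(P.Gam * strain P V), 0, 0;
     0, 0, 0, 0]

/-- Components of the reaction direction `(0, 0, q, -1)` in characteristic coordinates. -/
def reactionChar (P : Params) (ρ : ℝ) : Fin 4 → ℝ := ![P.Gam * P.q, P.Gam * P.q, P.q, -ρ]

/-- Response of the reaction rate to characteristic perturbations. -/
def rateResponse (P : Params) (V : State) : Fin 4 → ℝ :=
  ![rateEnergyDeriv P V / (P.Gam + 1) * ((impedance P V + V 0) / (2 * gap P V)),
    -(rateEnergyDeriv P V / (P.Gam + 1) * ((impedance P V - V 0) / (2 * gap P V))),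
    -(rateEnergyDeriv P V / (P.Gam + 1)), 0]

/-- Part of the coupling matrix due to the variation of the profile. -/
def geomCoupling (P : Params) (V : State) : Matrix (Fin 4) (Fin 4) ℝ :=
  let a := P.Gam / impedance P V * strain P V / 2
  let d := strain P V * (V 0 - pressure P V) / (4 * internalEnergy V)
  let h := P.Gam * strain P V / (2 * pressure P V * (P.Gam + 1))
  !![-(P.Gam * a) + d + h, P.Gam * a - d + h, -(2 * P.Gam * h), 0;
     -(P.Gam * a) - d + h, P.Gam * a + d + h, -(2 * P.Gam * h), 0;
     -a - h, a - h, 2 * P.Gam * h, 0;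
     0, 0, 0, 0]

/-- Coupling matrix in characteristic coordinates, without the damping `φ` of the reactant. -/
def couplingMat (P : Params) (ρ : ℝ) (V : State) : Matrix (Fin 4) (Fin 4) ℝ :=
  geomCoupling P V + Matrix.of fun j k => reactionChar P ρ j *
    (rateResponse P V k - if k = 3 then (if j = 3 then 0 else rate P V / ρ) else 0)

/-- Damping of the reactant. -/
def damping (P : Params) (V : State) : Fin 4 → ℝ := ![0, 0, 0, rate P V]

/-- Non-degenerate subsonic states. -/
structure IsSubsonic (P : Params) (V : State) : Prop where
  gam_pos : 0 < P.Gam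
  tau_pos : 0 < V 0
  energy_pos : 0 < internalEnergy V
  gap_pos : 0 < gap P V

section Algebra

variable {P : Params} {V : State}

theorem IsSubsonic.pressure_pos (h : IsSubsonic P V) : 0 < pressure P V :=
  div_pos (mul_pos h.gam_pos h.energy_pos) h.tau_pos

theorem IsSubsonic.impedance_pos (h : IsSubsonic P V) : 0 < impedance P V :=
  Real.sqrt_pos.2 (mul_pos (mul_pos (by linarith [h.gam_pos]) h.pressure_pos) h.tau_pos)

theorem IsSubsonic.impedance_sq (h : IsSubsonic P V) :
    impedance P V ^ 2 = (P.Gam + 1) * pressure P V * V 0 :=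
  Real.sq_sqrt (mul_pos (mul_pos (by linarith [h.gam_pos]) h.pressure_pos) h.tau_pos).le

theorem IsSubsonic.pressure_eq (h : IsSubsonic P V) :
    pressure P V = impedance P V ^ 2 / ((P.Gam + 1) * V 0) := by
  have := h.gam_pos
  have := h.tau_pos
  rw [h.impedance_sq]; field_simp

theorem IsSubsonic.energy_eq (h : IsSubsonic P V) :
    internalEnergy V = impedance P V ^ 2 / ((P.Gam + 1) * P.Gam) := by
  have := h.gam_pos
  have := h.tau_pos
  rw [h.impedance_sq, pressure]; field_simp

theorem IsSubsonic.gap_eq (h : IsSubsonic P V) :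
    gap P V = (impedance P V ^ 2 - V 0 ^ 2) / V 0 := by
  have := h.tau_pos
  rw [h.impedance_sq, gap]; field_simp

theorem IsSubsonic.tau_lt_impedance (h : IsSubsonic P V) : V 0 < impedance P V := by
  have h1 := h.gap_eq ▸ h.gap_pos
  rw [div_pos_iff_of_pos_right h.tau_pos] at h1
  exact lt_of_pow_lt_pow_left₀ 2 h.impedance_pos.le (by linarith)

/-- Substituting `p = D²/((Γ+1)τ)` makes the impedance `D` a free variable, so the eigenvector
relations become rational identities without square roots. `charMatDer_eq` and `rateCovector_eq` use
the same substitution. -/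
theorem IsSubsonic.slowness_mul (h : IsSubsonic P V) (ρ : ℝ) :
    Matrix.diagonal (slowness P V) * charMat P ρ V * fluxJac P V = charMat P ρ V := by
  have hG := h.gam_pos
  have hτ := h.tau_pos
  have hlt := h.tau_lt_impedance
  have hp := h.pressure_eq
  have hg := h.gap_eq
  simp only [slowness, charMat, fluxJac]
  rw [hg]
  generalize impedance P V = D at *
  generalize pressure P V = p at *
  generalize V 0 = τ at *
  subst hp
  have h1 : D ^ 2 - τ ^ 2 ≠ 0 := by nlinarith
  have hD : D ≠ 0 := by linarith
  ext i j
  fin_cases i <;> fin_cases j <;>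
    simp [Matrix.mul_apply, Fin.sum_univ_four, Matrix.diagonal_apply] <;> field_simp <;> ring

theorem IsSubsonic.charMatDer_eq (h : IsSubsonic P V) (ρ : ℝ) :
    charMatDer P V = geomCoupling P V * charMat P ρ V := by
  have hG := h.gam_pos
  have hτ := h.tau_pos
  have hlt := h.tau_lt_impedance
  have hp := h.pressure_eq
  have he := h.energy_eq
  simp only [charMat, charMatDer, geomCoupling, impedanceDer]
  generalize strain P V = r
  rw [he]
  generalize impedance P V = D at *
  generalize pressure P V = p at *
  generalize V 0 = τ at *
  subst hp
  have hD : D ≠ 0 := by linarith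
  ext i j
  fin_cases i <;> fin_cases j <;> simp [Matrix.mul_apply, Fin.sum_univ_four] <;> field_simp <;>
    ring

/-- Differential of the reaction rate `φ(T) z`. -/
def rateCovector (P : Params) (V : State) : Fin 4 → ℝ :=
  ![0, -(rateEnergyDeriv P V * V 1), rateEnergyDeriv P V, rate P V]

/-- The source is the scalar rate `φ(T)z` times the constant vector `(0, 0, q, -1)`, so its Jacobian
has rank one. -/
theorem charMat_mul_sourceJac (P : Params) (V : State) (ρ : ℝ) :
    charMat P ρ V * sourceJac P V = Matrix.vecMulVec (reactionChar P ρ) (rateCovector P V) := by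
  simp only [charMat, sourceJac, reactionChar, rateCovector, rateEnergyDeriv, rate]
  ext i j
  fin_cases i <;> fin_cases j <;>
    simp [Matrix.mul_apply, Fin.sum_univ_four, Matrix.vecMulVec_apply] <;>
    first | ring1 | exact Or.inl (by ring1)

/-- Expanding the differential of the rate in the rows of `L A` describes `E A⁻¹` in the frame `L`
without computing an inverse. -/
theorem IsSubsonic.rateCovector_eq (h : IsSubsonic P V) {ρ : ℝ} (hρ : ρ ≠ 0) :
    rateCovector P V = Matrix.vecMul (rateResponse P V - ![0, 0, 0, rate P V / ρ])
      (charMat P ρ V * fluxJac P V) := by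
  have hG := h.gam_pos
  have hτ := h.tau_pos
  have hlt := h.tau_lt_impedance
  have hp := h.pressure_eq
  have hg := h.gap_eq
  simp only [charMat, fluxJac, rateCovector, rateResponse]
  generalize rateEnergyDeriv P V = κ
  generalize rate P V = f
  rw [hg]
  generalize impedance P V = D at *
  generalize pressure P V = p at *
  generalize V 0 = τ at *
  subst hp
  have h1 : D ^ 2 - τ ^ 2 ≠ 0 := by nlinarith
  have hD : D ≠ 0 := by linarith
  ext j
  fin_cases j <;>
    simp [Matrix.mul_apply, Matrix.vecMul, dotProduct, Fin.sum_univ_four] <;> field_simp <;> ring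

/-- The entry `(-ρ)·(-φ/ρ) = φ` of the rank-one part is not small but has a favourable sign; it is
split off as the damping. -/
theorem couplingMat_add_damping (P : Params) (V : State) {ρ : ℝ} (hρ : ρ ≠ 0) :
    couplingMat P ρ V + Matrix.diagonal (damping P V) = geomCoupling P V
      + Matrix.vecMulVec (reactionChar P ρ) (rateResponse P V - ![0, 0, 0, rate P V / ρ]) := by
  rw [couplingMat, add_assoc]
  congr 1
  ext i j
  fin_cases i <;> fin_cases j <;>
    simp [Matrix.vecMulVec_apply, damping, reactionChar, rateResponse]
  field_simp

/-- This is the gauge transformation `L' + L E A⁻¹ = (B + d) L`, multiplied by `A` on the right. -/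
theorem IsSubsonic.charMat_intertwine (h : IsSubsonic P V) {ρ : ℝ} (hρ : ρ ≠ 0) :
    charMatDer P V * fluxJac P V + charMat P ρ V * sourceJac P V
      = (couplingMat P ρ V + Matrix.diagonal (damping P V)) * (charMat P ρ V * fluxJac P V) := by
  rw [couplingMat_add_damping P V hρ, add_mul, ← Matrix.mul_assoc, ← h.charMatDer_eq,
    charMat_mul_sourceJac, Matrix.vecMulVec_mul, ← h.rateCovector_eq hρ]

end Algebra

end ZND

/-! ### The eigenvalue equation in the moving characteristic frame. -/

namespace ZND

/-- Entrywise complexification of a real matrix. -/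
abbrev cplx (M : Matrix (Fin 4) (Fin 4) ℝ) : Matrix (Fin 4) (Fin 4) ℂ := M.map Complex.ofReal

theorem cplx_mul (M N : Matrix (Fin 4) (Fin 4) ℝ) : cplx (M * N) = cplx M * cplx N :=
  Matrix.map_mul (f := Complex.ofRealHom)

theorem cplx_add (M N : Matrix (Fin 4) (Fin 4) ℝ) : cplx (M + N) = cplx M + cplx N :=
  Matrix.map_add Complex.ofReal (by simp) M N

theorem det_cplx (M : Matrix (Fin 4) (Fin 4) ℝ) : (cplx M).det = (M.det : ℂ) :=
  (RingHom.map_det Complex.ofRealHom M).symm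

section State

variable {P : Params} {V : State}

theorem IsSubsonic.det_charMat_ne_zero (h : IsSubsonic P V) {ρ : ℝ} (hρ : ρ ≠ 0) :
    (charMat P ρ V).det ≠ 0 := by
  have hp := h.pressure_pos
  have hD := h.impedance_pos
  have hG := h.gam_pos
  have : (charMat P ρ V).det = 2 * impedance P V * (P.Gam + 1) * pressure P V * ρ := by
    simp [charMat, Matrix.det_succ_row_zero, Fin.sum_univ_succ, Fin.succAbove]
    ring
  rw [this]
  positivity

theorem IsSubsonic.det_fluxJac_ne_zero (h : IsSubsonic P V) : (fluxJac P V).det ≠ 0 := by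
  intro h0
  have h1 := congrArg Matrix.det (h.slowness_mul 1)
  rw [Matrix.det_mul, h0, mul_zero] at h1
  exact h.det_charMat_ne_zero one_ne_zero h1.symm

theorem IsSubsonic.isUnit_det (h : IsSubsonic P V) : IsUnit (cplx (fluxJac P V)).det := by
  rw [det_cplx]
  exact (Complex.ofReal_ne_zero.2 h.det_fluxJac_ne_zero).isUnit

/-- Coefficient matrix of the eigenvalue equation in characteristic coordinates. -/
def charCoeff (P : Params) (ρ : ℝ) (V : State) (lam : ℂ) : Matrix (Fin 4) (Fin 4) ℂ :=
  cplx (couplingMat P ρ V + Matrix.diagonal (damping P V))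
    - lam • cplx (Matrix.diagonal (slowness P V))

theorem IsSubsonic.charCoeff_intertwine (h : IsSubsonic P V) {ρ : ℝ} (hρ : ρ ≠ 0) (lam : ℂ) :
    cplx (charMatDer P V) + cplx (charMat P ρ V) *
      ((-(lam • (1 : Matrix (Fin 4) (Fin 4) ℂ)) + cplx (sourceJac P V)) * (cplx (fluxJac P V))⁻¹)
      = charCoeff P ρ V lam * cplx (charMat P ρ V) := by
  have hu := h.isUnit_det
  have h1 : cplx (charMatDer P V) * cplx (fluxJac P V)
      + cplx (charMat P ρ V) * (-(lam • (1 : Matrix (Fin 4) (Fin 4) ℂ)) + cplx (sourceJac P V))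
      = charCoeff P ρ V lam * cplx (charMat P ρ V) * cplx (fluxJac P V) := by
    have e1 := congrArg cplx (h.charMat_intertwine hρ)
    have e2 := congrArg cplx (h.slowness_mul ρ)
    rw [cplx_mul, cplx_mul] at e2
    rw [cplx_add, cplx_mul, cplx_mul, cplx_mul, cplx_mul] at e1
    rw [charCoeff, sub_mul, sub_mul, Matrix.mul_assoc (cplx (couplingMat _ _ _ + _)), ← e1,
      Matrix.smul_mul, Matrix.smul_mul, e2, Matrix.mul_add, Matrix.mul_neg, Matrix.mul_smul,
      Matrix.mul_one]
    abel
  calc _ = (cplx (charMatDer P V) * cplx (fluxJac P V) + cplx (charMat P ρ V) *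
        (-(lam • (1 : Matrix (Fin 4) (Fin 4) ℂ)) + cplx (sourceJac P V)))
          * (cplx (fluxJac P V))⁻¹ := by
        rw [Matrix.add_mul (cplx (charMatDer P V) * cplx (fluxJac P V)),
          Matrix.mul_nonsing_inv_cancel_right _ _ hu, Matrix.mul_assoc (cplx (charMat P ρ V))]
    _ = _ := by rw [h1, Matrix.mul_nonsing_inv_cancel_right _ _ hu]

end State

/-- Qualitative features of a strong detonation profile behind the shock. -/
structure IsStrongProfile (P : Params) (W : ℝ → State) : Prop where
  cont : ContinuousOn W (Iic 0)
  subsonic : ∀ x ≤ 0, IsSubsonic P (W x)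
  tau_eq : ∀ x ≤ 0, W x 0 = 1 - W x 1
  pressure_eq : ∀ x ≤ 0, pressure P (W x) = P.Gam * P.ePlus + W x 1
  deriv_u : ∀ x ≤ 0, HasDerivWithinAt (fun y => W y 1) (P.Gam * strain P (W x)) (Iic 0) x
  hasDeriv : ∀ x ≤ 0, ∃ V : State, HasDerivWithinAt W V (Iic 0) x ∧
    (fluxJac P (W x)).mulVec V = source P (W x)
  jump : unburned P - W 0 = ![W 0 1, -W 0 1, -(W 0 1 * pressure P (W 0)), 0]
  cv_pos : 0 < P.cv

section Profile

variable {P : Params} {W : ℝ → State}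

theorem IsStrongProfile.continuousOn_apply (h : IsStrongProfile P W) (i : Fin 4) :
    ContinuousOn (fun x => W x i) (Iic 0) := continuousOn_pi.1 h.cont i

theorem IsStrongProfile.continuousOn_energy (h : IsStrongProfile P W) :
    ContinuousOn (fun x => internalEnergy (W x)) (Iic 0) :=
  (h.continuousOn_apply 2).sub (((h.continuousOn_apply 1).pow 2).div_const 2)

theorem IsStrongProfile.continuousOn_pressure (h : IsStrongProfile P W) :
    ContinuousOn (fun x => pressure P (W x)) (Iic 0) :=
  (continuousOn_const.mul h.continuousOn_energy).div (h.continuousOn_apply 0)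
    fun x hx => (h.subsonic x hx).tau_pos.ne'

theorem IsStrongProfile.continuousOn_impedance (h : IsStrongProfile P W) :
    ContinuousOn (fun x => impedance P (W x)) (Iic 0) :=
  Real.continuous_sqrt.comp_continuousOn
    ((continuousOn_const.mul h.continuousOn_pressure).mul (h.continuousOn_apply 0))

theorem IsStrongProfile.continuousOn_gap (h : IsStrongProfile P W) :
    ContinuousOn (fun x => gap P (W x)) (Iic 0) :=
  (continuousOn_const.mul h.continuousOn_pressure).sub (h.continuousOn_apply 0)

theorem IsStrongProfile.temperature_ne_zero (h : IsStrongProfile P W) {x : ℝ} (hx : x ≤ 0) :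
    temperature P (W x) ≠ 0 := (div_pos (h.subsonic x hx).energy_pos h.cv_pos).ne'

theorem IsStrongProfile.continuousOn_temperature (h : IsStrongProfile P W) :
    ContinuousOn (fun x => temperature P (W x)) (Iic 0) :=
  h.continuousOn_energy.div_const _

theorem IsStrongProfile.continuousOn_rate (h : IsStrongProfile P W) :
    ContinuousOn (fun x => rate P (W x)) (Iic 0) :=
  Real.continuous_exp.comp_continuousOn
    (continuousOn_const.div h.continuousOn_temperature fun _ hx => h.temperature_ne_zero hx)

theorem IsStrongProfile.continuousOn_ignitionDeriv (h : IsStrongProfile P W) :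
    ContinuousOn (fun x => ignitionDeriv P (temperature P (W x))) (Iic 0) :=
  (continuousOn_const.div (h.continuousOn_temperature.pow 2)
    fun _ hx => pow_ne_zero 2 (h.temperature_ne_zero hx)).mul h.continuousOn_rate

theorem IsStrongProfile.continuousOn_rateEnergyDeriv (h : IsStrongProfile P W) :
    ContinuousOn (fun x => rateEnergyDeriv P (W x)) (Iic 0) :=
  (h.continuousOn_ignitionDeriv.mul (h.continuousOn_apply 3)).div_const _

theorem IsStrongProfile.continuousOn_strain (h : IsStrongProfile P W) :
    ContinuousOn (fun x => strain P (W x)) (Iic 0) :=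
  ((continuousOn_const.mul h.continuousOn_rate).mul (h.continuousOn_apply 3)).div
    h.continuousOn_gap fun x hx => (h.subsonic x hx).gap_pos.ne'

theorem IsStrongProfile.continuousOn_slowness (h : IsStrongProfile P W) (k : Fin 4) :
    ContinuousOn (fun x => slowness P (W x) k) (Iic 0) := by
  have hg : ∀ x ∈ Iic (0 : ℝ), gap P (W x) ≠ 0 := fun x hx => (h.subsonic x hx).gap_pos.ne'
  fin_cases k
  · exact (h.continuousOn_impedance.add (h.continuousOn_apply 0)).div h.continuousOn_gap hg
  · exact ((h.continuousOn_impedance.sub (h.continuousOn_apply 0)).div h.continuousOn_gap hg).neg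
  · exact continuousOn_const
  · exact continuousOn_const

theorem IsStrongProfile.continuousOn_damping (h : IsStrongProfile P W) (k : Fin 4) :
    ContinuousOn (fun x => damping P (W x) k) (Iic 0) := by
  fin_cases k
  · exact continuousOn_const
  · exact continuousOn_const
  · exact continuousOn_const
  · exact h.continuousOn_rate

theorem IsStrongProfile.continuousOn_couplingMat (h : IsStrongProfile P W) (ρ : ℝ) (j k : Fin 4) :
    ContinuousOn (fun x => couplingMat P ρ (W x) j k) (Iic 0) := by
  have hg : ∀ x ∈ Iic (0 : ℝ), 2 * gap P (W x) ≠ 0 := fun x hx =>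
    mul_ne_zero two_ne_zero (h.subsonic x hx).gap_pos.ne'
  have c0 := h.continuousOn_apply 0
  have cD := h.continuousOn_impedance
  have cs := h.continuousOn_strain
  have cp := h.continuousOn_pressure
  have hG1 : ∀ x ∈ Iic (0 : ℝ), P.Gam + 1 ≠ 0 := fun x hx =>
    (by linarith [(h.subsonic x hx).gam_pos] : 0 < P.Gam + 1).ne'
  have ca : ContinuousOn (fun x => P.Gam / impedance P (W x) * strain P (W x) / 2) (Iic 0) :=
    ((continuousOn_const.div cD fun x hx => (h.subsonic x hx).impedance_pos.ne').mul cs).div_const _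
  have cd : ContinuousOn (fun x => strain P (W x) * (W x 0 - pressure P (W x)) /
      (4 * internalEnergy (W x))) (Iic 0) :=
    (cs.mul (c0.sub cp)).div (continuousOn_const.mul h.continuousOn_energy)
      fun x hx => mul_ne_zero four_ne_zero (h.subsonic x hx).energy_pos.ne'
  have ch : ContinuousOn (fun x => P.Gam * strain P (W x) / (2 * pressure P (W x) * (P.Gam + 1)))
      (Iic 0) :=
    (continuousOn_const.mul cs).div ((continuousOn_const.mul cp).mul continuousOn_const)
      fun x hx => mul_ne_zero (mul_ne_zero two_ne_zero (h.subsonic x hx).pressure_pos.ne')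
        (hG1 x hx)
  have cR : ∀ k, ContinuousOn (fun x => rateResponse P (W x) k) (Iic 0) := by
    have ck := h.continuousOn_rateEnergyDeriv.div_const (P.Gam + 1)
    intro k
    fin_cases k
    · exact ck.mul ((cD.add c0).div (continuousOn_const.mul h.continuousOn_gap) hg)
    · exact (ck.mul ((cD.sub c0).div (continuousOn_const.mul h.continuousOn_gap) hg)).neg
    · exact ck.neg
    · exact continuousOn_const
  simp only [couplingMat, Matrix.add_apply, Matrix.of_apply]
  refine ContinuousOn.add ?_ (continuousOn_const.mul ((cR k).sub ?_))
  · fin_cases j <;> fin_cases k <;> simp [geomCoupling] <;> fun_prop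
  · split_ifs
    · exact continuousOn_const
    · exact h.continuousOn_rate.div_const _
    · exact continuousOn_const

/-- Conservation of mass and momentum makes `τ` and `p` affine in `u`, so the whole frame is
differentiated through `u'` alone. -/
theorem IsStrongProfile.hasDerivWithinAt_charMat (h : IsStrongProfile P W) (ρ : ℝ) {x : ℝ}
    (hx : x ≤ 0) (i j : Fin 4) :
    HasDerivWithinAt (fun y => charMat P ρ (W y) i j) (charMatDer P (W x) i j) (Iic 0) x := by
  have hs := h.subsonic x hx
  have hu := h.deriv_u x hx
  have hp : HasDerivWithinAt (fun y => pressure P (W y)) (P.Gam * strain P (W x)) (Iic 0) x :=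
    (hu.const_add (P.Gam * P.ePlus)).congr (fun y hy => h.pressure_eq y hy) (h.pressure_eq x hx)
  have ht : HasDerivWithinAt (fun y => W y 0) (-(P.Gam * strain P (W x))) (Iic 0) x :=
    (hu.const_sub 1).congr (fun y hy => h.tau_eq y hy) (h.tau_eq x hx)
  have hne : (P.Gam + 1) * pressure P (W x) * W x 0 ≠ 0 := by
    rw [← hs.impedance_sq]; exact pow_ne_zero 2 hs.impedance_pos.ne'
  have hD : HasDerivWithinAt (fun y => impedance P (W y)) (impedanceDer P (W x)) (Iic 0) x := by
    have h1 := ((hp.const_mul (P.Gam + 1)).mul ht).sqrt hne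
    refine h1.congr_deriv ?_
    simp only [impedanceDer, impedance, Pi.mul_apply]
    congr 1
    ring
  fin_cases i <;> fin_cases j <;> simp [charMat, charMatDer]
  · exact hp.neg
  · exact hD.sub (hu.const_mul _)
  · exact hasDerivWithinAt_const _ _ _
  · exact hasDerivWithinAt_const _ _ _
  · exact hp.neg
  · exact hD.neg.sub (hu.const_mul _)
  · exact hasDerivWithinAt_const _ _ _
  · exact hasDerivWithinAt_const _ _ _
  · exact hp
  · exact hu.neg
  · exact hasDerivWithinAt_const _ _ _
  · exact hasDerivWithinAt_const _ _ _
  · exact hasDerivWithinAt_const _ _ _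
  · exact hasDerivWithinAt_const _ _ _
  · exact hasDerivWithinAt_const _ _ _
  · exact hasDerivWithinAt_const _ _ _

/-- Characteristic coordinates of a vector field along the profile. -/
def charCoord (P : Params) (W : ℝ → State) (ρ : ℝ) (Z : ℝ → Fin 4 → ℂ) (x : ℝ) : Fin 4 → ℂ :=
  (cplx (charMat P ρ (W x))).mulVec (Z x)

theorem IsStrongProfile.hasDerivWithinAt_charCoord (h : IsStrongProfile P W) (ρ : ℝ)
    {Z : ℝ → Fin 4 → ℂ} {Z' : Fin 4 → ℂ} {x : ℝ} (hx : x ≤ 0)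
    (hZ : HasDerivWithinAt Z Z' (Iic 0) x) :
    HasDerivWithinAt (charCoord P W ρ Z)
      ((cplx (charMatDer P (W x))).mulVec (Z x) + (cplx (charMat P ρ (W x))).mulVec Z')
      (Iic 0) x := by
  rw [hasDerivWithinAt_pi] at hZ ⊢
  intro i
  have h1 := HasDerivWithinAt.fun_sum (u := Finset.univ) fun j (_ : j ∈ Finset.univ) =>
    (h.hasDerivWithinAt_charMat ρ hx i j).ofReal_comp.mul (hZ j)
  refine h1.congr_deriv ?_
  simp only [Matrix.mulVec, dotProduct, Pi.add_apply, Matrix.map_apply, Finset.sum_add_distrib]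

/-- In these coordinates `λ` enters only through the diagonal, which is what permits estimates
uniform in `Im λ`. -/
theorem IsStrongProfile.charCoord_ode (h : IsStrongProfile P W) {ρ : ℝ} (hρ : ρ ≠ 0) {lam : ℂ}
    {Z : ℝ → Fin 4 → ℂ} (hZ : SolvesEigenvalueODE P W lam Z) {x : ℝ} (hx : x ≤ 0) :
    HasDerivWithinAt (charCoord P W ρ Z)
      ((charCoeff P ρ (W x) lam).mulVec (charCoord P W ρ Z x)) (Iic 0) x := by
  refine (h.hasDerivWithinAt_charCoord ρ hx (hZ x hx)).congr_deriv ?_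
  rw [charCoord, Matrix.mulVec_mulVec, Matrix.mulVec_mulVec, ← Matrix.add_mulVec]
  exact congrArg (fun M => M.mulVec (Z x)) ((h.subsonic x hx).charCoeff_intertwine hρ lam)

end Profile

end ZND

/-! ### Size and decay of the coefficients when the heat release is small. -/

namespace ZND

/-- Quantitative bounds for a strong detonation profile with small heat release. -/
structure ProfileBounds (P : Params) (W : ℝ → State) (K η ρ : ℝ) : Prop where
  one_le : 1 ≤ K
  eta_pos : 0 < η
  rho_pos : 0 < ρ
  rho_le : ρ ≤ 1
  gam_le : P.Gam ≤ K
  q_nonneg : 0 ≤ P.q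
  q_le : P.q ≤ ρ ^ 2
  u_le : ∀ x ≤ 0, W x 1 ≤ 1
  le_u : ∀ x ≤ 0, K⁻¹ ≤ W x 1
  tau_le : ∀ x ≤ 0, W x 0 ≤ 1
  gap_le : ∀ x ≤ 0, gap P (W x) ≤ 1
  le_gap : ∀ x ≤ 0, K⁻¹ ≤ gap P (W x)
  pressure_le : ∀ x ≤ 0, pressure P (W x) ≤ K
  u_le_pressure : ∀ x ≤ 0, W x 1 ≤ pressure P (W x)
  le_energy : ∀ x ≤ 0, K⁻¹ ≤ internalEnergy (W x)
  impedance_le : ∀ x ≤ 0, impedance P (W x) ≤ K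
  -- `Γ` has no positive lower bound and the impedance may degenerate with it; the coupling involves
  -- only their ratio.
  gam_le_impedance : ∀ x ≤ 0, P.Gam ≤ K * impedance P (W x)
  rate_le : ∀ x ≤ 0, rate P (W x) ≤ 1
  le_rate : ∀ x ≤ 0, η ≤ rate P (W x)
  z_nonneg : ∀ x ≤ 0, 0 ≤ W x 3
  z_le : ∀ x ≤ 0, W x 3 ≤ Real.exp (η * x)
  rateEnergyDeriv_nonneg : ∀ x ≤ 0, 0 ≤ rateEnergyDeriv P (W x)
  rateEnergyDeriv_le : ∀ x ≤ 0, rateEnergyDeriv P (W x) ≤ K * Real.exp (η * x)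

variable {P : Params} {W : ℝ → State} {K η ρ : ℝ}

section Bounds

variable (hb : ProfileBounds P W K η ρ) (h : IsStrongProfile P W) {x : ℝ} (hx : x ≤ 0)
include hb h hx

omit h in
theorem ProfileBounds.inv_gap_le : (gap P (W x))⁻¹ ≤ K := by
  have := hb.one_le
  exact inv_le_of_inv_le₀ (by linarith) (hb.le_gap x hx)

omit hb in
theorem IsStrongProfile.tau_le_impedance : W x 0 ≤ impedance P (W x) :=
  (h.subsonic x hx).tau_lt_impedance.le

theorem ProfileBounds.slowness_zero_le : slowness P (W x) 0 ≤ 2 * K ^ 2 := by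
  have h1 := hb.inv_gap_le hx
  have h2 := h.tau_le_impedance hx
  have h3 := hb.impedance_le x hx
  have h4 := (h.subsonic x hx).tau_pos
  have h5 := (h.subsonic x hx).gap_pos
  change (impedance P (W x) + W x 0) / gap P (W x) ≤ 2 * K ^ 2
  rw [div_eq_mul_inv]
  have h6 : W x 0 ≤ K := h2.trans h3
  have h7 : 0 ≤ K + K := by linarith
  calc _ ≤ (K + K) * K := by gcongr
    _ = _ := by ring

/-- The bound degenerates as `Γ → 0`, which is harmless: it serves for signs and for the bare decay
of the dual mode. -/
theorem ProfileBounds.le_slowness_zero : P.Gam / K ≤ slowness P (W x) 0 := by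
  have h1 := hb.gam_le_impedance x hx
  have h4 := (h.subsonic x hx).tau_pos
  have h5 := (h.subsonic x hx).gap_pos
  have h6 := hb.gap_le x hx
  have hK := hb.one_le
  change _ ≤ (impedance P (W x) + W x 0) / gap P (W x)
  rw [div_le_div_iff₀ (by linarith) h5]
  have := (h.subsonic x hx).gam_pos
  nlinarith [mul_le_mul_of_nonneg_left h6 this.le]

omit hb in
theorem IsStrongProfile.neg_slowness_one_nonneg : 0 ≤ -slowness P (W x) 1 := by
  change 0 ≤ - -((impedance P (W x) - W x 0) / gap P (W x))
  rw [neg_neg]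
  exact div_nonneg (sub_nonneg.2 (h.tau_le_impedance hx)) (h.subsonic x hx).gap_pos.le

theorem ProfileBounds.neg_slowness_one_le : -slowness P (W x) 1 ≤ K ^ 2 := by
  have h1 := hb.inv_gap_le hx
  have h3 := hb.impedance_le x hx
  have h4 := (h.subsonic x hx).tau_pos
  have h5 := (h.subsonic x hx).gap_pos
  have h2 := h.tau_le_impedance hx
  change - -((impedance P (W x) - W x 0) / gap P (W x)) ≤ K ^ 2
  rw [neg_neg, div_eq_mul_inv, pow_two]
  have := hb.one_le
  gcongr
  linarith

theorem ProfileBounds.abs_slowness_le (k : Fin 4) : |slowness P (W x) k| ≤ 2 * K ^ 2 := by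
  have h0 := hb.slowness_zero_le h hx
  have h0' := hb.le_slowness_zero h hx
  have h1 := h.neg_slowness_one_nonneg hx
  have h2 := hb.neg_slowness_one_le h hx
  have hK := hb.one_le
  have : 0 ≤ P.Gam / K := div_nonneg (h.subsonic x hx).gam_pos.le (by linarith)
  have hKK : 1 ≤ K ^ 2 := one_le_pow₀ hK
  fin_cases k
  · exact abs_le.2 ⟨by simp only [Fin.zero_eta]; linarith, h0⟩
  · exact abs_le.2 ⟨by simp only [Fin.mk_one]; linarith, by simp only [Fin.mk_one]; linarith⟩
  · have : slowness P (W x) 2 = -1 := rfl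
    simp only [Fin.reduceFinMk, this]; norm_num; linarith
  · have : slowness P (W x) 3 = -1 := rfl
    simp only [Fin.reduceFinMk, this]; norm_num; linarith

theorem ProfileBounds.strain_nonneg : 0 ≤ strain P (W x) :=
  div_nonneg (mul_nonneg (mul_nonneg hb.q_nonneg (hb.eta_pos.le.trans (hb.le_rate x hx)))
    (hb.z_nonneg x hx)) (h.subsonic x hx).gap_pos.le

theorem ProfileBounds.strain_le : strain P (W x) ≤ K * ρ * Real.exp (η * x) := by
  have h1 := hb.inv_gap_le hx
  have h2 := hb.z_le x hx
  have h3 := hb.z_nonneg x hx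
  have h4 := hb.rate_le x hx
  have h5 := hb.eta_pos.le.trans (hb.le_rate x hx)
  have h6 := (h.subsonic x hx).gap_pos
  have h7 : P.q ≤ ρ := hb.q_le.trans (by nlinarith [hb.rho_pos, hb.rho_le])
  have h8 := hb.q_nonneg
  have h9 := hb.rho_pos
  rw [strain, div_eq_mul_inv]
  calc _ ≤ ρ * 1 * Real.exp (η * x) * K := by gcongr
    _ = _ := by ring

/-- The frame varies only through `u' = Γ · strain`; the remaining factors are bounded, those with
`1/D` because `Γ/D ≤ K`. -/
theorem ProfileBounds.abs_geomCoupling_le (j k : Fin 4) :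
    |geomCoupling P (W x) j k| ≤ 2 * K ^ 2 * strain P (W x) := by
  have hs := h.subsonic x hx
  have hr := hb.strain_nonneg h hx
  have hK := hb.one_le
  have hG := hs.gam_pos
  have hGK := hb.gam_le
  have hD := hs.impedance_pos
  have hp := hs.pressure_pos
  have hpK := hb.pressure_le x hx
  have hτ := hs.tau_pos
  have hτ1 := hb.tau_le x hx
  have he := hs.energy_pos
  have hpi : (pressure P (W x))⁻¹ ≤ K :=
    inv_le_of_inv_le₀ (by linarith) ((hb.le_u x hx).trans (hb.u_le_pressure x hx))
  have hei : (internalEnergy (W x))⁻¹ ≤ K := inv_le_of_inv_le₀ (by linarith) (hb.le_energy x hx)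
  have hω : P.Gam / impedance P (W x) ≤ K := (div_le_iff₀ hD).2 (hb.gam_le_impedance x hx)
  have hKK : K ≤ K ^ 2 := by nlinarith
  unfold geomCoupling
  set r := strain P (W x)
  have ha0 : 0 ≤ P.Gam / impedance P (W x) * r / 2 := by positivity
  have ha1 : P.Gam / impedance P (W x) * r / 2 ≤ K * r / 2 := by gcongr
  have ha2 : P.Gam * (P.Gam / impedance P (W x) * r / 2) ≤ K ^ 2 * r / 2 := by
    calc _ ≤ K * (K * r / 2) := by gcongr
      _ = _ := by ring
  have ha3 : 0 ≤ P.Gam * (P.Gam / impedance P (W x) * r / 2) := by positivity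
  have hd : |r * (W x 0 - pressure P (W x)) / (4 * internalEnergy (W x))| ≤ K ^ 2 * r / 4 := by
    rw [abs_div, abs_mul, abs_of_nonneg hr, abs_of_pos (by positivity : 0 < 4 * internalEnergy (W x)),
      div_eq_mul_inv, mul_inv]
    have : |W x 0 - pressure P (W x)| ≤ K := abs_le.2 ⟨by linarith, by linarith⟩
    calc _ ≤ r * K * (4⁻¹ * K) := by gcongr
      _ = _ := by ring
  have hh0 : 0 ≤ P.Gam * r / (2 * pressure P (W x) * (P.Gam + 1)) := by positivity
  have hh1 : P.Gam * r / (2 * pressure P (W x) * (P.Gam + 1)) ≤ K * r / 2 := by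
    have e1 : P.Gam / (P.Gam + 1) ≤ 1 := (div_le_one (by linarith)).2 (by linarith)
    calc _ = P.Gam / (P.Gam + 1) * (r / 2) * (pressure P (W x))⁻¹ := by field_simp
      _ ≤ 1 * (r / 2) * K := by gcongr
      _ = _ := by ring
  have hh2 : 2 * P.Gam * (P.Gam * r / (2 * pressure P (W x) * (P.Gam + 1))) ≤ K ^ 2 * r := by
    calc _ ≤ 2 * K * (K * r / 2) := by gcongr
      _ = _ := by ring
  have hh3 : 0 ≤ 2 * P.Gam * (P.Gam * r / (2 * pressure P (W x) * (P.Gam + 1))) := by positivity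
  have hKr : K * r ≤ K ^ 2 * r := mul_le_mul_of_nonneg_right hKK hr
  have hKr0 : 0 ≤ K ^ 2 * r := by positivity
  rw [abs_le] at hd
  obtain ⟨hd1, hd2⟩ := hd
  fin_cases j <;> fin_cases k <;> simp [-abs_mul] <;> first | positivity | (rw [abs_le]; constructor <;> linarith)

theorem ProfileBounds.abs_reactionChar_le (j : Fin 4) : |reactionChar P ρ j| ≤ K * ρ := by
  have hG := (h.subsonic x hx).gam_pos
  have hq := hb.q_nonneg
  have hK := hb.one_le
  have hρ := hb.rho_pos
  have hqρ : P.q ≤ ρ := hb.q_le.trans (by nlinarith [hb.rho_pos, hb.rho_le])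
  have h1 : P.Gam * P.q ≤ K * ρ := by have := hb.gam_le; gcongr
  have h2 : ρ ≤ K * ρ := by nlinarith
  fin_cases j <;> simp [reactionChar, abs_mul, abs_of_pos hG, abs_of_nonneg hq, abs_of_pos hρ] <;>
    linarith

theorem ProfileBounds.abs_reactionChar_le_sq (j : Fin 4) (hj : j ≠ 3) :
    |reactionChar P ρ j| ≤ K * ρ ^ 2 := by
  have hG := (h.subsonic x hx).gam_pos
  have hq := hb.q_nonneg
  have hK := hb.one_le
  have hqρ := hb.q_le
  have h1 : P.Gam * P.q ≤ K * ρ ^ 2 := by have := hb.gam_le; gcongr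
  have h2 : P.q ≤ K * ρ ^ 2 := hqρ.trans (by nlinarith [sq_nonneg ρ])
  fin_cases j
  · simpa [reactionChar, abs_mul, abs_of_pos hG, abs_of_nonneg hq] using h1
  · simpa [reactionChar, abs_mul, abs_of_pos hG, abs_of_nonneg hq] using h1
  · simpa [reactionChar, abs_of_nonneg hq] using h2
  · exact absurd rfl hj

theorem ProfileBounds.abs_rateResponse_le (k : Fin 4) :
    |rateResponse P (W x) k| ≤ K ^ 3 * Real.exp (η * x) := by
  have hs := h.subsonic x hx
  have hG := hs.gam_pos
  have hK := hb.one_le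
  have hκ0 := hb.rateEnergyDeriv_nonneg x hx
  have hκ := hb.rateEnergyDeriv_le x hx
  have hg := hs.gap_pos
  have hgi := hb.inv_gap_le hx
  have hD := hs.impedance_pos
  have hDK := hb.impedance_le x hx
  have hτ := hs.tau_pos
  have hτD := h.tau_le_impedance hx
  have h0 : 0 ≤ rateEnergyDeriv P (W x) / (P.Gam + 1) := by positivity
  have h1 : rateEnergyDeriv P (W x) / (P.Gam + 1) ≤ K * Real.exp (η * x) :=
    (div_le_self hκ0 (by linarith)).trans hκ
  have h2 : |(impedance P (W x) + W x 0) / (2 * gap P (W x))| ≤ K ^ 2 := by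
    rw [abs_of_nonneg (by positivity), div_eq_mul_inv, mul_inv]
    calc _ ≤ (K + K) * (2⁻¹ * K) := by gcongr; linarith
      _ = _ := by ring
  have h3 : |(impedance P (W x) - W x 0) / (2 * gap P (W x))| ≤ K ^ 2 := by
    rw [abs_of_nonneg (div_nonneg (by linarith) (by positivity)), div_eq_mul_inv, mul_inv]
    calc _ ≤ (K + K) * (2⁻¹ * K) := by gcongr; linarith
      _ = _ := by ring
  have hE := Real.exp_pos (η * x)
  have hKK : K * 1 ≤ K * K ^ 2 := by gcongr; exact one_le_pow₀ hK
  fin_cases k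
  · change |rateEnergyDeriv P (W x) / (P.Gam + 1) *
      ((impedance P (W x) + W x 0) / (2 * gap P (W x)))| ≤ _
    rw [abs_mul, abs_of_nonneg h0]
    calc _ ≤ (K * Real.exp (η * x)) * K ^ 2 := by gcongr
      _ = _ := by ring
  · change |-(rateEnergyDeriv P (W x) / (P.Gam + 1) *
      ((impedance P (W x) - W x 0) / (2 * gap P (W x))))| ≤ _
    rw [abs_neg, abs_mul, abs_of_nonneg h0]
    calc _ ≤ (K * Real.exp (η * x)) * K ^ 2 := by gcongr
      _ = _ := by ring
  · change |-(rateEnergyDeriv P (W x) / (P.Gam + 1))| ≤ _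
    rw [abs_neg, abs_of_nonneg h0]
    nlinarith
  · change |(0 : ℝ)| ≤ _
    rw [abs_zero]; positivity

theorem ProfileBounds.abs_couplingMat_le (j k : Fin 4) (hk : k ≠ 3) :
    |couplingMat P ρ (W x) j k| ≤ 3 * K ^ 4 * ρ * Real.exp (η * x) := by
  have h1 := hb.abs_geomCoupling_le h hx j k
  have h2 := hb.abs_reactionChar_le h hx j
  have h3 := hb.abs_rateResponse_le h hx k
  have h4 := hb.strain_le h hx
  have hK := hb.one_le
  have hρ := hb.rho_pos
  have hE := Real.exp_pos (η * x)
  simp only [couplingMat, Matrix.add_apply, Matrix.of_apply, if_neg hk, sub_zero]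
  refine (abs_add_le _ _).trans ?_
  rw [abs_mul]
  have h5 : 2 * K ^ 2 * strain P (W x) ≤ 2 * K ^ 4 * ρ * Real.exp (η * x) := by
    calc _ ≤ 2 * K ^ 2 * (K * ρ * Real.exp (η * x)) := by gcongr
      _ = 2 * K ^ 3 * ρ * Real.exp (η * x) := by ring
      _ ≤ _ := by gcongr; first | exact hK | norm_num
  have h6 : |reactionChar P ρ j| * |rateResponse P (W x) k|
      ≤ K ^ 4 * ρ * Real.exp (η * x) := by
    calc _ ≤ (K * ρ) * (K ^ 3 * Real.exp (η * x)) := by gcongr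
      _ = _ := by ring
  linarith

/-- No decay in `x` can be expected here, since `φ` stays bounded below. Smallness comes from `q/ρ ≤
ρ`, and the damping of the reactant will replace the decay. -/
theorem ProfileBounds.abs_couplingMat_three_le (j : Fin 4) :
    |couplingMat P ρ (W x) j 3| ≤ 3 * K ^ 4 * ρ := by
  have hK := hb.one_le
  have hρ := hb.rho_pos
  have hf0 := hb.eta_pos.le.trans (hb.le_rate x hx)
  have hf := hb.rate_le x hx
  have hg : geomCoupling P (W x) j 3 = 0 := by fin_cases j <;> simp [geomCoupling]
  have hR : rateResponse P (W x) 3 = 0 := rfl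
  simp only [couplingMat, Matrix.add_apply, Matrix.of_apply, if_true, hg, hR, zero_add, zero_sub]
  split_ifs with hj
  · simp; positivity
  · have h2 := hb.abs_reactionChar_le_sq h hx j hj
    rw [abs_mul, abs_neg, abs_div, abs_of_nonneg hf0, abs_of_pos hρ]
    calc _ ≤ K * ρ ^ 2 * (1 / ρ) := by gcongr
      _ = K ^ 1 * ρ := by field_simp
      _ ≤ (3 * K ^ 4) * ρ := by
        have : K ^ 1 ≤ K ^ 4 := pow_le_pow_right₀ hK (by norm_num)
        gcongr; nlinarith [pow_pos (by linarith : 0 < K) 4]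
      _ = _ := by ring

omit hb h hx in
theorem couplingMat_three_three (V : State) : couplingMat P ρ V 3 3 = 0 := by
  simp [couplingMat, geomCoupling, rateResponse]

end Bounds

end ZND

/-! ### The dual mode and its pairings with the source and the jump. -/

namespace ZND

variable {P : Params} {W : ℝ → State} {K η ρ : ℝ}

/-- Differences of slownesses, the transport coefficients relative to the fast acoustic mode. -/
def relSlowness (P : Params) (W : ℝ → State) (k : Fin 4) (x : ℝ) : ℝ :=
  slowness P (W x) 0 - slowness P (W x) k

/-- Mode `0` has the largest slowness, so all differences `ν₀ - ν_k` are nonnegative and transport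
never amplifies the kernel when `Re λ ≥ 0`. The bound `4K²` is twice that for a single slowness. -/
theorem ProfileBounds.dampedSystem (hb : ProfileBounds P W K η ρ) (h : IsStrongProfile P W) :
    DampedSystem (relSlowness P W) (fun k x => damping P (W x) k)
      (fun x => couplingMat P ρ (W x)) (4 * K ^ 2) (3 * K ^ 4 * ρ) η where
  eta_pos := hb.eta_pos
  eps_nonneg := by have := hb.one_le; have := hb.rho_pos; positivity
  K_pos := by have := hb.one_le; positivity
  mu_cont k := (h.continuousOn_slowness 0).sub (h.continuousOn_slowness k)
  d_cont k := h.continuousOn_damping k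
  B_cont j k := h.continuousOn_couplingMat ρ j k
  mu_nonneg k x hx := by
    have h0 : 0 ≤ P.Gam / K :=
      div_nonneg (h.subsonic x hx).gam_pos.le (by linarith [hb.one_le])
    have h1 := hb.le_slowness_zero h hx
    have h2 := h.neg_slowness_one_nonneg hx
    have h3 : slowness P (W x) 2 = -1 := rfl
    have h4 : slowness P (W x) 3 = -1 := rfl
    rw [relSlowness]
    fin_cases k
    · simp
    · simp only [Fin.mk_one]; linarith
    · simp only [Fin.reduceFinMk]; linarith
    · simp only [Fin.reduceFinMk]; linarith
  mu_le k x hx := by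
    have h0 := (abs_le.1 (hb.abs_slowness_le h hx 0)).2
    have h1 := (abs_le.1 (hb.abs_slowness_le h hx k)).1
    rw [relSlowness]; linarith
  d_nonneg k x hx := by
    have := hb.eta_pos.le.trans (hb.le_rate x hx)
    fin_cases k <;> simp [damping, this]
  coupling k := by
    by_cases hk : k = 3
    · subst hk
      exact Or.inr ⟨fun j x hx => hb.abs_couplingMat_three_le h hx j, fun x hx => hb.le_rate x hx⟩
    · exact Or.inl fun j x hx => hb.abs_couplingMat_le h hx j k hk

/-- A solution, up to the factor `exp (λ ∫ ν₀)`, of the adjoint eigenvalue equation in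
characteristic coordinates that stays close to the fast acoustic mode. -/
structure IsDualMode (P : Params) (W : ℝ → State) (ρ σ κ : ℝ) (f : ℂ → ℝ → Fin 4 → ℂ) : Prop where
  diff : DifferentiableOn ℂ (fun lam => f lam 0) {lam : ℂ | -σ < lam.re}
  close : ∀ lam : ℂ, -σ < lam.re → ∀ x ≤ 0, ∀ k, ‖f lam x k - if k = 0 then 1 else 0‖ ≤ κ
  ode : ∀ lam : ℂ, -σ < lam.re → ∀ x ≤ 0, ∀ k, HasDerivWithinAt (fun x => f lam x k)
    (-((lam * (relSlowness P W k x : ℂ) + (damping P (W x) k : ℂ)) * f lam x k)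
      - ∑ j, (couplingMat P ρ (W x) j k : ℂ) * f lam x j) (Iic 0) x

theorem ProfileBounds.exists_dualMode (hb : ProfileBounds P W K η ρ) (h : IsStrongProfile P W)
    (hsmall : 1000 * K ^ 8 * ρ ≤ η) :
    ∃ σ > 0, ∃ f, IsDualMode P W ρ σ (1 / (38 * K ^ 4)) f := by
  have hK := hb.one_le
  have hη := hb.eta_pos
  have hK4 : 1 ≤ K ^ 4 := one_le_pow₀ hK
  -- The contraction factor is `4 · 3K⁴ρ / (η/2) = 24K⁴ρ/η ≤ 24/(1000K⁴)`, below this `θ`; then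
  -- `θ/(1-θ) ≤ 1/(38K⁴)`.
  set θ : ℝ := 1 / (40 * K ^ 4) with hθ
  have hθ1 : θ ≤ 1 / 40 := by
    rw [hθ]; apply one_div_le_one_div_of_le <;> linarith
  have hθ0 : 0 < θ := by positivity
  obtain ⟨f, hf, hode⟩ := (hb.dampedSystem h).exists_solution (Pi.single 0 1)
    (fun k => by
      by_cases hk : k = 0
      · subst hk
        exact Or.inr fun x _ => ⟨by simp [relSlowness], rfl⟩
      · exact Or.inl (Pi.single_eq_of_ne hk 1)) (θ := θ)
    (by
      rw [hθ, Fintype.card_fin, div_le_div_iff₀ (by positivity) (by positivity)]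
      push_cast
      nlinarith) (by linarith)
  refine ⟨η / (2 * (4 * K ^ 2)), by positivity, f, hf 0 le_rfl, fun lam hl x hx k => ?_,
    fun lam hl x hx k => (hode lam hl x hx).2 k⟩
  have h1 := (hode lam hl x hx).1
  have hn : ‖(Pi.single 0 1 : Fin 4 → ℂ)‖ ≤ 1 := by
    refine (pi_norm_le_iff_of_nonneg zero_le_one).2 fun i => ?_
    by_cases hi : i = 0
    · subst hi; simp
    · simp [hi]
  have h2 : θ * (‖(Pi.single 0 1 : Fin 4 → ℂ)‖ * (1 - θ)⁻¹) ≤ 1 / (38 * K ^ 4) := by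
    have h3 : (1 - θ)⁻¹ ≤ 40 / 38 := by
      rw [inv_eq_one_div, div_le_div_iff₀ (by linarith) (by norm_num)]; linarith
    have h4 : 0 ≤ (1 - θ)⁻¹ := inv_nonneg.2 (by linarith)
    calc _ ≤ θ * (1 * (40 / 38)) := by gcongr
      _ = _ := by rw [hθ]; field_simp
  have h5 := (norm_le_pi_norm (f lam x - Pi.single 0 1) k).trans (h1.trans h2)
  simpa [Pi.single_apply] using h5

section DualMode

variable {σ κ : ℝ} {f : ℂ → ℝ → Fin 4 → ℂ} {lam : ℂ}

/-- The decay factor `exp (λ ∫ ν₀)` of the dual mode. -/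
def dualPhase (P : Params) (W : ℝ → State) (lam : ℂ) (x : ℝ) : ℂ :=
  Complex.exp (lam * (prim (fun y => slowness P (W y) 0) x : ℂ))

theorem dualPhase_zero : dualPhase P W lam 0 = 1 := by simp [dualPhase, prim_zero]

theorem ProfileBounds.norm_dualPhase_le (hb : ProfileBounds P W K η ρ) (h : IsStrongProfile P W)
    (hl : 0 ≤ lam.re) {x : ℝ} (hx : x ≤ 0) :
    ‖dualPhase P W lam x‖ ≤ Real.exp (lam.re * (P.Gam / K) * x) := by
  have h1 := prim_add_sub_le (h.continuousOn_slowness 0)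
    (fun x hx => hb.le_slowness_zero h hx) le_rfl hx
  rw [zero_add, prim_zero, sub_zero] at h1
  rw [dualPhase, Complex.norm_exp]
  refine Real.exp_le_exp.2 ?_
  simp only [Complex.mul_re, Complex.ofReal_re, Complex.ofReal_im, mul_zero, sub_zero]
  rw [mul_assoc]
  exact mul_le_mul_of_nonneg_left h1 hl

theorem ProfileBounds.norm_dualPhase_le_one (hb : ProfileBounds P W K η ρ)
    (h : IsStrongProfile P W) (hl : 0 ≤ lam.re) {x : ℝ} (hx : x ≤ 0) :
    ‖dualPhase P W lam x‖ ≤ 1 := by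
  refine (hb.norm_dualPhase_le h hl hx).trans (Real.exp_le_one_iff.2 ?_)
  have : 0 ≤ P.Gam / K := div_nonneg (h.subsonic x hx).gam_pos.le (by linarith [hb.one_le])
  exact mul_nonpos_of_nonneg_of_nonpos (mul_nonneg hl this) hx

/-- Derivative of the pairing of the dual mode with an inhomogeneous solution. -/
theorem IsDualMode.hasDerivWithinAt_pairing (hf : IsDualMode P W ρ σ κ f)
    (h : IsStrongProfile P W) (hl : -σ < lam.re) {Q : ℝ → Fin 4 → ℂ} {g : Fin 4 → ℂ} {x : ℝ}
    (hx : x ≤ 0)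
    (hQ : HasDerivWithinAt Q ((charCoeff P ρ (W x) lam).mulVec (Q x) + g) (Iic 0) x) :
    HasDerivWithinAt (fun y => dualPhase P W lam y * ∑ k, f lam y k * Q y k)
      (dualPhase P W lam x * ∑ k, f lam x k * g k) (Iic 0) x := by
  have hm : HasDerivWithinAt (dualPhase P W lam)
      (dualPhase P W lam x * (lam * (slowness P (W x) 0 : ℂ))) (Iic 0) x :=
    ((hasDerivWithinAt_prim (h.continuousOn_slowness 0) hx).ofReal_comp.const_mul lam).cexp
  rw [hasDerivWithinAt_pi] at hQ
  have hs := HasDerivWithinAt.fun_sum (u := Finset.univ) fun k (_ : k ∈ Finset.univ) =>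
    (hf.ode lam hl x hx k).mul (hQ k)
  refine (hm.mul hs).congr_deriv ?_
  simp only [charCoeff, cplx, Matrix.mulVec, dotProduct, Fin.sum_univ_four, Pi.add_apply,
    Matrix.sub_apply, Matrix.map_apply, Matrix.add_apply, Matrix.smul_apply, Matrix.diagonal_apply,
    relSlowness, smul_eq_mul]
  simp
  ring

/-- Adjoint and direct solutions have constant pairing; `dualPhase` restores the factor removed from
the adjoint mode. -/
theorem IsDualMode.pairing_eq (hf : IsDualMode P W ρ σ κ f) (h : IsStrongProfile P W)
    (hρ : ρ ≠ 0) (hl : -σ < lam.re) {Z : ℝ → Fin 4 → ℂ} (hZ : SolvesEigenvalueODE P W lam Z)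
    {x : ℝ} (hx : x ≤ 0) :
    dualPhase P W lam x * ∑ k, f lam x k * charCoord P W ρ Z x k
      = ∑ k, f lam 0 k * charCoord P W ρ Z 0 k := by
  have h1 := eq_of_hasDerivWithinAt_zero (g := fun y => dualPhase P W lam y *
    ∑ k, f lam y k * charCoord P W ρ Z y k) (fun y hy => ?_) hx
  · simpa [dualPhase_zero] using h1
  · have h2 := hf.hasDerivWithinAt_pairing h hl (g := 0) hy
      (by rw [add_zero]; exact h.charCoord_ode hρ hZ hy)
    simpa using h2

theorem IsDualMode.norm_le_two (hf : IsDualMode P W ρ σ κ f) (hκ : κ ≤ 1) (hl : -σ < lam.re)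
    {x : ℝ} (hx : x ≤ 0) (k : Fin 4) : ‖f lam x k‖ ≤ 2 := by
  have h1 := hf.close lam hl x hx k
  have h2 : ‖(if k = 0 then 1 else 0 : ℂ)‖ ≤ 1 := by split_ifs <;> simp
  have h3 := norm_add_le (f lam x k - if k = 0 then 1 else 0) (if k = 0 then 1 else 0)
  rw [sub_add_cancel] at h3
  linarith

/-- Translation invariance: along the profile `A W' = R(W)`, so `R(W)' = E W' = E A⁻¹ R(W)`. -/
theorem IsStrongProfile.solves_source (h : IsStrongProfile P W) :
    SolvesEigenvalueODE P W 0 (fun x i => (source P (W x) i : ℂ)) := by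
  intro x hx
  have hs := h.subsonic x hx
  obtain ⟨V, hV, hAV⟩ := h.hasDeriv x hx
  have h1 := (hasFDerivAt_source P (W x) h.cv_pos.ne' hs.energy_pos.ne').comp_hasDerivWithinAt x hV
  rw [hasDerivWithinAt_pi] at h1 ⊢
  intro i
  refine (h1 i).ofReal_comp.congr_deriv ?_
  have hc : ∀ (M : Matrix (Fin 4) (Fin 4) ℝ) (v : State),
      (cplx M).mulVec (fun i => (v i : ℂ)) = fun i => ((M.mulVec v i : ℝ) : ℂ) := by
    intro M v
    ext i
    simp [Matrix.mulVec, dotProduct]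
  have h2 : (cplx (fluxJac P (W x)))⁻¹.mulVec (fun i => (source P (W x) i : ℂ))
      = fun i => (V i : ℂ) := by
    rw [← hAV, ← hc, Matrix.mulVec_mulVec, Matrix.nonsing_inv_mul _ hs.isUnit_det,
      Matrix.one_mulVec]
  rw [coeffG, ← Matrix.mulVec_mulVec, h2, zero_smul, neg_zero, zero_add, hc]
  rfl

theorem charCoord_source (P : Params) (W : ℝ → State) (ρ x : ℝ) (k : Fin 4) :
    charCoord P W ρ (fun x i => (source P (W x) i : ℂ)) x k
      = ((rate P (W x) * W x 3 * reactionChar P ρ k : ℝ) : ℂ) := by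
  rw [charCoord]
  fin_cases k <;>
    simp [Matrix.mulVec, dotProduct, Fin.sum_univ_four, charMat, source, reactionChar, rate] <;>
    ring

theorem ProfileBounds.tendsto_exp (hb : ProfileBounds P W K η ρ) :
    Tendsto (fun x => Real.exp (η * x)) atBot (𝓝 0) :=
  Real.tendsto_exp_atBot.comp (tendsto_id.const_mul_atBot hb.eta_pos)

/-- The source vector is nearly annihilated by the dual mode at small frequencies. -/
theorem IsDualMode.norm_pairing_source_le (hf : IsDualMode P W ρ σ κ f) (hκ : κ ≤ 1)
    (hσ : 0 < σ) (hb : ProfileBounds P W K η ρ) (h : IsStrongProfile P W) (hl : 0 ≤ lam.re) :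
    ‖∑ k, f lam 0 k * charCoord P W ρ (fun x i => (source P (W x) i : ℂ)) 0 k‖
      ≤ ‖lam‖ * (16 * K ^ 3 * ρ / η) := by
  have hl' : -σ < lam.re := by linarith
  have hK := hb.one_le
  have hρ := hb.rho_pos
  set Q := charCoord P W ρ (fun x i => (source P (W x) i : ℂ)) with hQdef
  have hQ : ∀ x ≤ 0, ∀ k, ‖Q x k‖ ≤ K * ρ * Real.exp (η * x) := by
    intro x hx k
    have h1 := hb.abs_reactionChar_le h hx k
    have h2 := hb.rate_le x hx
    have h3 := hb.eta_pos.le.trans (hb.le_rate x hx)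
    have h4 := hb.z_nonneg x hx
    have h5 := hb.z_le x hx
    rw [hQdef, charCoord_source, Complex.norm_real, Real.norm_eq_abs, abs_mul, abs_mul,
      abs_of_nonneg h3, abs_of_nonneg h4]
    calc _ ≤ 1 * Real.exp (η * x) * (K * ρ) := by gcongr
      _ = _ := by ring
  -- Since the source solves the equation at frequency zero, its defect at frequency `λ` is just `λ
  -- ν Q`; this is the origin of the factor `‖lam‖`.
  let g : ℝ → Fin 4 → ℂ := fun x k => lam * ((slowness P (W x) k : ℂ) * Q x k)
  have hder : ∀ x ≤ 0, HasDerivWithinAt (fun y => dualPhase P W lam y * ∑ k, f lam y k * Q y k)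
      (dualPhase P W lam x * ∑ k, f lam x k * g x k) (Iic 0) x := by
    intro x hx
    refine hf.hasDerivWithinAt_pairing h hl' hx ?_
    refine (h.charCoord_ode hρ.ne' h.solves_source hx).congr_deriv ?_
    rw [charCoeff, charCoeff, zero_smul, sub_zero, Matrix.sub_mulVec]
    have : (lam • cplx (Matrix.diagonal (slowness P (W x)))).mulVec (Q x) = g x := by
      ext k
      simp [Matrix.mulVec, dotProduct, g, Matrix.diagonal_apply, apply_ite]
      ring
    rw [this]
    abel
  have hbound : ∀ x ≤ 0, ‖dualPhase P W lam x * ∑ k, f lam x k * g x k‖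
      ≤ (‖lam‖ * (16 * K ^ 3 * ρ)) * Real.exp (η * x) := by
    intro x hx
    rw [norm_mul]
    have h1 := hb.norm_dualPhase_le_one h hl hx
    have h2 : ‖∑ k, f lam x k * g x k‖
        ≤ ∑ _k : Fin 4, 2 * (‖lam‖ * (2 * K ^ 2 * (K * ρ * Real.exp (η * x)))) := by
      refine (norm_sum_le _ _).trans (Finset.sum_le_sum fun k _ => ?_)
      simp only [g]
      rw [norm_mul, norm_mul, norm_mul, Complex.norm_real, Real.norm_eq_abs]
      have h3 := hf.norm_le_two hκ hl' hx k
      have h4 := hb.abs_slowness_le h hx k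
      have h5 := hQ x hx k
      gcongr
    calc _ ≤ 1 * ‖∑ k, f lam x k * g x k‖ := by gcongr
      _ ≤ _ := by
        rw [one_mul]
        refine h2.trans (le_of_eq ?_)
        simp; ring
  -- The decay is that of the source itself, so the argument also covers `Re λ = 0`, where the phase
  -- has modulus one.
  have hlim : Tendsto (fun y => dualPhase P W lam y * ∑ k, f lam y k * Q y k) atBot (𝓝 0) := by
    have hz : Tendsto (fun x => 8 * (K * ρ) * Real.exp (η * x)) atBot (𝓝 0) := by
      simpa using hb.tendsto_exp.const_mul (8 * (K * ρ))
    refine squeeze_zero_norm' ?_ hz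
    filter_upwards [eventually_le_atBot 0] with x hx
    rw [norm_mul]
    have h1 := hb.norm_dualPhase_le_one h hl hx
    have h2 : ‖∑ k, f lam x k * Q x k‖ ≤ ∑ _k : Fin 4, 2 * (K * ρ * Real.exp (η * x)) := by
      refine (norm_sum_le _ _).trans (Finset.sum_le_sum fun k _ => ?_)
      rw [norm_mul]
      have h3 := hf.norm_le_two hκ hl' hx k
      have h5 := hQ x hx k
      gcongr
    calc _ ≤ 1 * ‖∑ k, f lam x k * Q x k‖ := by gcongr
      _ ≤ _ := by
        rw [one_mul]
        refine h2.trans (le_of_eq ?_)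
        simp; ring
  have hfin := norm_le_of_tendsto_zero_of_deriv_le hb.eta_pos hder hbound hlim
  simp only [dualPhase_zero, one_mul] at hfin
  refine hfin.trans (le_of_eq ?_)
  ring

/-- Characteristic coordinates of the jump at the Neumann shock. -/
theorem IsStrongProfile.charMat_mulVec_jump (h : IsStrongProfile P W) :
    (charMat P ρ (W 0)).mulVec (unburned P - W 0)
      = ![-(W 0 1 * ((P.Gam + 1) * pressure P (W 0) + impedance P (W 0) - P.Gam * W 0 1)),
          -(W 0 1 * ((P.Gam + 1) * pressure P (W 0) - impedance P (W 0) - P.Gam * W 0 1)),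
          W 0 1 ^ 2, 0] := by
  rw [h.jump]
  ext k
  fin_cases k <;> simp [charMat, Matrix.mulVec, dotProduct, Fin.sum_univ_four] <;> ring

theorem charCoord_zero_shockColumn (P : Params) (W : ℝ → State) (ρ : ℝ) (lam : ℂ) (k : Fin 4) :
    (cplx (charMat P ρ (W 0))).mulVec (shockColumn P W lam) k
      = lam * (((charMat P ρ (W 0)).mulVec (unburned P - W 0) k : ℝ) : ℂ)
        + charCoord P W ρ (fun x i => (source P (W x) i : ℂ)) 0 k := by
  simp only [charCoord, Matrix.mulVec, dotProduct, Fin.sum_univ_four, shockColumn,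
    Matrix.map_apply, Pi.sub_apply]
  push_cast
  ring

/-- The reduced determinant `Y · (λ [W] + R)` vanishes at most linearly, and only at `λ = 0`. -/
theorem IsDualMode.le_norm_pairing_shockColumn (hf : IsDualMode P W ρ σ (1 / (38 * K ^ 4)) f)
    (hσ : 0 < σ) (hb : ProfileBounds P W K η ρ) (h : IsStrongProfile P W)
    (hsmall : 1000 * K ^ 8 * ρ ≤ η) (hl : 0 ≤ lam.re) :
    ‖lam‖ * (1 / (2 * K ^ 2))
      ≤ ‖∑ k, f lam 0 k * (cplx (charMat P ρ (W 0))).mulVec (shockColumn P W lam) k‖ := by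
  have hK := hb.one_le
  have hρ := hb.rho_pos
  have hη := hb.eta_pos
  have hl' : -σ < lam.re := by linarith
  have hK4 : 1 ≤ K ^ 4 := one_le_pow₀ hK
  have hκ : 1 / (38 * K ^ 4) ≤ 1 := by
    rw [div_le_one (by positivity)]; linarith
  have hs := h.subsonic 0 le_rfl
  have hR := hf.norm_pairing_source_le hκ hσ hb h hl
  set R := ∑ k, f lam 0 k * charCoord P W ρ (fun x i => (source P (W x) i : ℂ)) 0 k with hRdef
  set J := (charMat P ρ (W 0)).mulVec (unburned P - W 0) with hJ
  -- The main term `λ J₀` is that of the inert shock; the errors are the deviation of `f` from `e₀`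
  -- and the source pairing `R`.
  have hsplit : ∑ k, f lam 0 k * (cplx (charMat P ρ (W 0))).mulVec (shockColumn P W lam) k
      = lam * ((J 0 : ℂ) + ∑ k, (f lam 0 k - if k = 0 then 1 else 0) * (J k : ℂ)) + R := by
    simp only [charCoord_zero_shockColumn, ← hJ, hRdef, Fin.sum_univ_four]
    simp
    ring
  have hu := hb.le_u 0 le_rfl
  have hu1 := hb.u_le 0 le_rfl
  have hpK := hb.pressure_le 0 le_rfl
  have hup := hb.u_le_pressure 0 le_rfl
  have hD := hs.impedance_pos
  have hDK := hb.impedance_le 0 le_rfl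
  have hG := hs.gam_pos
  have hGK := hb.gam_le
  have hu0 : 0 < W 0 1 := lt_of_lt_of_le (inv_pos.2 (by linarith)) hu
  have hJv : J = _ := h.charMat_mulVec_jump
  have hKK : K ≤ K ^ 2 := by nlinarith
  have e1 : P.Gam * pressure P (W 0) ≤ K ^ 2 := by
    rw [pow_two]; have := hs.pressure_pos; gcongr
  have e2 : 0 ≤ P.Gam * (pressure P (W 0) - W 0 1) := mul_nonneg hG.le (by linarith)
  have e3 : P.Gam * W 0 1 ≤ K := by
    calc _ ≤ K * 1 := by gcongr
      _ = K := mul_one K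
  have e4 : 0 ≤ P.Gam * W 0 1 := by positivity
  -- `-J₀ = u (p + Γ(p - u) + D) ≥ u²`, because `p ≥ u`.
  have hJ0 : (K ^ 2)⁻¹ ≤ -J 0 := by
    rw [hJv]
    simp only [Matrix.cons_val_zero, neg_neg]
    calc (K ^ 2)⁻¹ = K⁻¹ * K⁻¹ := by rw [pow_two, mul_inv]
      _ ≤ W 0 1 * W 0 1 := by gcongr
      _ ≤ _ := by
        refine mul_le_mul_of_nonneg_left ?_ hu0.le
        linarith
  have hJb : ∀ k, |J k| ≤ 4 * K ^ 2 := by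
    have aux : ∀ y : ℝ, |y| ≤ 4 * K ^ 2 → |-(W 0 1 * y)| ≤ 4 * K ^ 2 := by
      intro y hy
      rw [abs_neg, abs_mul, abs_of_pos hu0]
      calc _ ≤ 1 * (4 * K ^ 2) := by gcongr
        _ = _ := one_mul _
    rw [hJv]
    intro k
    fin_cases k
    · exact aux _ (abs_le.2 ⟨by linarith, by linarith⟩)
    · exact aux _ (abs_le.2 ⟨by linarith, by linarith⟩)
    · change |W 0 1 ^ 2| ≤ _
      rw [abs_of_nonneg (sq_nonneg _)]
      nlinarith
    · change |(0 : ℝ)| ≤ _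
      rw [abs_zero]; positivity
  have hE1 : ‖∑ k, (f lam 0 k - if k = 0 then 1 else 0) * (J k : ℂ)‖ ≤ 16 / 38 * (K ^ 2)⁻¹ := by
    calc _ ≤ ∑ _k : Fin 4, 1 / (38 * K ^ 4) * (4 * K ^ 2) := by
          refine (norm_sum_le _ _).trans (Finset.sum_le_sum fun k _ => ?_)
          rw [norm_mul, Complex.norm_real, Real.norm_eq_abs]
          have h1 := hf.close lam hl' 0 le_rfl k
          have h2 := hJb k
          gcongr
      _ = _ := by simp; field_simp; norm_num
  have hE2 : 16 * K ^ 3 * ρ / η ≤ 16 / 1000 * (K ^ 2)⁻¹ := by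
    rw [← div_eq_mul_inv, div_le_div_iff₀ hη (by positivity)]
    have h5 : K ^ 5 * ρ ≤ K ^ 8 * ρ := by gcongr; norm_num
    calc 16 * K ^ 3 * ρ * K ^ 2 = 16 * (K ^ 5 * ρ) := by ring
      _ ≤ 16 * (K ^ 8 * ρ) := by linarith
      _ ≤ _ := by linarith
  have hJn : (K ^ 2)⁻¹ ≤ ‖(J 0 : ℂ)‖ := by
    rw [Complex.norm_real, Real.norm_eq_abs]
    exact hJ0.trans (neg_le_abs _)
  set S := ∑ k, (f lam 0 k - if k = 0 then 1 else 0) * (J k : ℂ) with hS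
  have hlow : (K ^ 2)⁻¹ - 16 / 38 * (K ^ 2)⁻¹ ≤ ‖(J 0 : ℂ) + S‖ := by
    have := norm_sub_le ((J 0 : ℂ) + S) S
    rw [add_sub_cancel_right] at this
    linarith
  rw [hsplit]
  have h1 := norm_sub_le (lam * ((J 0 : ℂ) + S) + R) R
  rw [add_sub_cancel_right, norm_mul] at h1
  have h2 := mul_le_mul_of_nonneg_left hlow (norm_nonneg lam)
  have h3 := mul_le_mul_of_nonneg_left hE2 (norm_nonneg lam)
  have h4 : 0 ≤ ‖lam‖ * (K ^ 2)⁻¹ := by positivity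
  -- The final constant rests on `1 - 16/38 - 16/1000 > 1/2`.
  have h5 : 1 / (2 * K ^ 2) = (K ^ 2)⁻¹ / 2 := by field_simp
  rw [h5]
  nlinarith

end DualMode

end ZND

/-! ### The annihilating covector at the shock and the factorization of the determinant. -/

namespace ZND

variable {P : Params} {W : ℝ → State} {K η ρ σ κ : ℝ} {f : ℂ → ℝ → Fin 4 → ℂ} {lam : ℂ}

/-- Value at the shock of the dual mode, in the original coordinates. -/
def dualVec (P : Params) (W : ℝ → State) (ρ : ℝ) (f : ℂ → ℝ → Fin 4 → ℂ) (lam : ℂ) : Fin 4 → ℂ :=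
  Matrix.vecMul (f lam 0) (cplx (charMat P ρ (W 0)))

theorem dualVec_dotProduct (P : Params) (W : ℝ → State) (ρ : ℝ) (f : ℂ → ℝ → Fin 4 → ℂ)
    (lam : ℂ) (v : Fin 4 → ℂ) :
    dotProduct (dualVec P W ρ f lam) v
      = ∑ k, f lam 0 k * (cplx (charMat P ρ (W 0))).mulVec v k :=
  (Matrix.dotProduct_mulVec _ _ _).symm

theorem IsDualMode.one_div_le (hf : IsDualMode P W ρ σ κ f) (hl : -σ < lam.re) {x : ℝ}
    (hx : x ≤ 0) : 1 - κ ≤ ‖f lam x 0‖ := by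
  have h1 := hf.close lam hl x hx 0
  rw [if_pos rfl] at h1
  have h2 := norm_sub_norm_le (1 : ℂ) (f lam x 0)
  rw [norm_one, norm_sub_rev] at h2
  linarith

theorem IsDualMode.norm_le (hf : IsDualMode P W ρ σ κ f) (hl : -σ < lam.re) {x : ℝ}
    (hx : x ≤ 0) {k : Fin 4} (hk : k ≠ 0) : ‖f lam x k‖ ≤ κ := by
  simpa [hk] using hf.close lam hl x hx k

/-- The first column of the frame is `(-p, -p, p, 0)`, so this entry is `-p (f₀ + f₁ - f₂)`, and
`|f₀| ≥ 1 - κ > 2κ`. Coordinate `0` then serves as pivot for the orthogonal hyperplane. -/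
theorem IsDualMode.dualVec_zero_ne (hf : IsDualMode P W ρ σ κ f) (hκ : κ < 1 / 4)
    (h : IsStrongProfile P W) (hl : -σ < lam.re) : dualVec P W ρ f lam 0 ≠ 0 := by
  have hp := (h.subsonic 0 le_rfl).pressure_pos
  have h0 := hf.one_div_le hl le_rfl
  have h1 := hf.norm_le hl le_rfl (k := 1) (by decide)
  have h2 := hf.norm_le hl le_rfl (k := 2) (by decide)
  have he : dualVec P W ρ f lam 0
      = -((pressure P (W 0) : ℂ) * (f lam 0 0 - (f lam 0 2 - f lam 0 1))) := by
    simp [dualVec, Matrix.vecMul, dotProduct, Fin.sum_univ_four, charMat]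
    ring
  rw [he, neg_ne_zero]
  refine mul_ne_zero (Complex.ofReal_ne_zero.2 hp.ne') fun h3 => ?_
  have h4 := norm_sub_le (f lam 0 2) (f lam 0 1)
  rw [← sub_eq_zero.1 h3] at h4
  linarith

theorem IsDualMode.differentiableOn_dualVec (hf : IsDualMode P W ρ σ κ f) (j : Fin 4) :
    DifferentiableOn ℂ (fun lam => dualVec P W ρ f lam j) {lam : ℂ | -σ < lam.re} := by
  simp only [dualVec, Matrix.vecMul, dotProduct]
  exact DifferentiableOn.fun_sum fun k _ =>
    (differentiableOn_pi.1 hf.diff k).mul (differentiableOn_const _)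

theorem ProfileBounds.abs_charMat_le (hb : ProfileBounds P W K η ρ) (h : IsStrongProfile P W)
    {x : ℝ} (hx : x ≤ 0) (i j : Fin 4) : |charMat P ρ (W x) i j| ≤ 2 * K := by
  have hK := hb.one_le
  have hs := h.subsonic x hx
  have hp := hs.pressure_pos
  have hpK := hb.pressure_le x hx
  have hG := hs.gam_pos
  have hGK := hb.gam_le
  have hD := hs.impedance_pos
  have hDK := hb.impedance_le x hx
  have hu : 0 < W x 1 := lt_of_lt_of_le (inv_pos.2 (by linarith)) (hb.le_u x hx)
  have hu1 := hb.u_le x hx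
  have hρ := hb.rho_pos
  have hρ1 := hb.rho_le
  have hGu : P.Gam * W x 1 ≤ K := by
    calc _ ≤ K * 1 := by gcongr
      _ = K := mul_one K
  have hGu0 : 0 < P.Gam * W x 1 := by positivity
  fin_cases i <;> fin_cases j <;> 
    simp only [charMat, Matrix.of_apply, Matrix.cons_val', Matrix.cons_val_fin_one, Matrix.cons_val,
      Fin.zero_eta, Fin.mk_one, Fin.reduceFinMk, Fin.isValue] <;>
    exact abs_le.2 ⟨by linarith, by linarith⟩

theorem norm_charCoord_le (hb : ProfileBounds P W K η ρ) (h : IsStrongProfile P W)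
    {Z : ℝ → Fin 4 → ℂ} {x : ℝ} (hx : x ≤ 0) : ‖charCoord P W ρ Z x‖ ≤ 8 * K * ‖Z x‖ := by
  have h1 := norm_mulVec_le_card (cplx (charMat P ρ (W x))) (Z x) (c := 2 * K)
    (by linarith [hb.one_le]) fun i j => by
      exact (Complex.norm_real _).trans_le (hb.abs_charMat_le h hx i j)
  refine h1.trans (le_of_eq ?_)
  rw [Fintype.card_fin]; push_cast; ring

/-- For `Re λ > 0` the dual mode annihilates every bounded solution. -/
theorem IsDualMode.dualVec_orthogonal (hf : IsDualMode P W ρ σ κ f) (hκ : κ ≤ 1) (hσ : 0 < σ)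
    (hb : ProfileBounds P W K η ρ) (h : IsStrongProfile P W) (hl : 0 < lam.re)
    {Z : ℝ → Fin 4 → ℂ} (hZ : SolvesEigenvalueODE P W lam Z) {C : ℝ}
    (hC : ∀ x ≤ 0, ‖Z x‖ ≤ C) : dotProduct (dualVec P W ρ f lam) (Z 0) = 0 := by
  have hl' : -σ < lam.re := by linarith
  have hK := hb.one_le
  have hθ : 0 < lam.re * (P.Gam / K) :=
    mul_pos hl (div_pos (h.subsonic 0 le_rfl).gam_pos (by linarith))
  rw [dualVec_dotProduct, ← norm_eq_zero]
  have hC0 : 0 ≤ C := (norm_nonneg _).trans (hC 0 le_rfl)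
  -- The pairing has the same value at every `x`, while the phase drives it to zero at `-∞` against
  -- bounded `f` and `Z`.
  have hle : ∀ x ≤ 0, ‖∑ k, f lam 0 k * (cplx (charMat P ρ (W 0))).mulVec (Z 0) k‖
      ≤ 64 * K * C * Real.exp (lam.re * (P.Gam / K) * x) := by
    intro x hx
    have h1 := hf.pairing_eq h hb.rho_pos.ne' hl' hZ hx
    rw [show (∑ k, f lam 0 k * (cplx (charMat P ρ (W 0))).mulVec (Z 0) k)
      = ∑ k, f lam 0 k * charCoord P W ρ Z 0 k from rfl, ← h1, norm_mul]
    have h2 := hb.norm_dualPhase_le h hl.le hx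
    have h3 : ‖∑ k, f lam x k * charCoord P W ρ Z x k‖ ≤ ∑ _k : Fin 4, 2 * (8 * K * C) := by
      refine (norm_sum_le _ _).trans (Finset.sum_le_sum fun k _ => ?_)
      rw [norm_mul]
      have h4 := hf.norm_le_two hκ hl' hx k
      have h5 := (norm_le_pi_norm (charCoord P W ρ Z x) k).trans (norm_charCoord_le hb h hx)
      have h6 := hC x hx
      calc _ ≤ 2 * (8 * K * ‖Z x‖) := by gcongr
        _ ≤ _ := by gcongr
    calc _ ≤ Real.exp (lam.re * (P.Gam / K) * x) * ∑ _k : Fin 4, 2 * (8 * K * C) := by gcongr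
      _ = _ := by simp; ring
  have hlim : Tendsto (fun x => 64 * K * C * Real.exp (lam.re * (P.Gam / K) * x)) atBot (𝓝 0) := by
    simpa using (Real.tendsto_exp_atBot.comp (tendsto_id.const_mul_atBot hθ)).const_mul
      (64 * K * C)
  exact le_antisymm (ge_of_tendsto hlim ((eventually_le_atBot 0).mono hle)) (norm_nonneg _)

section LinearAlgebra

/-- The `3 × 3` minor complementary to the first row. -/
def minor (z : Fin 3 → Fin 4 → ℂ) : ℂ := (Matrix.of fun i j : Fin 3 => z j i.succ).det

/-- Scale the first row of the matrix with columns `z 0, z 1, z 2, v` by `y 0` and add `y i` times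
the other rows: it becomes `(0, 0, 0, y·v)`. The minus sign is that of the corner cofactor. -/
theorem det_mul_eq_minor_mul {y : Fin 4 → ℂ} {z : Fin 3 → Fin 4 → ℂ} {v : Fin 4 → ℂ}
    (hz : ∀ j, dotProduct y (z j) = 0) :
    (Matrix.of ![z 0, z 1, z 2, v]).transpose.det * y 0 = -(minor z * dotProduct y v) := by
  have h0 := hz 0
  have h1 := hz 1
  have h2 := hz 2
  simp only [dotProduct, Fin.sum_univ_four] at h0 h1 h2 ⊢
  rw [Matrix.det_transpose, minor, Matrix.det_fin_three]
  simp only [Matrix.of_apply, Fin.succ_zero_eq_one, Fin.succ_one_eq_two,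
    show Fin.succ (2 : Fin 3) = (3 : Fin 4) from rfl]
  simp only [Matrix.det_succ_row_zero, Fin.sum_univ_succ]
  simp [Fin.succAbove, Matrix.submatrix_apply]
  generalize z 0 = a at *
  generalize z 1 = b at *
  generalize z 2 = c at *
  let d (p q r : Fin 4 → ℂ) : ℂ := p 1 * (q 2 * r 3 - q 3 * r 2) - p 2 * (q 1 * r 3 - q 3 * r 1)
    + p 3 * (q 1 * r 2 - q 2 * r 1)
  linear_combination d b c v * h0 - d a c v * h1 + d a b v * h2

end LinearAlgebra

end ZND

/-! ### Exponential decay of solutions orthogonal to the dual mode. -/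

namespace ZND

variable {P : Params} {W : ℝ → State} {K η ρ σ κ : ℝ} {f : ℂ → ℝ → Fin 4 → ℂ} {lam : ℂ}

theorem hasDerivWithinAt_normSq_ge {q : ℝ → ℂ} {c r : ℂ} {t x : ℝ} {s : Set ℝ}
    (hq : HasDerivWithinAt q (c * q x + r) s x) (hc : t ≤ c.re) :
    ∃ d, HasDerivWithinAt (fun y => ‖q y‖ ^ 2) d s x ∧
      2 * t * ‖q x‖ ^ 2 - 2 * ‖q x‖ * ‖r‖ ≤ d := by
  refine ⟨_, hq.norm_sq, ?_⟩
  have h1 : inner ℝ (q x) (c * q x) = c.re * ‖q x‖ ^ 2 := by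
    rw [Complex.inner, ← Complex.normSq_eq_norm_sq, mul_assoc, Complex.mul_conj, Complex.re_mul_ofReal]
  have h2 : -(‖q x‖ * ‖r‖) ≤ inner ℝ (q x) r := (abs_le.1 (abs_real_inner_le_norm _ _)).1
  rw [inner_add_right, h1]
  nlinarith [mul_le_mul_of_nonneg_right hc (sq_nonneg ‖q x‖)]

/-- Here `a, b, c` stand for the moduli of the second acoustic, entropy and reactant components. The
coupling `ε c` out of the reactant does not decay; the weight satisfies `Q η = η + ε²/t`, so the
damping absorbs it. All other couplings carry the integrable factor `E`. -/
theorem energy_inequality {a b c ε E t η Q : ℝ}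
    (hε : 0 ≤ ε) (hE : 0 ≤ E) (ht : 0 < t) (hη : 0 < η) (hQ : Q = 1 + ε ^ 2 / (t * η)) :
    (t - 12 * ε * (1 + Q) * E) * (a ^ 2 + b ^ 2 + Q * c ^ 2) ≤
      (2 * t * a ^ 2 - 2 * a * (2 * ε * E * (a + b + c) + ε * c))
      + (2 * t * b ^ 2 - 2 * b * (2 * ε * E * (a + b + c) + ε * c))
      + Q * (2 * (t + η) * c ^ 2 - 2 * c * (2 * ε * E * (a + b + c))) := by
  have hQ1 : 1 ≤ Q := by rw [hQ]; have : 0 ≤ ε ^ 2 / (t * η) := by positivity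
                         linarith
  have hQ2 : Q * η = η + ε ^ 2 / t := by rw [hQ]; field_simp
  set S := a ^ 2 + b ^ 2 + c ^ 2 with hS
  have hS0 : 0 ≤ S := by positivity
  have hSN : S ≤ a ^ 2 + b ^ 2 + Q * c ^ 2 := by nlinarith [sq_nonneg c]
  have h1 : (a + b) * (a + b + c) ≤ 3 * S := by
    nlinarith [sq_nonneg (a - b), sq_nonneg (a - c), sq_nonneg (b - c)]
  have h2 : c * (a + b + c) ≤ 3 * S := by
    nlinarith [sq_nonneg (a - c), sq_nonneg (b - c), sq_nonneg (a), sq_nonneg b]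
  have h3 : 2 * ε * (a + b) * c ≤ t * (a ^ 2 + b ^ 2) + 2 * (ε ^ 2 / t) * c ^ 2 := by
    have e : t * (a ^ 2 + b ^ 2) + 2 * (ε ^ 2 / t) * c ^ 2 - 2 * ε * (a + b) * c
        = t * ((a - ε * c / t) ^ 2 + (b - ε * c / t) ^ 2) := by
      field_simp; ring
    have : 0 ≤ t * ((a - ε * c / t) ^ 2 + (b - ε * c / t) ^ 2) := by positivity
    linarith
  have hεE : 0 ≤ 4 * ε * E := by positivity
  have h4 := mul_le_mul_of_nonneg_left h1 hεE
  have h5 := mul_le_mul_of_nonneg_left h2 (mul_nonneg hεE (by linarith : 0 ≤ Q))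
  have h6 : 12 * ε * (1 + Q) * E * S ≤ 12 * ε * (1 + Q) * E * (a ^ 2 + b ^ 2 + Q * c ^ 2) :=
    mul_le_mul_of_nonneg_left hSN (by positivity)
  have h7 : Q * η * c ^ 2 = η * c ^ 2 + ε ^ 2 / t * c ^ 2 := by rw [hQ2]; ring
  have h8 : 0 ≤ η * c ^ 2 := by positivity
  have h9 : 0 ≤ Q * t * c ^ 2 := by positivity
  nlinarith

/-- Rationalized, `-ν₁ = τ/(D + τ)`, and `τ` is bounded below through `Γ² ≤ K²D² = K²(Γ+1)pτ`. Only
positivity matters for the decay. -/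
theorem ProfileBounds.le_neg_slowness_one (hb : ProfileBounds P W K η ρ)
    (h : IsStrongProfile P W) {x : ℝ} (hx : x ≤ 0) :
    P.Gam ^ 2 / (4 * K ^ 5) ≤ -slowness P (W x) 1 := by
  have hs := h.subsonic x hx
  have hK := hb.one_le
  have hD := hs.impedance_pos
  have hDK := hb.impedance_le x hx
  have hτ := hs.tau_pos
  have hg := hs.gap_pos
  have hlt := hs.tau_lt_impedance
  have hp := hs.pressure_pos
  have hpK := hb.pressure_le x hx
  have hG := hs.gam_pos
  have hGK := hb.gam_le
  have hsq := hs.impedance_sq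
  have hgap : gap P (W x) * W x 0 = impedance P (W x) ^ 2 - W x 0 ^ 2 := by
    rw [hs.gap_eq]; field_simp
  have he : -slowness P (W x) 1 = W x 0 / (impedance P (W x) + W x 0) := by
    change - -((impedance P (W x) - W x 0) / gap P (W x)) = _
    rw [neg_neg, div_eq_div_iff hg.ne' (by positivity)]
    linarith
  have h1 : P.Gam ^ 2 ≤ K ^ 2 * (2 * K ^ 2 * W x 0) := by
    calc P.Gam ^ 2 ≤ (K * impedance P (W x)) ^ 2 :=
          pow_le_pow_left₀ hG.le (hb.gam_le_impedance x hx) 2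
      _ = K ^ 2 * ((P.Gam + 1) * pressure P (W x) * W x 0) := by rw [mul_pow, hsq]
      _ ≤ K ^ 2 * ((K + K) * K * W x 0) := by gcongr
      _ = _ := by ring
  rw [he, div_le_div_iff₀ (by positivity) (by positivity)]
  calc P.Gam ^ 2 * (impedance P (W x) + W x 0) ≤ (K ^ 2 * (2 * K ^ 2 * W x 0)) * (K + K) := by
        gcongr; linarith
    _ = _ := by ring

/-- Characteristic coordinates control the vector. -/
theorem norm_le_of_charCoord (hb : ProfileBounds P W K η ρ) (h : IsStrongProfile P W) :
    ∃ C, 0 ≤ C ∧ ∀ (Z : ℝ → Fin 4 → ℂ) (x : ℝ), x ≤ 0 → ‖Z x‖ ≤ C * ‖charCoord P W ρ Z x‖ := by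
  have hK := hb.one_le
  have hG := (h.subsonic 0 le_rfl).gam_pos
  have hρ := hb.rho_pos
  set C1 := K / P.Gam with hC1
  have hC10 : 0 < C1 := div_pos (by linarith) hG
  set C2 := C1 + 2 with hC2
  set C0 := K * (1 + C1 + C2) with hC0
  refine ⟨C0 + C1 + C2 + 1 / ρ, by positivity, fun Z x hx => ?_⟩
  have hs := h.subsonic x hx
  have hD := hs.impedance_pos
  have hp := hs.pressure_pos
  have hpi : (pressure P (W x))⁻¹ ≤ K :=
    inv_le_of_inv_le₀ (by linarith) ((hb.le_u x hx).trans (hb.u_le_pressure x hx))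
  have hu : 0 < W x 1 := lt_of_lt_of_le (inv_pos.2 (by linarith)) (hb.le_u x hx)
  have hu1 := hb.u_le x hx
  set X := ‖charCoord P W ρ Z x‖ with hX
  have hX0 : 0 ≤ X := norm_nonneg _
  have hk : ∀ k, ‖charCoord P W ρ Z x k‖ ≤ X := fun k => norm_le_pi_norm _ k
  set Q := charCoord P W ρ Z x with hQ
  have q0 : Q 0 = -(pressure P (W x) : ℂ) * Z x 0
      + ((impedance P (W x) : ℂ) - P.Gam * (W x 1 : ℂ)) * Z x 1 + P.Gam * Z x 2 := by
    simp [hQ, charCoord, Matrix.mulVec, dotProduct, Fin.sum_univ_four, charMat]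
  have q1 : Q 1 = -(pressure P (W x) : ℂ) * Z x 0
      + (-(impedance P (W x) : ℂ) - P.Gam * (W x 1 : ℂ)) * Z x 1 + P.Gam * Z x 2 := by
    simp [hQ, charCoord, Matrix.mulVec, dotProduct, Fin.sum_univ_four, charMat]
  have q2 : Q 2 = (pressure P (W x) : ℂ) * Z x 0 - (W x 1 : ℂ) * Z x 1 + Z x 2 := by
    simp [hQ, charCoord, Matrix.mulVec, dotProduct, Fin.sum_univ_four, charMat]
    ring
  have q3 : Q 3 = (ρ : ℂ) * Z x 3 := by
    simp [hQ, charCoord, Matrix.mulVec, dotProduct, Fin.sum_univ_four, charMat]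
  have hn : ∀ {y : ℝ}, 0 < y → ‖(y : ℂ)‖ = y := fun hy => by
    rw [Complex.norm_real, Real.norm_eq_abs, abs_of_pos hy]
  have z1 : ‖Z x 1‖ ≤ C1 * X := by
    have e : ((2 * impedance P (W x) : ℝ) : ℂ) * Z x 1 = Q 0 - Q 1 := by
      rw [q0, q1]; push_cast; ring
    have h1 := congrArg norm e
    rw [norm_mul, hn (by positivity)] at h1
    have h2 := (norm_sub_le (Q 0) (Q 1)).trans (add_le_add (hk 0) (hk 1))
    have h3 : impedance P (W x) * ‖Z x 1‖ ≤ X := by linarith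
    have h4 := hb.gam_le_impedance x hx
    rw [hC1, div_mul_eq_mul_div, le_div_iff₀ hG]
    calc ‖Z x 1‖ * P.Gam ≤ ‖Z x 1‖ * (K * impedance P (W x)) := by gcongr
      _ = K * (impedance P (W x) * ‖Z x 1‖) := by ring
      _ ≤ K * X := by gcongr
  have z2 : ‖Z x 2‖ ≤ C2 * X := by
    have e : ((P.Gam + 1 : ℝ) : ℂ) * (Z x 2 - (W x 1 : ℂ) * Z x 1)
        = (Q 0 + Q 1) / 2 + Q 2 := by
      rw [q0, q1, q2]; push_cast; ring
    have h1 := congrArg norm e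
    rw [norm_mul, hn (by positivity)] at h1
    have h2 : ‖(Q 0 + Q 1) / 2 + Q 2‖ ≤ 2 * X := by
      refine (norm_add_le _ _).trans ?_
      rw [norm_div, Complex.norm_two]
      have := (norm_add_le (Q 0) (Q 1)).trans (add_le_add (hk 0) (hk 1))
      have := hk 2
      linarith
    have h3 : ‖Z x 2 - (W x 1 : ℂ) * Z x 1‖ ≤ 2 * X := by
      nlinarith [norm_nonneg (Z x 2 - (W x 1 : ℂ) * Z x 1)]
    have h4 := norm_add_le (Z x 2 - (W x 1 : ℂ) * Z x 1) ((W x 1 : ℂ) * Z x 1)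
    rw [sub_add_cancel, norm_mul, hn hu] at h4
    have h5 : W x 1 * ‖Z x 1‖ ≤ 1 * (C1 * X) := by gcongr
    rw [hC2]; linarith
  have z0 : ‖Z x 0‖ ≤ C0 * X := by
    have e : (pressure P (W x) : ℂ) * Z x 0 = Q 2 + (W x 1 : ℂ) * Z x 1 - Z x 2 := by
      rw [q2]; ring
    have h1 := congrArg norm e
    rw [norm_mul, hn hp] at h1
    have h2 : ‖Q 2 + (W x 1 : ℂ) * Z x 1 - Z x 2‖ ≤ X + C1 * X + C2 * X := by
      refine (norm_sub_le _ _).trans (add_le_add ((norm_add_le _ _).trans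
        (add_le_add (hk 2) ?_)) z2)
      rw [norm_mul, hn hu]
      calc _ ≤ 1 * (C1 * X) := by gcongr
        _ = _ := one_mul _
    have h3 : ‖Z x 0‖ = (pressure P (W x))⁻¹ * (pressure P (W x) * ‖Z x 0‖) := by
      field_simp
    rw [h3, h1]
    calc _ ≤ K * (X + C1 * X + C2 * X) := by gcongr
      _ = _ := by rw [hC0]; ring
  have z3 : ‖Z x 3‖ ≤ 1 / ρ * X := by
    have h1 := congrArg norm q3
    rw [norm_mul, hn hρ] at h1
    rw [one_div, inv_mul_eq_div, le_div_iff₀ hρ]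
    have := hk 3
    linarith
  have p0 : 0 ≤ C0 * X := by positivity
  have p1 : 0 ≤ C1 * X := by positivity
  have p2 : 0 ≤ C2 * X := by positivity
  have p3 : 0 ≤ 1 / ρ * X := by positivity
  refine (pi_norm_le_iff_of_nonneg (by positivity)).2 fun i => ?_
  have e : (C0 + C1 + C2 + 1 / ρ) * X = C0 * X + C1 * X + C2 * X + 1 / ρ * X := by ring
  rw [e]
  fin_cases i
  · exact z0.trans (by linarith)
  · exact z1.trans (by linarith)
  · exact z2.trans (by linarith)
  · exact z3.trans (by linarith)

/-- For `Re λ > 0`, solutions annihilated by the dual mode decay exponentially. -/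
theorem IsDualMode.exp_decay (hf : IsDualMode P W ρ σ κ f) (hκ : κ < 1 / 4)
    (hσ : 0 < σ) (hb : ProfileBounds P W K η ρ) (h : IsStrongProfile P W) (hl : 0 < lam.re)
    {Z : ℝ → Fin 4 → ℂ} (hZ : SolvesEigenvalueODE P W lam Z)
    (horth : dotProduct (dualVec P W ρ f lam) (Z 0) = 0) :
    ∃ C θ : ℝ, 0 < θ ∧ ∀ x, x ≤ 0 → ‖Z x‖ ≤ C * Real.exp (θ * x) := by
  have hl' : -σ < lam.re := by linarith
  have hK := hb.one_le
  have hη := hb.eta_pos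
  have hρ := hb.rho_pos
  have hG := (h.subsonic 0 le_rfl).gam_pos
  set q := charCoord P W ρ Z with hq
  -- Orthogonality propagates to every `x`. Since `f` is close to `e₀`, it slaves component `0`, the
  -- one whose transport grows towards `-∞`, to the other three.
  have hslave : ∀ x ≤ 0, ‖q x 0‖ ≤ ‖q x 1‖ + ‖q x 2‖ + ‖q x 3‖ := by
    intro x hx
    have h1 := hf.pairing_eq h hρ.ne' hl' hZ hx
    rw [dualVec_dotProduct] at horth
    have h2 : ∑ k, f lam x k * q x k = 0 := by
      rcases mul_eq_zero.1 (h1.trans horth) with h3 | h3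
      · exact absurd h3 (Complex.exp_ne_zero _)
      · exact h3
    rw [Fin.sum_univ_four] at h2
    have h3 : f lam x 0 * q x 0
        = -(f lam x 1 * q x 1 + f lam x 2 * q x 2 + f lam x 3 * q x 3) := by
      linear_combination h2
    have h4 := congrArg norm h3
    rw [norm_neg, norm_mul] at h4
    have h5 : ‖f lam x 1 * q x 1 + f lam x 2 * q x 2 + f lam x 3 * q x 3‖
        ≤ κ * ‖q x 1‖ + κ * ‖q x 2‖ + κ * ‖q x 3‖ := by
      refine (norm_add₃_le).trans ?_
      simp only [norm_mul]
      have e1 := hf.norm_le hl' hx (k := 1) (by decide)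
      have e2 := hf.norm_le hl' hx (k := 2) (by decide)
      have e3 := hf.norm_le hl' hx (k := 3) (by decide)
      gcongr
    have h6 := hf.one_div_le hl' hx
    have h7 : 1 / 2 * ‖q x 0‖ ≤ ‖f lam x 0‖ * ‖q x 0‖ :=
      mul_le_mul_of_nonneg_right (by linarith) (norm_nonneg _)
    have n1 := norm_nonneg (q x 1)
    have n2 := norm_nonneg (q x 2)
    have n3 := norm_nonneg (q x 3)
    nlinarith
  set ε := 3 * K ^ 4 * ρ with hε
  have hε0 : 0 < ε := by positivity
  -- A common lower bound for the transport rates of the three remaining modes; the reactant gains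
  -- `η` on top of it.
  set t := lam.re * min (P.Gam ^ 2 / (4 * K ^ 5)) 1 with ht
  have ht0 : 0 < t := mul_pos hl (lt_min (by positivity) one_pos)
  have ht1 : t ≤ lam.re := by
    calc t ≤ lam.re * 1 := by rw [ht]; gcongr; exact min_le_right _ _
      _ = _ := mul_one _
  set Q := 1 + ε ^ 2 / (t * η) with hQ
  have hQ1 : 1 ≤ Q := by
    have : 0 ≤ ε ^ 2 / (t * η) := by positivity
    linarith
  let N : ℝ → ℝ := fun x => ‖q x 1‖ ^ 2 + ‖q x 2‖ ^ 2 + Q * ‖q x 3‖ ^ 2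
  have hstep : ∀ x ≤ 0, ∃ d, HasDerivWithinAt N d (Iic 0) x ∧
      (t - 12 * ε * (1 + Q) * Real.exp (η * x)) * N x ≤ d := by
    intro x hx
    have hode := hasDerivWithinAt_pi.1 (h.charCoord_ode hρ.ne' hZ hx)
    have hcomp : ∀ j, HasDerivWithinAt (fun y => q y j)
        ((-(lam * (slowness P (W x) j : ℂ)) + (damping P (W x) j : ℂ)) * q x j
          + ∑ k, (couplingMat P ρ (W x) j k : ℂ) * q x k) (Iic 0) x := by
      intro j
      refine (hode j).congr_deriv ?_
      rw [charCoeff, Matrix.sub_mulVec, cplx_add, Matrix.add_mulVec]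
      simp only [cplx, Matrix.mulVec, dotProduct, Pi.add_apply, Pi.sub_apply, Matrix.map_apply,
        Matrix.smul_apply, Matrix.diagonal_apply, ← hq]
      simp [apply_ite]
      ring
    have hE := Real.exp_pos (η * x)
    set E := Real.exp (η * x) with hEdef
    have hcoup : ∀ j k, k ≠ 3 → ‖(couplingMat P ρ (W x) j k : ℂ) * q x k‖ ≤ ε * E * ‖q x k‖ := by
      intro j k hk
      rw [norm_mul, Complex.norm_real]
      exact mul_le_mul_of_nonneg_right (hb.abs_couplingMat_le h hx j k hk) (norm_nonneg _)
    have hcoup3 : ∀ j, ‖(couplingMat P ρ (W x) j 3 : ℂ) * q x 3‖ ≤ ε * ‖q x 3‖ := by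
      intro j
      rw [norm_mul, Complex.norm_real]
      exact mul_le_mul_of_nonneg_right (hb.abs_couplingMat_three_le h hx j) (norm_nonneg _)
    have hsl := hslave x hx
    have hεE : 0 ≤ ε * E := by positivity
    have hr : ∀ j, ‖∑ k, (couplingMat P ρ (W x) j k : ℂ) * q x k‖
        ≤ 2 * ε * E * (‖q x 1‖ + ‖q x 2‖ + ‖q x 3‖) + ε * ‖q x 3‖ := by
      intro j
      have h1 := norm_sum_le Finset.univ fun k => (couplingMat P ρ (W x) j k : ℂ) * q x k
      rw [Fin.sum_univ_four (fun k => ‖(couplingMat P ρ (W x) j k : ℂ) * q x k‖)] at h1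
      have h2 := hcoup j 0 (by decide)
      have h3 := hcoup j 1 (by decide)
      have h4 := hcoup j 2 (by decide)
      have h5 := hcoup3 j
      nlinarith [mul_le_mul_of_nonneg_left hsl hεE, mul_nonneg hεE (norm_nonneg (q x 3))]
    have hr3 : ‖∑ k, (couplingMat P ρ (W x) 3 k : ℂ) * q x k‖
        ≤ 2 * ε * E * (‖q x 1‖ + ‖q x 2‖ + ‖q x 3‖) := by
      have h1 := norm_sum_le Finset.univ fun k => (couplingMat P ρ (W x) 3 k : ℂ) * q x k
      rw [Fin.sum_univ_four (fun k => ‖(couplingMat P ρ (W x) 3 k : ℂ) * q x k‖),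
        couplingMat_three_three] at h1
      have h2 := hcoup 3 0 (by decide)
      have h3 := hcoup 3 1 (by decide)
      have h4 := hcoup 3 2 (by decide)
      simp only [Complex.ofReal_zero, zero_mul, norm_zero, add_zero] at h1
      nlinarith [mul_le_mul_of_nonneg_left hsl hεE, mul_nonneg hεE (norm_nonneg (q x 3))]
    have hre : ∀ j, (-(lam * (slowness P (W x) j : ℂ)) + (damping P (W x) j : ℂ)).re
        = lam.re * -slowness P (W x) j + damping P (W x) j := by
      intro j; simp
    have hν1 : t ≤ lam.re * -slowness P (W x) 1 := by
      rw [ht]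
      exact mul_le_mul_of_nonneg_left
        ((min_le_left _ _).trans (hb.le_neg_slowness_one h hx)) hl.le
    have hν2 : slowness P (W x) 2 = -1 := rfl
    have hν3 : slowness P (W x) 3 = -1 := rfl
    have hd1 : damping P (W x) 1 = 0 := rfl
    have hd2 : damping P (W x) 2 = 0 := rfl
    have hd3 : damping P (W x) 3 = rate P (W x) := rfl
    obtain ⟨d1, hd1', hd1b⟩ := hasDerivWithinAt_normSq_ge (t := t) (hcomp 1)
      (by rw [hre, hd1]; linarith)
    obtain ⟨d2, hd2', hd2b⟩ := hasDerivWithinAt_normSq_ge (t := t) (hcomp 2)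
      (by rw [hre, hd2, hν2]; linarith)
    obtain ⟨d3, hd3', hd3b⟩ := hasDerivWithinAt_normSq_ge (t := t + η) (hcomp 3)
      (by rw [hre, hd3, hν3]; linarith [hb.le_rate x hx])
    refine ⟨_, (hd1'.add hd2').add (hd3'.const_mul Q), ?_⟩
    have hen := energy_inequality (a := ‖q x 1‖) (b := ‖q x 2‖) (c := ‖q x 3‖) hε0.le hE.le ht0 hη hQ
    refine hen.trans (add_le_add (add_le_add (le_trans ?_ hd1b) (le_trans ?_ hd2b))
      (mul_le_mul_of_nonneg_left (le_trans ?_ hd3b) (by linarith)))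
    · have := mul_le_mul_of_nonneg_left (hr 1) (norm_nonneg (q x 1)); linarith
    · have := mul_le_mul_of_nonneg_left (hr 2) (norm_nonneg (q x 2)); linarith
    · have := mul_le_mul_of_nonneg_left hr3 (norm_nonneg (q x 3)); linarith
  choose! N' hN' hNge using hstep
  have hN0 : ∀ x, 0 ≤ N x := fun x => by
    have : 0 ≤ Q := by linarith
    simp only [N]; positivity
  have hdec : ∀ x ≤ 0, N x ≤ N 0 * Real.exp (12 * ε * (1 + Q) / η) * Real.exp (t * x) :=
    fun x hx => decay_of_deriv_ge hη (by positivity) hN' (fun x _ => hN0 x) hNge hx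
  set C1 := N 0 * Real.exp (12 * ε * (1 + Q) / η) with hC1
  have hC10 : 0 ≤ C1 := mul_nonneg (hN0 0) (Real.exp_pos _).le
  obtain ⟨C2, hC20, hC2⟩ := norm_le_of_charCoord hb h
  refine ⟨C2 * (3 * Real.sqrt C1), t / 2, by positivity, fun x hx => ?_⟩
  have hsq : ∀ a : ℝ, 0 ≤ a → a ^ 2 ≤ N x → a ≤ Real.sqrt C1 * Real.exp (t / 2 * x) := by
    intro a ha haN
    refine le_of_sq_le_sq ?_ (by positivity)
    rw [mul_pow, Real.sq_sqrt hC10, ← Real.exp_nat_mul]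
    refine (haN.trans (hdec x hx)).trans (le_of_eq ?_)
    congr 2
    push_cast; ring
  have s1 := sq_nonneg ‖q x 1‖
  have s2 := sq_nonneg ‖q x 2‖
  have s3 := sq_nonneg ‖q x 3‖
  have s4 : ‖q x 3‖ ^ 2 ≤ Q * ‖q x 3‖ ^ 2 := le_mul_of_one_le_left s3 hQ1
  have b1 := hsq ‖q x 1‖ (norm_nonneg _) (by simp only [N]; linarith)
  have b2 := hsq ‖q x 2‖ (norm_nonneg _) (by simp only [N]; linarith)
  have b3 := hsq ‖q x 3‖ (norm_nonneg _) (by simp only [N]; linarith)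
  have b0 := hslave x hx
  set Y := Real.sqrt C1 * Real.exp (t / 2 * x) with hY
  have hY0 : 0 ≤ Y := by positivity
  have hqn : ‖q x‖ ≤ 3 * Y := by
    refine (pi_norm_le_iff_of_nonneg (by positivity)).2 fun i => ?_
    fin_cases i
    · exact b0.trans (by linarith)
    · exact b1.trans (by linarith)
    · exact b2.trans (by linarith)
    · exact b3.trans (by linarith)
  calc ‖Z x‖ ≤ C2 * ‖q x‖ := hC2 Z x hx
    _ ≤ C2 * (3 * Y) := by gcongr
    _ = _ := by rw [hY]; ring

end ZND

/-! ### Admissible bases and the zeros of the determinant. -/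

namespace ZND

variable {P : Params} {W : ℝ → State} {K η ρ σ κ : ℝ} {f : ℂ → ℝ → Fin 4 → ℂ} {lam : ℂ}

section LinearAlgebra

/-- A kernel vector gives a combination of the `z j` supported in coordinate `0`; orthogonality to
`y` with `y 0 ≠ 0` kills that coordinate too, contradicting independence. -/
theorem minor_ne_zero {y : Fin 4 → ℂ} {z : Fin 3 → Fin 4 → ℂ} (hy : y 0 ≠ 0)
    (hz : ∀ j, dotProduct y (z j) = 0) (hi : LinearIndependent ℂ z) : minor z ≠ 0 := by
  intro h0
  obtain ⟨a, ha, hm⟩ := Matrix.exists_mulVec_eq_zero_iff.2 h0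
  have hw : ∀ i : Fin 3, (∑ j, a j • z j) i.succ = 0 := by
    intro i
    have := congrFun hm i
    simp only [Matrix.mulVec, dotProduct, Matrix.of_apply, Pi.zero_apply] at this
    simp only [Finset.sum_apply, Pi.smul_apply, smul_eq_mul, ← this]
    exact Finset.sum_congr rfl fun j _ => mul_comm _ _
  have hyw : dotProduct y (∑ j, a j • z j) = 0 := by
    rw [dotProduct_sum]
    exact Finset.sum_eq_zero fun j _ => by rw [dotProduct_smul, hz, smul_zero]
  have hw0 : (∑ j, a j • z j) 0 = 0 := by
    rw [dotProduct, Fin.sum_univ_succ] at hyw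
    simp only [hw, mul_zero, Finset.sum_const_zero, add_zero] at hyw
    exact (mul_eq_zero.1 hyw).resolve_left hy
  have hzero : ∑ j, a j • z j = 0 := by
    ext i
    refine Fin.cases hw0 (fun i => hw i) i
  exact ha (funext fun j => Fintype.linearIndependent_iff.1 hi a hzero j)

/-- Basis vectors of the hyperplane orthogonal to `y`, provided `y 0 ≠ 0`. -/
def hyperplaneVec (y : Fin 4 → ℂ) (j : Fin 3) : Fin 4 → ℂ :=
  Fin.cons (-y j.succ) (fun i => if i = j then y 0 else 0)

theorem sum_smul_hyperplaneVec_succ (y : Fin 4 → ℂ) (a : Fin 3 → ℂ) (i : Fin 3) :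
    (∑ j, a j • hyperplaneVec y j) i.succ = a i * y 0 := by
  simp [hyperplaneVec, Finset.sum_apply]

theorem sum_smul_hyperplaneVec_zero (y : Fin 4 → ℂ) (a : Fin 3 → ℂ) :
    (∑ j, a j • hyperplaneVec y j) 0 = -∑ j, a j * y j.succ := by
  simp [hyperplaneVec, Finset.sum_apply, Finset.sum_neg_distrib]

theorem linearIndependent_hyperplaneVec {y : Fin 4 → ℂ} (hy : y 0 ≠ 0) :
    LinearIndependent ℂ (hyperplaneVec y) := by
  refine Fintype.linearIndependent_iff.2 fun a ha i => ?_
  have h := congrFun ha i.succ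
  rw [sum_smul_hyperplaneVec_succ] at h
  exact (mul_eq_zero.1 h).resolve_right hy

theorem dotProduct_hyperplaneVec (y : Fin 4 → ℂ) (j : Fin 3) :
    dotProduct y (hyperplaneVec y j) = 0 := by
  simp [dotProduct, hyperplaneVec, Fin.sum_univ_succ (n := 3)]
  ring

theorem exists_eq_sum_hyperplaneVec {y v : Fin 4 → ℂ} (hy : y 0 ≠ 0) (hv : dotProduct y v = 0) :
    ∃ a : Fin 3 → ℂ, v = ∑ j, a j • hyperplaneVec y j := by
  refine ⟨fun j => v j.succ / y 0, ?_⟩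
  ext i
  refine Fin.cases ?_ (fun i => ?_) i
  · rw [sum_smul_hyperplaneVec_zero]
    rw [dotProduct, Fin.sum_univ_succ] at hv
    have : ∑ j : Fin 3, v j.succ / y 0 * y j.succ = (∑ j : Fin 3, y j.succ * v j.succ) / y 0 := by
      rw [Finset.sum_div]
      exact Finset.sum_congr rfl fun j _ => by ring
    rw [this, eq_neg_iff_add_eq_zero]
    field_simp
    linear_combination hv
  · rw [sum_smul_hyperplaneVec_succ]
    field_simp

end LinearAlgebra

theorem IsStrongProfile.continuousOn_coeffG (h : IsStrongProfile P W) (lam : ℂ) (i j : Fin 4) :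
    ContinuousOn (fun x => coeffG P W lam x i j) (Iic 0) := by
  have hτ : ∀ x ∈ Iic (0 : ℝ), W x 0 ≠ 0 := fun x hx => (h.subsonic x hx).tau_pos.ne'
  have c0 := h.continuousOn_apply 0
  have c1 := h.continuousOn_apply 1
  have c3 := h.continuousOn_apply 3
  have cp := h.continuousOn_pressure
  have cφ : ContinuousOn (fun x => ignition P (temperature P (W x))) (Iic 0) := h.continuousOn_rate
  have cψ := h.continuousOn_ignitionDeriv
  have cA : ∀ i j, ContinuousOn (fun x => fluxJac P (W x) i j) (Iic 0) := by
    have d1 := cp.div c0 hτ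
    have cΓ : ContinuousOn (fun _ : ℝ => P.Gam) (Iic 0) := continuousOn_const
    have d2 := cΓ.div c0 hτ
    have d3 := (cΓ.mul c1).div c0 hτ
    have d4 := (c1.mul cp).div c0 hτ
    have d5 := (cΓ.mul (c1.pow 2)).div c0 hτ
    intro i j
    fin_cases i <;> fin_cases j <;> simp [fluxJac] <;> fun_prop
  have cE : ∀ i j, ContinuousOn (fun x => sourceJac P (W x) i j) (Iic 0) := by
    intro i j
    fin_cases i <;> fin_cases j <;> simp [sourceJac] <;> fun_prop
  have cA' : ContinuousOn (fun x => cplx (fluxJac P (W x))) (Iic 0) :=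
    continuousOn_pi.2 fun i => continuousOn_pi.2 fun j =>
      Complex.continuous_ofReal.comp_continuousOn (cA i j)
  have cAi : ContinuousOn (fun x => (cplx (fluxJac P (W x)))⁻¹) (Iic 0) := by
    simp only [Matrix.inv_def, Ring.inverse_eq_inv']
    have hdet : Continuous fun A : Matrix (Fin 4) (Fin 4) ℂ => A.det :=
      Continuous.matrix_det continuous_id
    have hadj : Continuous fun A : Matrix (Fin 4) (Fin 4) ℂ => A.adjugate :=
      Continuous.matrix_adjugate continuous_id
    exact ((hdet.comp_continuousOn cA').inv₀
      fun x hx => (h.subsonic x hx).isUnit_det.ne_zero).smul (hadj.comp_continuousOn cA')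
  simp only [coeffG, Matrix.mul_apply, Matrix.add_apply, Matrix.map_apply]
  exact continuousOn_finsetSum _ fun k _ => (continuousOn_const.add
    (Complex.continuous_ofReal.comp_continuousOn (cE i k))).mul
    (continuousOn_pi.1 (continuousOn_pi.1 cAi k) j)

/-- Existence of an admissible basis of decaying solutions. -/
theorem IsDualMode.exists_decayingBasis (hf : IsDualMode P W ρ σ κ f) (hκ : κ < 1 / 4)
    (hσ : 0 < σ) (hb : ProfileBounds P W K η ρ) (h : IsStrongProfile P W) :
    ∃ Z, IsDecayingBasis P W Z := by
  choose S hS0 hS using fun (lam : ℂ) (v : Fin 4 → ℂ) =>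
    exists_linearODE_solution (M := coeffG P W lam) (h.continuousOn_coeffG lam) v
  have hne : ∀ lam : ℂ, 0 ≤ lam.re → dualVec P W ρ f lam 0 ≠ 0 := fun lam hl =>
    hf.dualVec_zero_ne hκ h (by linarith)
  -- The data are linear in the dual covector, so they inherit its holomorphy beyond the imaginary
  -- axis; decay and spanning come from orthogonality.
  refine ⟨fun j lam => S lam (hyperplaneVec (dualVec P W ρ f lam) j), ?_, ?_, ?_, ?_, ?_⟩
  · exact fun lam _ j => hS lam _
  · intro j lam hl
    have hopen : IsOpen {lam : ℂ | -σ < lam.re} :=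
      isOpen_lt continuous_const Complex.continuous_re
    have hmem : {lam : ℂ | -σ < lam.re} ∈ 𝓝 lam := hopen.mem_nhds (by
      simp only [Set.mem_ofPred_eq] at hl ⊢; linarith)
    refine DifferentiableOn.analyticAt (s := {lam : ℂ | -σ < lam.re}) ?_ hmem
    simp only [hS0]
    refine differentiableOn_pi.2 fun i => ?_
    refine Fin.cases ?_ (fun i => ?_) i
    · simpa [hyperplaneVec] using (hf.differentiableOn_dualVec j.succ).neg
    · by_cases hij : i = j
      · simpa [hyperplaneVec, hij] using hf.differentiableOn_dualVec 0
      · simp [hyperplaneVec, hij]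
  · intro lam hl
    simp only [hS0]
    exact linearIndependent_hyperplaneVec (hne lam hl)
  · intro lam hl j
    refine hf.exp_decay hκ hσ hb h hl (hS lam _) ?_
    rw [hS0]
    exact dotProduct_hyperplaneVec _ _
  · intro lam hl Y hY ⟨C, hC⟩
    have horth := hf.dualVec_orthogonal (by linarith) hσ hb h hl hY hC
    obtain ⟨a, ha⟩ := exists_eq_sum_hyperplaneVec (hne lam hl.le) horth
    refine ⟨a, fun x hx => ?_⟩
    refine linearODE_unique (M := coeffG P W lam) (h.continuousOn_coeffG lam) hY
      (Z := fun x => ∑ j, a j • S lam (hyperplaneVec (dualVec P W ρ f lam) j) x)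
      (fun x hx => ?_) ?_ hx
    · have h1 := HasDerivWithinAt.fun_sum (u := Finset.univ) fun j (_ : j ∈ Finset.univ) =>
        (hS lam (hyperplaneVec (dualVec P W ρ f lam) j) x hx).const_smul (a j)
      refine h1.congr_deriv ?_
      rw [Matrix.mulVec_sum]
      exact Finset.sum_congr rfl fun j _ => (Matrix.mulVec_smul _ _ _).symm
    · simp only [hS0]; exact ha

section Evans

variable {Z : Fin 3 → ℂ → ℝ → Fin 4 → ℂ}

theorem IsDualMode.continuousAt_dualVec (hf : IsDualMode P W ρ σ κ f) (hl : -σ < lam.re)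
    (j : Fin 4) : ContinuousAt (fun lam => dualVec P W ρ f lam j) lam :=
  ((hf.differentiableOn_dualVec j).continuousOn).continuousAt
    ((isOpen_lt continuous_const Complex.continuous_re).mem_nhds hl)

/-- The dual mode annihilates every admissible basis, up to the imaginary axis. -/
theorem IsDualMode.dualVec_orthogonal_basis (hf : IsDualMode P W ρ σ κ f) (hκ : κ ≤ 1)
    (hσ : 0 < σ) (hb : ProfileBounds P W K η ρ) (h : IsStrongProfile P W)
    (hZ : IsDecayingBasis P W Z) (hl : 0 ≤ lam.re) (j : Fin 3) :
    dotProduct (dualVec P W ρ f lam) (Z j lam 0) = 0 := by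
  have hpos : ∀ mu : ℂ, 0 < mu.re → dotProduct (dualVec P W ρ f mu) (Z j mu 0) = 0 := by
    intro mu hmu
    obtain ⟨C, θ, hθ, hC⟩ := hZ.decays mu hmu j
    have hC0 : 0 ≤ C := by simpa using (norm_nonneg _).trans (hC 0 le_rfl)
    refine hf.dualVec_orthogonal hκ hσ hb h hmu (hZ.solves mu hmu.le j) (C := C) fun x hx => ?_
    refine (hC x hx).trans (mul_le_of_le_one_right hC0 (Real.exp_le_one_iff.2 ?_))
    exact mul_nonpos_of_nonneg_of_nonpos hθ.le hx
  have hcont : ContinuousAt (fun mu => dotProduct (dualVec P W ρ f mu) (Z j mu 0)) lam := by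
    simp only [dotProduct]
    refine tendsto_finsetSum _ fun i _ => ?_
    exact (hf.continuousAt_dualVec (by linarith) i).mul
      ((continuous_apply i).continuousAt.comp (hZ.analytic j lam hl).continuousAt)
  -- A point of the imaginary axis is approached from the right, where orthogonality is known.
  have hu : Tendsto (fun t : ℝ => lam + (t : ℂ)) (𝓝[>] 0) (𝓝 lam) := by
    have h1 : Tendsto (fun t : ℝ => lam + (t : ℂ)) (𝓝 0) (𝓝 (lam + ((0 : ℝ) : ℂ))) :=
      (Complex.continuous_ofReal.tendsto 0).const_add lam
    simpa using h1.mono_left nhdsWithin_le_nhds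
  have h0 : Tendsto (fun t : ℝ => dotProduct (dualVec P W ρ f (lam + (t : ℂ)))
      (Z j (lam + (t : ℂ)) 0)) (𝓝[>] 0) (𝓝 0) := by
    refine tendsto_const_nhds.congr' ?_
    filter_upwards [self_mem_nhdsWithin] with t ht
    refine (hpos _ ?_).symm
    simp only [mem_Ioi] at ht
    simp
    linarith
  exact tendsto_nhds_unique (hcont.tendsto.comp hu) h0

theorem analyticAt_evansLopatinski (hZ : ∀ j, AnalyticAt ℂ (fun lam => Z j lam 0) lam) :
    AnalyticAt ℂ (evansLopatinski P W Z) lam := by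
  have hz : ∀ j i, AnalyticAt ℂ (fun lam => Z j lam 0 i) lam := fun j i =>
    analyticAt_pi_iff.1 (hZ j) i
  have hs : ∀ i, AnalyticAt ℂ (fun lam => shockColumn P W lam i) lam := fun i => by
    simp only [shockColumn]; fun_prop
  have hd : evansLopatinski P W Z = fun lam => ∑ τ : Equiv.Perm (Fin 4),
      Equiv.Perm.sign τ • ∏ i, (Matrix.of ![Z 0 lam 0, Z 1 lam 0, Z 2 lam 0,
        shockColumn P W lam]) (τ i) i := by
    funext lam
    rw [evansLopatinski, Matrix.det_transpose, Matrix.det_apply]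
  rw [hd]
  refine Finset.analyticAt_fun_sum _ fun τ _ => ?_
  simp only [Units.smul_def, zsmul_eq_mul]
  refine analyticAt_const.mul (Finset.analyticAt_fun_prod _ fun i _ => ?_)
  generalize τ i = r
  fin_cases r
  · exact hz 0 i
  · exact hz 1 i
  · exact hz 2 i
  · exact hs i

theorem continuousAt_minor (hZ : ∀ j, AnalyticAt ℂ (fun lam => Z j lam 0) lam) :
    ContinuousAt (fun lam => minor fun j => Z j lam 0) lam := by
  have hc : ContinuousAt (fun lam => (Matrix.of fun i j : Fin 3 => Z j lam 0 i.succ)) lam := by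
    refine continuousAt_pi.2 fun i => continuousAt_pi.2 fun j => ?_
    exact (continuous_apply i.succ).continuousAt.comp (hZ j).continuousAt
  have hdet : Continuous fun A : Matrix (Fin 3) (Fin 3) ℂ => A.det :=
    Continuous.matrix_det continuous_id
  exact hdet.continuousAt.comp hc

/-- A strong detonation profile with sufficiently small heat release is spectrally stable. -/
theorem ProfileBounds.spectrallyStable (hb : ProfileBounds P W K η ρ) (h : IsStrongProfile P W)
    (hsmall : 1000 * K ^ 8 * ρ ≤ η) : SpectrallyStable P W := by
  obtain ⟨σ, hσ, f, hf⟩ := hb.exists_dualMode h hsmall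
  have hK := hb.one_le
  have hK4 : 1 ≤ K ^ 4 := one_le_pow₀ hK
  have hκ : 1 / (38 * K ^ 4) < 1 / 4 := by
    apply one_div_lt_one_div_of_lt <;> linarith
  have hκ1 : 1 / (38 * K ^ 4) ≤ 1 := by linarith
  refine ⟨hf.exists_decayingBasis hκ hσ hb h, fun Z hZ => ?_⟩
  have hne : ∀ lam : ℂ, 0 ≤ lam.re → dualVec P W ρ f lam 0 ≠ 0 := fun lam hl =>
    hf.dualVec_zero_ne hκ h (by linarith)
  have horth : ∀ lam : ℂ, 0 ≤ lam.re → ∀ j,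
      dotProduct (dualVec P W ρ f lam) (Z j lam 0) = 0 := fun lam hl j =>
    hf.dualVec_orthogonal_basis hκ1 hσ hb h hZ hl j
  have hminor : ∀ lam : ℂ, 0 ≤ lam.re → (minor fun j => Z j lam 0) ≠ 0 := fun lam hl =>
    minor_ne_zero (hne lam hl) (horth lam hl) (hZ.independent lam hl)
  have hdet : ∀ lam : ℂ, 0 ≤ lam.re → evansLopatinski P W Z lam * dualVec P W ρ f lam 0
      = -((minor fun j => Z j lam 0)
        * dotProduct (dualVec P W ρ f lam) (shockColumn P W lam)) := fun lam hl =>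
    det_mul_eq_minor_mul (z := fun j => Z j lam 0) (horth lam hl)
  have hlow : ∀ lam : ℂ, 0 ≤ lam.re → ‖lam‖ * (1 / (2 * K ^ 2))
      ≤ ‖dotProduct (dualVec P W ρ f lam) (shockColumn P W lam)‖ := by
    intro lam hl
    rw [dualVec_dotProduct]
    exact hf.le_norm_pairing_shockColumn hσ hb h hsmall hl
  have hK2 : 0 < 1 / (2 * K ^ 2) := by positivity
  have hzero : dotProduct (dualVec P W ρ f 0) (shockColumn P W 0) = 0 := by
    rw [dualVec_dotProduct]
    simp only [charCoord_zero_shockColumn, zero_mul, zero_add]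
    have := hf.norm_pairing_source_le (lam := 0) hκ1 hσ hb h le_rfl
    rw [norm_zero, zero_mul] at this
    exact norm_le_zero_iff.1 this
  have hiff : ∀ lam : ℂ, 0 ≤ lam.re → (evansLopatinski P W Z lam = 0 ↔ lam = 0) := by
    intro lam hl
    constructor
    · intro h0
      have h1 := hdet lam hl
      rw [h0, zero_mul, eq_comm, neg_eq_zero] at h1
      have h2 := (mul_eq_zero.1 h1).resolve_left (hminor lam hl)
      have h3 := hlow lam hl
      rw [h2, norm_zero] at h3
      exact norm_le_zero_iff.1 (nonpos_of_mul_nonpos_left h3 hK2)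
    · rintro rfl
      have h1 := hdet 0 hl
      rw [hzero, mul_zero, neg_zero] at h1
      exact (mul_eq_zero.1 h1).resolve_right (hne 0 hl)
  refine ⟨hiff, ?_⟩
  have h0re : (0 : ℝ) ≤ (0 : ℂ).re := le_rfl
  have hanZ : ∀ j, AnalyticAt ℂ (fun lam => Z j lam 0) 0 := fun j => hZ.analytic j 0 h0re
  have han : AnalyticAt ℂ (evansLopatinski P W Z) 0 := analyticAt_evansLopatinski hanZ
  have hD0 : evansLopatinski P W Z 0 = 0 := (hiff 0 h0re).2 rfl
  -- If the derivative vanished, the quotients `D(t)/t` along `t → 0⁺` would tend to zero, against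
  -- the linear lower bound for the pairing and the nonvanishing minor.
  refine han.analyticOrderAt_eq_one_of_zero_deriv_ne_zero hD0 fun hder => ?_
  have hslope := han.differentiableAt.hasDerivAt.tendsto_slope
  rw [hder] at hslope
  have hu0 : Tendsto (fun t : ℝ => (t : ℂ)) (𝓝[>] 0) (𝓝 0) :=
    ((Complex.continuous_ofReal.tendsto 0).mono_left nhdsWithin_le_nhds)
  have hu : Tendsto (fun t : ℝ => (t : ℂ)) (𝓝[>] 0) (𝓝[≠] 0) := by
    refine tendsto_nhdsWithin_iff.2 ⟨hu0, ?_⟩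
    filter_upwards [self_mem_nhdsWithin] with t ht
    simpa using (ne_of_gt ht : t ≠ 0)
  have hL : Tendsto (fun t : ℝ => ‖minor fun j => Z j (t : ℂ) 0‖ * (1 / (2 * K ^ 2)))
      (𝓝[>] 0) (𝓝 (‖minor fun j => Z j 0 0‖ * (1 / (2 * K ^ 2)))) :=
    ((continuousAt_minor hanZ).tendsto.comp hu0).norm.mul_const _
  have hR : Tendsto (fun t : ℝ => ‖slope (evansLopatinski P W Z) 0 (t : ℂ)‖
      * ‖dualVec P W ρ f (t : ℂ) 0‖) (𝓝[>] 0) (𝓝 (‖(0 : ℂ)‖ * ‖dualVec P W ρ f 0 0‖)) :=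
    (hslope.comp hu).norm.mul
      ((hf.continuousAt_dualVec (by simpa using hσ) 0).tendsto.comp hu0).norm
  have hle := le_of_tendsto_of_tendsto hL hR (by
    filter_upwards [self_mem_nhdsWithin] with t ht
    have ht' : (0 : ℝ) < t := ht
    have htre : 0 ≤ ((t : ℝ) : ℂ).re := by simpa using ht'.le
    have h1 := congrArg norm (hdet t htre)
    rw [norm_neg, norm_mul, norm_mul] at h1
    have h2 := mul_le_mul_of_nonneg_left (hlow t htre) (norm_nonneg (minor fun j => Z j (t : ℂ) 0))
    rw [← h1, Complex.norm_real, Real.norm_eq_abs, abs_of_pos ht'] at h2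
    rw [slope_def_field, hD0, sub_zero, sub_zero, norm_div, Complex.norm_real, Real.norm_eq_abs,
      abs_of_pos ht', div_mul_eq_mul_div, le_div_iff₀ ht']
    linarith)
  rw [norm_zero, zero_mul] at hle
  exact hminor 0 h0re (norm_le_zero_iff.1 (nonpos_of_mul_nonpos_left hle hK2))

end Evans

end ZND

/-! ### Explicit structure of ZND profiles and uniform bounds. -/

namespace ZND

/-- `1 - Γ (Γ + 1) e₊`; positive exactly when the shock is supersonic ahead. -/
def Params.excess (P : Params) : ℝ := 1 - P.Gam * (P.Gam + 1) * P.ePlus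

/-- Thus `q_cj` is the heat release at which the formula for the squared gap in `gap_sq` reaches
zero at complete combustion `z = 0`. -/
theorem Params.qCJ_eq {P : Params} (hG : 0 < P.Gam) :
    2 * P.Gam * (P.Gam + 2) * P.qCJ = P.excess ^ 2 := by
  rw [Params.qCJ, Params.excess]
  field_simp
  ring

theorem Params.InRange.excess_nonneg {P : Params} (hP : P.InRange) : 0 ≤ P.excess := by
  have hG := hP.gam_pos
  have h := hP.ePlus_le
  rw [le_div_iff₀ (by positivity)] at h
  rw [Params.excess]
  linarith

section Detonation

variable {P : Params} {W : ℝ → State}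

theorem IsDetonation.hasDerivWithinAt_flux (h : IsDetonation P W) {x : ℝ} (hx : x ≤ 0)
    (i : Fin 4) :
    HasDerivWithinAt (fun y => flux P (W y) i) (source P (W x) i) (Iic 0) x :=
  hasDerivWithinAt_pi.1 (h.profile_eq x hx) i

theorem IsDetonation.rankine_hugoniot_apply (h : IsDetonation P W) (i : Fin 4) :
    flux P (W 0) i = flux P (unburned P) i := by
  rw [h.rankine_hugoniot]

theorem pressure_unburned (P : Params) : pressure P (unburned P) = P.Gam * P.ePlus := by
  simp [pressure, internalEnergy, unburned]

theorem IsDetonation.z_zero (h : IsDetonation P W) : W 0 3 = 1 := by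
  have := h.rankine_hugoniot_apply 3
  simp [flux, unburned] at this
  exact this

theorem IsDetonation.tau_eq (h : IsDetonation P W) {x : ℝ} (hx : x ≤ 0) :
    W x 0 = 1 - W x 1 := by
  have h1 : flux P (W x) 0 = flux P (W 0) 0 := eq_of_hasDerivWithinAt_zero (fun y hy => by
    simpa [source] using h.hasDerivWithinAt_flux hy 0) hx
  rw [h.rankine_hugoniot_apply 0] at h1
  simp [flux, unburned] at h1
  linarith

theorem IsDetonation.pressure_eq (h : IsDetonation P W) {x : ℝ} (hx : x ≤ 0) :
    pressure P (W x) = P.Gam * P.ePlus + W x 1 := by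
  have h1 : flux P (W x) 1 = flux P (W 0) 1 := eq_of_hasDerivWithinAt_zero (fun y hy => by
    simpa [source] using h.hasDerivWithinAt_flux hy 1) hx
  rw [h.rankine_hugoniot_apply 1] at h1
  simp only [flux, Matrix.cons_val_one, Matrix.cons_val_zero, pressure_unburned] at h1
  simp [unburned] at h1
  linarith

theorem IsDetonation.hasDerivWithinAt_z (h : IsDetonation P W) {x : ℝ} (hx : x ≤ 0) :
    HasDerivWithinAt (fun y => W y 3) (rate P (W x) * W x 3) (Iic 0) x := by
  have h1 := (h.hasDerivWithinAt_flux hx 3).neg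
  simpa [flux, source, rate, Pi.neg_def] using h1

/-- Heat release is proportional to the consumption of reactant, so the energy flux minus `q z` is
conserved. -/
theorem IsDetonation.energy_eq (h : IsDetonation P W) {x : ℝ} (hx : x ≤ 0) :
    W x 2 = W x 1 * pressure P (W x) + P.ePlus + P.q * (1 - W x 3) := by
  have h1 : flux P (W x) 2 - P.q * W x 3 = flux P (W 0) 2 - P.q * W 0 3 :=
    eq_of_hasDerivWithinAt_zero (g := fun y => flux P (W y) 2 - P.q * W y 3) (fun y hy => by
      refine ((h.hasDerivWithinAt_flux hy 2).sub
        ((h.hasDerivWithinAt_z hy).const_mul P.q)).congr_deriv ?_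
      simp [source, rate]
      ring) hx
  rw [h.rankine_hugoniot_apply 2, h.z_zero] at h1
  simp [flux, unburned] at h1
  linarith

theorem IsDetonation.internalEnergy_eq (h : IsDetonation P W) {x : ℝ} (hx : x ≤ 0) :
    internalEnergy (W x) = W x 1 ^ 2 / 2 + P.Gam * P.ePlus * W x 1 + P.ePlus
      + P.q * (1 - W x 3) := by
  rw [internalEnergy, h.energy_eq hx, h.pressure_eq hx]
  ring

theorem IsDetonation.gap_eq (h : IsDetonation P W) {x : ℝ} (hx : x ≤ 0) :
    gap P (W x) = (P.Gam + 2) * W x 1 - P.excess := by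
  rw [gap, h.pressure_eq hx, h.tau_eq hx, Params.excess]
  ring

/-- Inserting the conserved quantities into `p τ = Γ e` gives a quadratic equation for `u`; this is
its completed square. -/
theorem IsDetonation.gap_sq (h : IsDetonation P W) {x : ℝ} (hx : x ≤ 0) :
    gap P (W x) ^ 2 = P.excess ^ 2 - 2 * P.Gam * (P.Gam + 2) * P.q * (1 - W x 3) := by
  have h1 : pressure P (W x) * W x 0 = P.Gam * internalEnergy (W x) :=
    div_mul_cancel₀ _ (h.physical x hx).tau_pos.ne'
  rw [h.pressure_eq hx, h.tau_eq hx, h.internalEnergy_eq hx] at h1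
  rw [h.gap_eq hx, Params.excess]
  linear_combination (-2 * (P.Gam + 2)) * h1

theorem IsDetonation.continuousOn (h : IsDetonation P W) (i : Fin 4) :
    ContinuousOn (fun x => W x i) (Iic 0) :=
  continuousOn_pi.1 h.smooth.continuousOn i

theorem IsDetonation.gap_zero_pos (h : IsDetonation P W) : 0 < gap P (W 0) := by
  have hph := h.physical 0 le_rfl
  have hl := h.lax_behind
  rw [soundSpeed, lt_div_iff₀ hph.tau_pos, one_mul, Real.lt_sqrt hph.tau_pos.le] at hl
  have h1 : pressure P (W 0) * W 0 0 = P.Gam * internalEnergy (W 0) :=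
    div_mul_cancel₀ _ hph.tau_pos.ne'
  have h2 : 0 < gap P (W 0) * W 0 0 := by
    have : gap P (W 0) * W 0 0 = (P.Gam + 1) * (pressure P (W 0) * W 0 0) - W 0 0 ^ 2 := by
      rw [gap]; ring
    rw [this, h1]
    linarith
  exact pos_of_mul_pos_left h2 hph.tau_pos.le

theorem IsDetonation.gap_sq_ge (h : IsDetonation P W) (hP : P.InRange) {x : ℝ} (hx : x ≤ 0) :
    P.excess ^ 2 - 2 * P.Gam * (P.Gam + 2) * P.q ≤ gap P (W x) ^ 2 := by
  have hG := hP.gam_pos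
  have hq := hP.q_nonneg
  have h0 : 0 ≤ 2 * P.Gam * (P.Gam + 2) * P.q * W x 3 :=
    mul_nonneg (by positivity) (h.physical x hx).z_nonneg
  rw [h.gap_sq hx]
  linarith

/-- The square of the gap never vanishes below `q_cj`, and the Lax condition makes the gap positive
at the shock; continuity keeps the profile on that branch. -/
theorem IsDetonation.gap_pos (h : IsDetonation P W) (hP : P.InRange) (hq : P.q < P.qCJ) {x : ℝ}
    (hx : x ≤ 0) : 0 < gap P (W x) := by
  have hG := hP.gam_pos
  have hne : ∀ y ≤ 0, gap P (W y) ≠ 0 := by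
    intro y hy h0
    have h1 := h.gap_sq_ge hP hy
    rw [h0, ← Params.qCJ_eq hG] at h1
    have : 0 < 2 * P.Gam * (P.Gam + 2) * (P.qCJ - P.q) :=
      mul_pos (by positivity) (sub_pos.2 hq)
    linarith
  by_contra hneg
  have hcont : ContinuousOn (fun y => gap P (W y)) (Iic 0) := by
    refine ContinuousOn.congr (f := fun y => (P.Gam + 2) * W y 1 - P.excess)
      ((continuousOn_const.mul (h.continuousOn 1)).sub continuousOn_const) fun y hy => h.gap_eq hy
  obtain ⟨y, hy, h0⟩ := isPreconnected_Iic.intermediate_value hx (mem_Iic.2 le_rfl) hcont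
    ⟨not_lt.1 hneg, h.gap_zero_pos.le⟩
  exact hne y hy h0

/-- Differentiate `gap_sq` using `z' = φ z` and divide by the positive gap. -/
theorem IsDetonation.hasDerivWithinAt_u (h : IsDetonation P W) (hP : P.InRange)
    (hq : P.q < P.qCJ) {x : ℝ} (hx : x ≤ 0) :
    HasDerivWithinAt (fun y => W y 1) (P.Gam * strain P (W x)) (Iic 0) x := by
  have hG := hP.gam_pos
  have hs := h.gap_pos hP hq hx
  have hW := ((h.smooth.differentiableOn (by simp)) x hx).hasDerivWithinAt
  have hu := hasDerivWithinAt_pi.1 hW 1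
  have h1 := ((hu.const_mul (P.Gam + 2)).sub_const P.excess).pow 2
  have h2 := (((h.hasDerivWithinAt_z hx).const_sub 1).const_mul
    (2 * P.Gam * (P.Gam + 2) * P.q)).const_sub (P.excess ^ 2)
  have h3 := h2.congr_of_mem (f₁ := fun y => ((P.Gam + 2) * W y 1 - P.excess) ^ 2)
    (fun y hy => by rw [← h.gap_eq hy, h.gap_sq hy]) hx
  have h4 := (uniqueDiffOn_Iic (0 : ℝ) x hx).eq_deriv _ h1 h3
  rw [← h.gap_eq hx] at h4
  refine hu.congr_deriv ?_
  rw [strain, mul_div_assoc', eq_div_iff hs.ne']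
  have h5 : (0 : ℝ) < 2 * (P.Gam + 2) := by positivity
  refine mul_left_cancel₀ h5.ne' ?_
  linear_combination h4

theorem IsDetonation.isStrongProfile (h : IsDetonation P W) (hP : P.InRange)
    (hq : P.q < P.qCJ) : IsStrongProfile P W where
  cont := h.smooth.continuousOn
  subsonic x hx := ⟨hP.gam_pos, (h.physical x hx).tau_pos, (h.physical x hx).energy_pos,
    h.gap_pos hP hq hx⟩
  tau_eq _ hx := h.tau_eq hx
  pressure_eq _ hx := h.pressure_eq hx
  deriv_u _ hx := h.hasDerivWithinAt_u hP hq hx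
  hasDeriv x hx := by
    have hW := ((h.smooth.differentiableOn (by simp)) x hx).hasDerivWithinAt
    refine ⟨_, hW, ?_⟩
    have h1 := (hasFDerivAt_flux P (W x) (h.physical x hx).tau_pos.ne').comp_hasDerivWithinAt x hW
    exact (uniqueDiffOn_Iic (0 : ℝ) x hx).eq_deriv _ h1 (h.profile_eq x hx)
  jump := by
    have h0 := h.tau_eq (le_refl 0)
    have h2 := h.energy_eq (le_refl 0)
    have h3 := h.z_zero
    ext i
    fin_cases i
    · simp [unburned, h0]
    · simp [unburned]
    · simp [unburned, h2, h3]
    · simp [unburned, h3]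
  cv_pos := hP.cv_pos

theorem IsDetonation.u_le_one (h : IsDetonation P W) {x : ℝ} (hx : x ≤ 0) : W x 1 ≤ 1 := by
  have := (h.physical x hx).tau_pos
  rw [h.tau_eq hx] at this
  linarith

theorem IsDetonation.le_u (h : IsDetonation P W) (hP : P.InRange) (hq : P.q < P.qCJ) {x : ℝ}
    (hx : x ≤ 0) : P.excess / (P.Gam + 2) ≤ W x 1 := by
  have h1 := h.gap_pos hP hq hx
  rw [h.gap_eq hx] at h1
  rw [div_le_iff₀ (by linarith [hP.gam_pos])]
  linarith

theorem IsDetonation.u_nonneg (h : IsDetonation P W) (hP : P.InRange) (hq : P.q < P.qCJ) {x : ℝ}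
    (hx : x ≤ 0) : 0 ≤ W x 1 :=
  (div_nonneg hP.excess_nonneg (by linarith [hP.gam_pos])).trans (h.le_u hP hq hx)

theorem IsDetonation.half_sq_le_energy (h : IsDetonation P W) (hP : P.InRange)
    (hq : P.q < P.qCJ) {x : ℝ} (hx : x ≤ 0) : W x 1 ^ 2 / 2 ≤ internalEnergy (W x) := by
  have h1 : 0 ≤ P.q * (1 - W x 3) :=
    mul_nonneg hP.q_nonneg (by linarith [(h.physical x hx).z_le_one])
  have h2 : 0 ≤ P.Gam * P.ePlus * W x 1 :=
    mul_nonneg (mul_nonneg hP.gam_pos.le hP.ePlus_nonneg) (h.u_nonneg hP hq hx)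
  rw [h.internalEnergy_eq hx]
  linarith [hP.ePlus_nonneg]

theorem IsDetonation.gap_le_one (h : IsDetonation P W) (hP : P.InRange) {x : ℝ}
    (hx : x ≤ 0) : gap P (W x) ≤ 1 := by
  have hG := hP.gam_pos
  have hq0 := hP.q_nonneg
  have he := hP.ePlus_nonneg
  have h1 : 0 ≤ 2 * P.Gam * (P.Gam + 2) * P.q * (1 - W x 3) :=
    mul_nonneg (by positivity) (by linarith [(h.physical x hx).z_le_one])
  have h2 : gap P (W x) ≤ P.excess := by
    refine le_of_sq_le_sq ?_ hP.excess_nonneg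
    rw [h.gap_sq hx]
    linarith
  refine h2.trans ?_
  have : 0 ≤ P.Gam * (P.Gam + 1) * P.ePlus := by positivity
  rw [Params.excess]
  linarith

theorem IsDetonation.impedance_sq (h : IsDetonation P W) (hP : P.InRange) (hq : P.q < P.qCJ)
    {x : ℝ} (hx : x ≤ 0) :
    impedance P (W x) ^ 2 = P.Gam * (P.Gam + 1) * internalEnergy (W x) := by
  have h1 : pressure P (W x) * W x 0 = P.Gam * internalEnergy (W x) :=
    div_mul_cancel₀ _ (h.physical x hx).tau_pos.ne'
  rw [((h.isStrongProfile hP hq).subsonic x hx).impedance_sq]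
  linear_combination (P.Gam + 1) * h1

/-- The product `z e^{-ηx}` is nondecreasing and equals `1` at the shock. -/
theorem IsDetonation.z_le_exp (h : IsDetonation P W) {η : ℝ}
    (hη : ∀ x ≤ 0, η ≤ rate P (W x)) {x : ℝ} (hx : x ≤ 0) : W x 3 ≤ Real.exp (η * x) := by
  have hexp : ∀ y : ℝ, HasDerivAt (fun y => Real.exp (-η * y))
      (Real.exp (-η * y) * (-η)) y := fun y => by
    have := ((hasDerivAt_id y).const_mul (-η)).exp
    simpa using this
  have hmono := monotoneOn_Iic_of_hasDerivWithinAt_nonneg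
    (N := fun y => W y 3 * Real.exp (-η * y))
    (fun y hy => (h.hasDerivWithinAt_z hy).mul (hexp y).hasDerivWithinAt) (fun y hy => by
      have h1 := mul_nonneg (mul_nonneg (sub_nonneg.2 (hη y hy))
        (h.physical y hy).z_nonneg) (Real.exp_pos (-η * y)).le
      linarith)
  have h1 := hmono hx (mem_Iic.2 le_rfl) hx
  simp only [h.z_zero, mul_zero, Real.exp_zero, mul_one] at h1
  rwa [neg_mul, Real.exp_neg, ← div_eq_mul_inv, div_le_one (Real.exp_pos _)] at h1

end Detonation

section Rate

variable {P : Params} {V : State}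

theorem rate_le_one (hP : P.InRange) (he : 0 < internalEnergy V) : rate P V ≤ 1 := by
  rw [rate, ignition, neg_div]
  exact Real.exp_le_one_iff.2
    (neg_nonpos.2 (div_nonneg hP.actE_nonneg (div_pos he hP.cv_pos).le))

theorem exp_le_rate {M k : ℝ} (hP : P.InRange) (he : 0 < internalEnergy V) (hE : P.actE ≤ M)
    (hk : 1 ≤ k * internalEnergy V) : Real.exp (-(M * P.cv * k)) ≤ rate P V := by
  have hc := hP.cv_pos
  have hM : 0 ≤ M := hP.actE_nonneg.trans hE
  rw [rate, ignition, neg_div, Real.exp_le_exp, neg_le_neg_iff, temperature,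
    div_div_eq_mul_div, div_le_iff₀ he]
  calc P.actE * P.cv ≤ M * P.cv := by gcongr
    _ ≤ M * P.cv * (k * internalEnergy V) := le_mul_of_one_le_right (by positivity) hk
    _ = _ := by ring

theorem rateEnergyDeriv_eq (hP : P.InRange) (he : 0 < internalEnergy V) :
    rateEnergyDeriv P V = P.actE * P.cv / internalEnergy V ^ 2 * (rate P V * V 3) := by
  have hc := hP.cv_pos
  have h1 : P.actE / temperature P V ^ 2 / P.cv = P.actE * P.cv / internalEnergy V ^ 2 := by
    rw [temperature]
    field_simp
  rw [← h1, rateEnergyDeriv, ignitionDeriv, rate, ignition]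
  ring

theorem rateEnergyDeriv_le {M k : ℝ} (hP : P.InRange) (he : 0 < internalEnergy V)
    (hE : P.actE ≤ M) (hk : 1 ≤ k * internalEnergy V) (hz : 0 ≤ V 3) :
    rateEnergyDeriv P V ≤ M * P.cv * k ^ 2 * V 3 := by
  have hc := hP.cv_pos
  have hM : 0 ≤ M := hP.actE_nonneg.trans hE
  have h1 : P.actE * P.cv / internalEnergy V ^ 2 ≤ M * P.cv * k ^ 2 := by
    rw [div_le_iff₀ (by positivity)]
    calc P.actE * P.cv ≤ M * P.cv := by gcongr
      _ ≤ M * P.cv * (k * internalEnergy V) ^ 2 :=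
        le_mul_of_one_le_right (by positivity) (one_le_pow₀ hk)
      _ = _ := by ring
  have h2 : rate P V * V 3 ≤ V 3 := mul_le_of_le_one_left hz (rate_le_one hP he)
  rw [rateEnergyDeriv_eq hP he]
  exact mul_le_mul h1 h2 (mul_nonneg (Real.exp_pos _).le hz) (by positivity)

end Rate

section Bounds

variable {P : Params} {W : ℝ → State} {M a k K ρ : ℝ}

/-- The choice of `ρ` makes the loss `2Γ(Γ+2)q` in the squared gap at most `a²/8`. -/
theorem IsDetonation.half_excess_le_gap (h : IsDetonation P W) (hP : P.InRange)
    (hq : P.q < P.qCJ) (hGM : P.Gam ≤ M) (ha : 0 < a) (hax : a ≤ P.excess) (hρ : 0 < ρ)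
    (hρa : 4 * (M + 2) * ρ ≤ a) (hqρ : P.q ≤ ρ ^ 2) {x : ℝ} (hx : x ≤ 0) :
    a / 2 ≤ gap P (W x) := by
  have hG := hP.gam_pos
  have hM0 : 0 < M := hG.trans_le hGM
  have h1 := h.gap_sq_ge hP hx
  have hq0 := hP.q_nonneg
  have h2 : 2 * P.Gam * (P.Gam + 2) * P.q ≤ 2 * M * (M + 2) * ρ ^ 2 := by gcongr
  have h5 : (4 * (M + 2) * ρ) ^ 2 ≤ a ^ 2 := pow_le_pow_left₀ (by positivity) hρa 2
  have h4 : 2 * M * (M + 2) * ρ ^ 2 ≤ (4 * (M + 2) * ρ) ^ 2 / 8 := by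
    have : 0 ≤ (M + 2) * ρ ^ 2 := by positivity
    linarith
  have h6 : a ^ 2 ≤ P.excess ^ 2 := pow_le_pow_left₀ ha.le hax 2
  refine le_of_sq_le_sq ?_ (h.gap_pos hP hq hx).le
  rw [div_pow]
  linarith [sq_nonneg a]

/-- In `K`, the term `k` handles reciprocals, since `e ≥ u²/2 ≥ 1/k`; the second term handles
pressure and impedance, the third the energy derivative of the rate. The rate `η` is the Arrhenius
factor for `ℰ = M` at energy `1/k`. -/
theorem IsDetonation.profileBounds (h : IsDetonation P W) (hP : P.InRange) (hq : P.q < P.qCJ)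
    (hM : 1 ≤ M) (hGM : P.Gam ≤ M) (hEM : P.actE ≤ M) (heM : P.ePlus ≤ M)
    (ha : 0 < a) (ha1 : a ≤ 1) (hax : a ≤ P.excess) (hk : k = 2 * ((M + 2) / a) ^ 2)
    (hK : K = k + (M + 1) * (M ^ 2 + 1) + M * P.cv * k ^ 2) (hρ : 0 < ρ)
    (hρa : 4 * (M + 2) * ρ ≤ a) (hqρ : P.q ≤ ρ ^ 2) :
    ProfileBounds P W K (Real.exp (-(M * P.cv * k))) ρ := by
  have hG := hP.gam_pos
  have hc := hP.cv_pos
  have he := hP.ePlus_nonneg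
  have hM0 : 0 < M := by linarith
  set b := a / (M + 2) with hb
  have hb0 : 0 < b := by positivity
  have hba : b ≤ a / 2 := div_le_div_of_nonneg_left ha.le two_pos (by linarith)
  have hkb : k = 2 / b ^ 2 := by rw [hk, hb, div_pow, div_pow]; field_simp
  have hk0 : 0 < k := by rw [hkb]; positivity
  have hkinv : k⁻¹ = b ^ 2 / 2 := by rw [hkb, inv_div]
  have h0 : 0 ≤ M * P.cv * k ^ 2 := by positivity
  have h0' : M + 1 ≤ (M + 1) * (M ^ 2 + 1) :=
    le_mul_of_one_le_right (by positivity) (by linarith [sq_nonneg M])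
  have h0'' : M ^ 2 + 1 ≤ (M + 1) * (M ^ 2 + 1) :=
    le_mul_of_one_le_left (by positivity) (by linarith)
  have hkK : k ≤ K := by linarith
  have hMK : (M + 1) * (M ^ 2 + 1) ≤ K := by linarith
  have hcK : M * P.cv * k ^ 2 ≤ K := by linarith
  have hK1 : 1 ≤ K := by linarith
  have hK0 : 0 < K := by linarith
  have hKinv : K⁻¹ ≤ b ^ 2 / 2 := by rw [← hkinv]; exact inv_anti₀ hk0 hkK
  have hbb : b ^ 2 / 2 ≤ b := by
    have : b * b ≤ b * 2 := mul_le_mul_of_nonneg_left (by linarith) hb0.le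
    linarith
  have hub : ∀ x ≤ 0, b ≤ W x 1 := fun x hx => by
    refine le_trans ?_ (h.le_u hP hq hx)
    rw [hb]
    exact div_le_div₀ hP.excess_nonneg hax (by linarith) (by linarith)
  have hen : ∀ x ≤ 0, b ^ 2 / 2 ≤ internalEnergy (W x) := fun x hx => by
    have := pow_le_pow_left₀ hb0.le (hub x hx) 2
    linarith [h.half_sq_le_energy hP hq hx]
  have hek : ∀ x ≤ 0, 1 ≤ k * internalEnergy (W x) := fun x hx => by
    have := mul_le_mul_of_nonneg_left (hen x hx) hk0.le
    rwa [← hkinv, mul_inv_cancel₀ hk0.ne'] at this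
  have hsub := (h.isStrongProfile hP hq).subsonic
  have htau1 : ∀ x ≤ 0, W x 0 ≤ 1 := fun x hx => by
    rw [h.tau_eq hx]
    linarith [hub x hx]
  have hp : ∀ x ≤ 0, pressure P (W x) ≤ M ^ 2 + 1 := fun x hx => by
    have : P.Gam * P.ePlus ≤ M * M := by gcongr
    rw [h.pressure_eq hx]
    linarith [h.u_le_one hx]
  have hrate : ∀ x ≤ 0, Real.exp (-(M * P.cv * k)) ≤ rate P (W x) := fun x hx =>
    exp_le_rate hP (h.physical x hx).energy_pos hEM (hek x hx)
  have hz := fun x (hx : x ≤ 0) => h.z_le_exp hrate hx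
  refine ⟨hK1, Real.exp_pos _, hρ, ?_, by linarith, hP.q_nonneg, hqρ, fun x hx => h.u_le_one hx,
    fun x hx => (hKinv.trans hbb).trans (hub x hx), htau1, fun x hx => h.gap_le_one hP hx,
    fun x hx => (hKinv.trans hbb).trans
      (hba.trans (h.half_excess_le_gap hP hq hGM ha hax hρ hρa hqρ hx)),
    fun x hx => (hp x hx).trans (h0''.trans hMK), ?_, fun x hx => hKinv.trans (hen x hx), ?_, ?_,
    fun x hx => rate_le_one hP (h.physical x hx).energy_pos,
    hrate, fun x hx => (h.physical x hx).z_nonneg, hz, ?_, ?_⟩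
  · have : 1 * ρ ≤ 4 * (M + 2) * ρ := mul_le_mul_of_nonneg_right (by linarith) hρ.le
    linarith
  · intro x hx
    rw [h.pressure_eq hx]
    have : 0 ≤ P.Gam * P.ePlus := by positivity
    linarith
  · intro x hx
    have h2 := (hsub x hx).pressure_pos
    have h3 := (h.physical x hx).tau_pos
    have h4 : (P.Gam + 1) * pressure P (W x) * W x 0 ≤ (M + 1) * (M ^ 2 + 1) * 1 := by
      gcongr
      · exact hp x hx
      · exact htau1 x hx
    refine le_of_sq_le_sq ?_ hK0.le
    rw [(hsub x hx).impedance_sq]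
    have : K * 1 ≤ K * K := mul_le_mul_of_nonneg_left hK1 hK0.le
    linarith
  · intro x hx
    refine le_of_sq_le_sq ?_ (mul_nonneg hK0.le (hsub x hx).impedance_pos.le)
    have hex := (h.physical x hx).energy_pos
    have h2 : 1 ≤ K * internalEnergy (W x) :=
      (hek x hx).trans (mul_le_mul_of_nonneg_right hkK hex.le)
    have h3 : 1 * 1 ≤ K * (K * internalEnergy (W x)) :=
      mul_le_mul hK1 h2 zero_le_one hK0.le
    rw [mul_pow, h.impedance_sq hP hq hx]
    calc P.Gam ^ 2 = P.Gam * (P.Gam + 0) * (1 * 1) := by ring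
      _ ≤ P.Gam * (P.Gam + 1) * (K * (K * internalEnergy (W x))) := by
        gcongr
        exact zero_le_one
      _ = _ := by ring
  · intro x hx
    have hex := (h.physical x hx).energy_pos
    rw [rateEnergyDeriv_eq hP hex]
    have := hP.actE_nonneg
    exact mul_nonneg (by positivity) (mul_nonneg (Real.exp_pos _).le (h.physical x hx).z_nonneg)
  · intro x hx
    exact (rateEnergyDeriv_le hP (h.physical x hx).energy_pos hEM (hek x hx)
      (h.physical x hx).z_nonneg).trans
      (mul_le_mul hcK (hz x hx) (h.physical x hx).z_nonneg hK0.le)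

end Bounds

/-- Under the assumptions of the small heat release limit the unburned state is uniformly
supersonic. -/
theorem Params.exists_le_excess (M : ℝ) {δ : ℝ} (hδ : 0 < δ) :
    ∃ a : ℝ, 0 < a ∧ a ≤ 1 ∧ ∀ P : Params, P.InRange → P.Gam ≤ M → P.ePlus ≤ M →
      P.q ≤ P.qCJ - δ → a ≤ P.excess := by
  by_cases hM : 0 ≤ M
  swap
  · exact ⟨1, one_pos, le_rfl, fun P hP hG => absurd (hP.gam_pos.le.trans hG) hM⟩
  -- For `Γ ≤ g` the bound on `e₊` alone gives excess at least `1/2`; for larger `Γ`, `δ ≤ q_cj`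
  -- forces `excess² = 2Γ(Γ+2) q_cj ≥ 4gδ`.
  set g : ℝ := 1 / (2 * (M + 1) ^ 2) with hg
  have hg0 : 0 < g := by positivity
  refine ⟨min (1 / 2) (Real.sqrt (4 * g * δ)), by positivity,
    (min_le_left _ _).trans (by norm_num), fun P hP hG he hq => ?_⟩
  have hG0 := hP.gam_pos
  have he0 := hP.ePlus_nonneg
  by_cases hs : P.Gam ≤ g
  · refine (min_le_left _ _).trans ?_
    have h1 : P.Gam * (P.Gam + 1) * P.ePlus ≤ g * (M + 1) * (M + 1) := by
      gcongr
      linarith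
    have h2 : g * (M + 1) * (M + 1) = 1 / 2 := by rw [hg]; field_simp
    rw [Params.excess]
    linarith
  · refine (min_le_right _ _).trans ?_
    rw [Real.sqrt_le_left hP.excess_nonneg, ← Params.qCJ_eq hG0]
    have h1 : δ ≤ P.qCJ := by linarith [hP.q_nonneg]
    push Not at hs
    calc 4 * g * δ = 2 * g * (0 + 2) * δ := by ring
      _ ≤ 2 * P.Gam * (P.Gam + 2) * P.qCJ := by gcongr

/-- Every detonation with sufficiently small heat release is spectrally stable. -/
theorem exists_forall_spectrallyStable {cv : ℝ} (hcv : 0 < cv) (M : ℝ) {δ : ℝ} (hδ : 0 < δ) :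
    ∃ qStar : ℝ, 0 < qStar ∧ ∀ P : Params, P.cv = cv → P.InRange → P.Gam ≤ M → P.actE ≤ M →
      P.ePlus ≤ M → P.q ≤ P.qCJ - δ → P.q ≤ qStar →
      ∀ W, IsDetonation P W → SpectrallyStable P W := by
  obtain ⟨a, ha, ha1, hax⟩ := Params.exists_le_excess M hδ
  set N := max M 1 with hN
  have hN1 : 1 ≤ N := le_max_right _ _
  have hMN : M ≤ N := le_max_left _ _
  set k := 2 * ((N + 2) / a) ^ 2 with hk
  set K := k + (N + 1) * (N ^ 2 + 1) + N * cv * k ^ 2 with hK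
  set η := Real.exp (-(N * cv * k)) with hη
  have hη0 : 0 < η := Real.exp_pos _
  have hN0 : 0 < N := by linarith
  have hk0 : 0 < k := by positivity
  have hK0 : 0 < K := by positivity
  -- The first entry controls the gap, the second the contraction; the admissible heat release is
  -- `ρ²`.
  set ρ := min (a / (4 * (N + 2))) (η / (1000 * K ^ 8)) with hρ
  have hρ0 : 0 < ρ := by positivity
  refine ⟨ρ ^ 2, by positivity, fun P hc hP hG hE he hq hqs W h => ?_⟩
  have hq' : P.q < P.qCJ := by linarith
  subst hc
  have hρa : ρ * (4 * (N + 2)) ≤ a := (le_div_iff₀ (by positivity)).1 (min_le_left _ _)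
  have hρη : ρ * (1000 * K ^ 8) ≤ η := (le_div_iff₀ (by positivity)).1 (min_le_right _ _)
  have hb := h.profileBounds hP hq' hN1 (hG.trans hMN) (hE.trans hMN) (he.trans hMN) ha ha1
    (hax P hP hG he hq) hk hK hρ0 (by rwa [mul_comm]) hqs
  exact hb.spectrallyStable (h.isStrongProfile hP hq') (by rwa [mul_comm])

end ZND

/-! ### Existence of ZND profiles. -/

namespace ZND

section AutonomousODE

/-- Global solutions of scalar autonomous equations with positive bounded right-hand side. -/
theorem exists_autonomous_solution {ψ : ℝ → ℝ} (hc : Continuous ψ) (h0 : ∀ v, 0 < ψ v)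
    (h1 : ∀ v, ψ v ≤ 1) :
    ∃ v : ℝ → ℝ, v 0 = 0 ∧ Monotone v ∧ Tendsto v atBot atBot ∧
      ∀ x, HasDerivAt v (ψ (v x)) x := by
  have hinv : Continuous fun v => (ψ v)⁻¹ := hc.inv₀ fun v => (h0 v).ne'
  -- Separation of variables: the solution is the inverse of `G`, which is onto because `ψ ≤ 1`
  -- makes `G y - y` monotone.
  let G : ℝ → ℝ := fun y => ∫ s in (0 : ℝ)..y, (ψ s)⁻¹
  have hG : ∀ y, HasDerivAt G (ψ y)⁻¹ y := fun y =>
    intervalIntegral.integral_hasDerivAt_right (hinv.intervalIntegrable _ _)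
      (hinv.stronglyMeasurableAtFilter _ _) hinv.continuousAt
  have hG0 : G 0 = 0 := intervalIntegral.integral_same
  have hGc : Continuous G := continuous_iff_continuousAt.2 fun y => (hG y).continuousAt
  have hmono : StrictMono G := strictMono_of_hasDerivAt_pos hG fun y => inv_pos.2 (h0 y)
  have hsub : Monotone fun y => G y - y :=
    monotone_of_hasDerivAt_nonneg (fun y => (hG y).sub (hasDerivAt_id y)) fun y =>
      sub_nonneg.2 ((one_le_inv₀ (h0 y)).2 (h1 y))
  have htop : Tendsto G atTop atTop := by
    refine tendsto_atTop_mono' _ ?_ tendsto_id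
    filter_upwards [eventually_ge_atTop 0] with y hy
    have := hsub hy
    simp only [hG0, sub_zero, id] at this ⊢
    linarith
  have hbot : Tendsto G atBot atBot := by
    refine tendsto_atBot_mono' _ ?_ tendsto_id
    filter_upwards [eventually_le_atBot 0] with y hy
    have := hsub hy
    simp only [hG0, sub_zero, id] at this ⊢
    linarith
  let e : ℝ ≃o ℝ := hmono.orderIsoOfSurjective G (hGc.surjective htop hbot)
  have heG : ∀ y, e y = G y := fun _ => rfl
  refine ⟨e.symm, ?_, e.symm.monotone, e.symm.tendsto_atBot, fun x => ?_⟩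
  · rw [OrderIso.symm_apply_eq, heG, hG0]
  · have h2 := (hG (e.symm x)).of_local_left_inverse (g := e.symm) (a := x)
      e.symm.continuous.continuousAt (inv_ne_zero (h0 _).ne')
      (Eventually.of_forall fun y => e.apply_symm_apply y)
    rwa [inv_inv] at h2

/-- Bootstrap: regularity `n` of `z` gives regularity `n` of `h ∘ z = z'`, hence `n + 1` of `z`. -/
theorem contDiffOn_of_hasDerivWithinAt_comp {h z : ℝ → ℝ} {s t : Set ℝ} (hs : UniqueDiffOn ℝ s)
    (hh : ContDiffOn ℝ (⊤ : ℕ∞) h t) (hzt : MapsTo z s t)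
    (hz : ∀ x ∈ s, HasDerivWithinAt z (h (z x)) s x) : ContDiffOn ℝ (⊤ : ℕ∞) z s := by
  refine contDiffOn_infty.2 fun n => ?_
  induction n with
  | zero => exact contDiffOn_zero.2 fun x hx => (hz x hx).continuousWithinAt
  | succ n ih =>
    have := (contDiffOn_succ_iff_derivWithin (n := (n : WithTop ℕ∞)) (f := z) hs).2
      ⟨fun x hx => (hz x hx).differentiableWithinAt, fun h => by simp at h, ?_⟩
    · exact_mod_cast this
    · refine ((hh.of_le (by exact_mod_cast le_top)).comp ih hzt).congr fun x hx => ?_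
      exact (hz x hx).derivWithin (hs x hx)

end AutonomousODE

/-- The gap along the reaction zone, as a function of the reactant. -/
def Params.burnGap (P : Params) (z : ℝ) : ℝ :=
  Real.sqrt (P.excess ^ 2 - 2 * P.Gam * (P.Gam + 2) * P.q * (1 - z))

/-- The velocity along the reaction zone, as a function of the reactant. -/
def Params.burnVelocity (P : Params) (z : ℝ) : ℝ := (P.excess + P.burnGap z) / (P.Gam + 2)

/-- The state in the reaction zone, as a function of the reactant. -/
def Params.burnState (P : Params) (z : ℝ) : State :=
  ![1 - P.burnVelocity z, P.burnVelocity z,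
    P.burnVelocity z * (P.Gam * P.ePlus + P.burnVelocity z) + P.ePlus + P.q * (1 - z), z]

section Existence

variable {P : Params} {z : ℝ}

theorem Params.InRange.excess_pos (hP : P.InRange) (hq : P.q < P.qCJ) : 0 < P.excess := by
  have hG := hP.gam_pos
  refine lt_of_le_of_ne hP.excess_nonneg fun h0 => ?_
  have h1 := Params.qCJ_eq hG
  have h2 : 0 < 2 * P.Gam * (P.Gam + 2) * P.qCJ :=
    mul_pos (by positivity) (hP.q_nonneg.trans_lt hq)
  rw [h1, ← h0] at h2
  simp at h2

theorem Params.InRange.radicand_pos (hP : P.InRange) (hq : P.q < P.qCJ) (hz : 0 ≤ z) :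
    0 < P.excess ^ 2 - 2 * P.Gam * (P.Gam + 2) * P.q * (1 - z) := by
  have hG := hP.gam_pos
  have hq0 := hP.q_nonneg
  rw [← Params.qCJ_eq hG]
  have h1 : 0 < 2 * P.Gam * (P.Gam + 2) * (P.qCJ - P.q) := mul_pos (by positivity) (sub_pos.2 hq)
  have h2 : 0 ≤ 2 * P.Gam * (P.Gam + 2) * P.q * z := by positivity
  linarith

theorem Params.InRange.burnGap_pos (hP : P.InRange) (hq : P.q < P.qCJ) (hz : 0 ≤ z) :
    0 < P.burnGap z := Real.sqrt_pos.2 (hP.radicand_pos hq hz)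

theorem Params.InRange.burnGap_eq (hP : P.InRange) :
    P.burnGap z = (P.Gam + 2) * P.burnVelocity z - P.excess := by
  have hG := hP.gam_pos
  rw [Params.burnVelocity]
  field_simp
  ring

theorem Params.InRange.burnVelocity_pos (hP : P.InRange) (hq : P.q < P.qCJ) :
    0 < P.burnVelocity z :=
  div_pos (add_pos_of_pos_of_nonneg (hP.excess_pos hq) (Real.sqrt_nonneg _))
    (by linarith [hP.gam_pos])

theorem Params.InRange.burnVelocity_lt_one (hP : P.InRange) (hz : z ≤ 1) :
    P.burnVelocity z < 1 := by
  have hG := hP.gam_pos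
  have hq0 := hP.q_nonneg
  have he := hP.ePlus_nonneg
  have h1 : P.burnGap z ≤ P.excess := by
    refine Real.sqrt_le_iff.2 ⟨hP.excess_nonneg, ?_⟩
    have : 0 ≤ 2 * P.Gam * (P.Gam + 2) * P.q * (1 - z) :=
      mul_nonneg (by positivity) (by linarith)
    linarith
  have h2 : P.excess ≤ 1 := by
    have : 0 ≤ P.Gam * (P.Gam + 1) * P.ePlus := by positivity
    rw [Params.excess]
    linarith
  rw [Params.burnVelocity, div_lt_one (by linarith)]
  linarith

theorem internalEnergy_burnState (P : Params) (z : ℝ) :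
    internalEnergy (P.burnState z) = P.burnVelocity z ^ 2 / 2
      + P.Gam * P.ePlus * P.burnVelocity z + P.ePlus + P.q * (1 - z) := by
  simp [internalEnergy, Params.burnState]
  ring

theorem Params.InRange.isPhysical_burnState (hP : P.InRange) (hq : P.q < P.qCJ) (hz : 0 ≤ z)
    (hz1 : z ≤ 1) : IsPhysical (P.burnState z) := by
  refine ⟨?_, ?_, hz, hz1⟩
  · have := hP.burnVelocity_lt_one hz1
    simpa [Params.burnState] using this
  · have hu := hP.burnVelocity_pos (z := z) hq
    have hG := hP.gam_pos
    have he := hP.ePlus_nonneg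
    have h1 : 0 ≤ P.q * (1 - z) := mul_nonneg hP.q_nonneg (by linarith)
    rw [internalEnergy_burnState]
    positivity

/-- Converse of `IsDetonation.gap_sq`: a velocity solving the quadratic equation satisfies the ideal
gas law. -/
theorem Params.InRange.pressure_burnState (hP : P.InRange) (hq : P.q < P.qCJ) (hz : 0 ≤ z)
    (hz1 : z ≤ 1) : pressure P (P.burnState z) = P.Gam * P.ePlus + P.burnVelocity z := by
  have hG := hP.gam_pos
  have hτ := (hP.isPhysical_burnState hq hz hz1).tau_pos
  have h1 : P.burnGap z ^ 2 = P.excess ^ 2 - 2 * P.Gam * (P.Gam + 2) * P.q * (1 - z) :=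
    Real.sq_sqrt (hP.radicand_pos hq hz).le
  rw [pressure, div_eq_iff hτ.ne', internalEnergy_burnState]
  have h2 : P.burnState z 0 = 1 - P.burnVelocity z := rfl
  rw [h2]
  rw [hP.burnGap_eq] at h1
  have h3 : P.Gam + 2 ≠ 0 := by positivity
  refine mul_left_cancel₀ (mul_ne_zero two_ne_zero h3) ?_
  rw [Params.excess] at h1
  linear_combination h1

theorem Params.InRange.flux_burnState (hP : P.InRange) (hq : P.q < P.qCJ) (hz : 0 ≤ z)
    (hz1 : z ≤ 1) :
    flux P (P.burnState z) = ![-1, P.Gam * P.ePlus, -P.ePlus - P.q * (1 - z), -z] := by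
  rw [flux, hP.pressure_burnState hq hz hz1]
  simp only [Params.burnState]
  ext i
  fin_cases i <;> simp <;> ring

theorem flux_unburned (P : Params) :
    flux P (unburned P) = ![-1, P.Gam * P.ePlus, -P.ePlus, -1] := by
  rw [flux, pressure_unburned]
  ext i
  fin_cases i <;> simp [unburned]

theorem Params.InRange.contDiffAt_burnVelocity (hP : P.InRange) (hq : P.q < P.qCJ) (hz : 0 ≤ z) :
    ContDiffAt ℝ (⊤ : ℕ∞) P.burnVelocity z := by
  have h1 : ContDiffAt ℝ (⊤ : ℕ∞)
      (fun z => P.excess ^ 2 - 2 * P.Gam * (P.Gam + 2) * P.q * (1 - z)) z := by fun_prop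
  exact (contDiffAt_const.add (h1.sqrt (hP.radicand_pos hq hz).ne')).div_const _

theorem Params.InRange.contDiffAt_burnState (hP : P.InRange) (hq : P.q < P.qCJ) (hz : 0 ≤ z) :
    ContDiffAt ℝ (⊤ : ℕ∞) P.burnState z := by
  have hu := hP.contDiffAt_burnVelocity hq hz
  refine contDiffAt_pi.2 fun i => ?_
  fin_cases i
  · exact contDiffAt_const.sub hu
  · exact hu
  · exact ((hu.mul (contDiffAt_const.add hu)).add contDiffAt_const).add
      (contDiffAt_const.mul (contDiffAt_const.sub contDiffAt_id))
  · exact contDiffAt_id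

theorem Params.InRange.contDiffAt_rate_burnState (hP : P.InRange) (hq : P.q < P.qCJ)
    (hz : 0 ≤ z) (hz1 : z ≤ 1) :
    ContDiffAt ℝ (⊤ : ℕ∞) (fun z => rate P (P.burnState z)) z := by
  have hW := contDiffAt_pi.1 (hP.contDiffAt_burnState hq hz)
  have he := (hP.isPhysical_burnState hq hz hz1).energy_pos
  have hT : ContDiffAt ℝ (⊤ : ℕ∞) (fun z => temperature P (P.burnState z)) z :=
    ((hW 2).sub (((hW 1).pow 2).div_const 2)).div_const _
  exact (contDiffAt_const.div hT (div_pos he hP.cv_pos).ne').exp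

/-- Existence of a solution of the reaction equation. -/
theorem Params.InRange.exists_reactant (hP : P.InRange) (hq : P.q < P.qCJ) :
    ∃ z : ℝ → ℝ, z 0 = 1 ∧ (∀ x ≤ 0, 0 < z x ∧ z x ≤ 1) ∧ Tendsto z atBot (𝓝 0) ∧
      ContDiffOn ℝ (⊤ : ℕ∞) z (Iic 0) ∧
      ∀ x ≤ 0, HasDerivWithinAt z (rate P (P.burnState (z x)) * z x) (Iic 0) x := by
  have hm : ∀ v : ℝ, 0 ≤ Real.exp (min v 0) ∧ Real.exp (min v 0) ≤ 1 := fun v =>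
    ⟨(Real.exp_pos _).le, Real.exp_le_one_iff.2 (min_le_right v 0)⟩
  -- With `v = log z` the equation becomes `v' = φ`, with right-hand side in `(0, 1]`. Truncation at
  -- `v = 0` keeps `z ≤ 1` and is inactive for `x ≤ 0`.
  obtain ⟨v, hv0, hmono, hbot, hv⟩ := exists_autonomous_solution
    (ψ := fun v => rate P (P.burnState (Real.exp (min v 0))))
    (continuous_iff_continuousAt.2 fun v =>
      ContinuousAt.comp (f := fun v : ℝ => Real.exp (min v 0))
        (hP.contDiffAt_rate_burnState hq (hm v).1 (hm v).2).continuousAt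
        (Continuous.continuousAt (by fun_prop)))
    (fun v => Real.exp_pos _)
    (fun v => rate_le_one hP (hP.isPhysical_burnState hq (hm v).1 (hm v).2).energy_pos)
  have hv' : ∀ x ≤ 0, v x ≤ 0 := fun x hx => hv0 ▸ hmono hx
  have hz : ∀ x ≤ 0, 0 < Real.exp (v x) ∧ Real.exp (v x) ≤ 1 := fun x hx =>
    ⟨Real.exp_pos _, Real.exp_le_one_iff.2 (hv' x hx)⟩
  have hder : ∀ x ≤ 0, HasDerivWithinAt (fun x => Real.exp (v x))
      (rate P (P.burnState (Real.exp (v x))) * Real.exp (v x)) (Iic 0) x := by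
    intro x hx
    refine ((hv x).exp.hasDerivWithinAt).congr_deriv ?_
    rw [min_eq_left (hv' x hx), mul_comm]
  refine ⟨fun x => Real.exp (v x), by simp [hv0], hz, Real.tendsto_exp_atBot.comp hbot, ?_, hder⟩
  refine contDiffOn_of_hasDerivWithinAt_comp (h := fun z => rate P (P.burnState z) * z)
    (t := Ioc 0 1) (uniqueDiffOn_Iic 0) (fun z hz => ?_) hz hder
  exact ((hP.contDiffAt_rate_burnState hq hz.1.le hz.2).mul contDiffAt_id).contDiffWithinAt

/-- Below the Chapman--Jouguet heat release, a strong detonation exists. -/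
theorem Params.InRange.exists_isDetonation (hP : P.InRange) (hq : P.q < P.qCJ) :
    ∃ W, IsDetonation P W := by
  obtain ⟨z, hz0, hz, hbot, hsm, hder⟩ := hP.exists_reactant hq
  have hG := hP.gam_pos
  set W : ℝ → State := fun x => if x ≤ 0 then P.burnState (z x) else unburned P with hWdef
  have hW : ∀ x ≤ 0, W x = P.burnState (z x) := fun x hx => if_pos hx
  have hph : ∀ x ≤ 0, IsPhysical (W x) := fun x hx => by
    rw [hW x hx]
    exact hP.isPhysical_burnState hq (hz x hx).1.le (hz x hx).2
  have hflux : ∀ x ≤ 0, flux P (W x)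
      = ![-1, P.Gam * P.ePlus, -P.ePlus - P.q * (1 - z x), -z x] := fun x hx => by
    rw [hW x hx, hP.flux_burnState hq (hz x hx).1.le (hz x hx).2]
  refine ⟨W, fun x hx => if_neg (not_le.2 hx), ?_, hph, fun x hx => ?_, ?_, ?_, ?_, ?_⟩
  · refine ContDiffOn.congr (fun x hx => ?_) hW
    exact (hP.contDiffAt_burnState hq (hz x hx).1.le).comp_contDiffWithinAt x (hsm x hx)
  · have h1 : HasDerivWithinAt
        (fun y => ![-1, P.Gam * P.ePlus, -P.ePlus - P.q * (1 - z y), -z y])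
        (source P (W x)) (Iic 0) x := by
      have hr : source P (W x) = ![0, 0, P.q * (rate P (P.burnState (z x)) * z x),
          -(rate P (P.burnState (z x)) * z x)] := by
        rw [hW x hx]
        simp [source, rate, Params.burnState, mul_assoc]
      rw [hr]
      refine hasDerivWithinAt_pi.2 fun i => ?_
      fin_cases i
      · exact hasDerivWithinAt_const _ _ _
      · exact hasDerivWithinAt_const _ _ _
      · refine ((((hder x hx).const_sub 1).const_mul P.q).const_sub (-P.ePlus)).congr_deriv ?_
        simp
      · exact (hder x hx).neg
    exact h1.congr (fun y hy => hflux y hy) (hflux x hx)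
  · rw [hflux 0 le_rfl, flux_unburned, hz0]
    simp
  · have h1 : soundSpeed P (unburned P) = Real.sqrt (P.Gam * (P.Gam + 1) * P.ePlus) := by
      simp [soundSpeed, internalEnergy, unburned]
    have h2 := hP.excess_pos hq
    rw [Params.excess] at h2
    rw [h1, Real.sqrt_lt' one_pos]
    linarith
  · have hτ := (hph 0 le_rfl).tau_pos
    have h1 : pressure P (W 0) * W 0 0 = P.Gam * internalEnergy (W 0) :=
      div_mul_cancel₀ _ hτ.ne'
    rw [soundSpeed, lt_div_iff₀ hτ, one_mul, Real.lt_sqrt hτ.le]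
    have h2 : W 0 0 < (P.Gam + 1) * pressure P (W 0) := by
      have h3 := hP.burnGap_pos hq (hz 0 le_rfl).1.le
      have h4 : W 0 0 = 1 - P.burnVelocity (z 0) := by rw [hW 0 le_rfl]; rfl
      rw [h4, hW 0 le_rfl, hP.pressure_burnState hq (hz 0 le_rfl).1.le (hz 0 le_rfl).2]
      rw [hP.burnGap_eq, Params.excess] at h3
      linarith
    have h5 := mul_lt_mul_of_pos_right h2 hτ
    rw [mul_assoc, h1] at h5
    linarith
  · refine ⟨P.burnState 0, hP.isPhysical_burnState hq le_rfl zero_le_one, rfl, ?_⟩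
    refine (((hP.contDiffAt_burnState hq le_rfl).continuousAt.tendsto.comp hbot)).congr' ?_
    filter_upwards [eventually_le_atBot 0] with x hx
    exact (hW x hx).symm

end Existence

end ZND

/-! ### The two limits. -/

namespace ZND

/-- Detonations exist and are stable for sufficiently small heat release. -/
theorem exists_forall_detonationStable {cv : ℝ} (hcv : 0 < cv) (M : ℝ) {δ : ℝ} (hδ : 0 < δ) :
    ∃ qStar : ℝ, 0 < qStar ∧ ∀ P : Params, P.cv = cv → P.InRange → P.Gam ≤ M → P.actE ≤ M →
      P.ePlus ≤ M → P.q ≤ P.qCJ - δ → P.q ≤ qStar → DetonationStable P := by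
  obtain ⟨qStar, hq0, h⟩ := exists_forall_spectrallyStable hcv M hδ
  exact ⟨qStar, hq0, fun P hc hP hG hE he hq hqs =>
    ⟨hP.exists_isDetonation (by linarith), h P hc hP hG hE he hq hqs⟩⟩

/-- Detonations exist and are stable in the high overdrive limit. -/
theorem exists_forall_overdriven_detonationStable {cv : ℝ} (hcv : 0 < cv) {Gam : ℝ}
    (hG : 0 < Gam) : ∃ ε : ℝ, 0 < ε ∧
      ∀ ePlus q actE : ℝ, 0 ≤ ePlus → ePlus ≤ ε → 0 ≤ q → q ≤ ε → 0 ≤ actE → actE ≤ ε →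
        (Params.mk ePlus q actE Gam cv).InRange ∧ q < (Params.mk ePlus q actE Gam cv).qCJ ∧
        DetonationStable (Params.mk ePlus q actE Gam cv) := by
  -- Excess at least `1/2` gives `q_cj ≥ 1/(8Γ(Γ+2)) = 2δ`; thus `q ≤ δ` leaves the margin `δ`
  -- required for small heat release.
  set δ : ℝ := 1 / (16 * Gam * (Gam + 2)) with hδ
  have hδ0 : 0 < δ := by positivity
  obtain ⟨qStar, hq0, h⟩ := exists_forall_detonationStable hcv (max Gam 1) hδ0
  refine ⟨min (min 1 (1 / (2 * (Gam * (Gam + 1))))) (min δ qStar), by positivity,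
    fun e q E he0 he hq0 hq hE0 hE => ?_⟩
  simp only [le_min_iff] at he hq hE
  set P := Params.mk e q E Gam cv with hP
  have he1 : e * (2 * (Gam * (Gam + 1))) ≤ 1 := (le_div_iff₀ (by positivity)).1 he.1.2
  have hexc : 1 / 2 ≤ P.excess := by
    change 1 / 2 ≤ 1 - Gam * (Gam + 1) * e
    linarith
  have hCJ : 2 * δ ≤ P.qCJ := by
    have h1 : 2 * Gam * (Gam + 2) * P.qCJ = P.excess ^ 2 := Params.qCJ_eq (P := P) hG
    have h2 : 2 * Gam * (Gam + 2) * (2 * δ) = (1 / 2) ^ 2 := by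
      rw [hδ]
      field_simp
      norm_num
    have h3 : (1 / 2 : ℝ) ^ 2 ≤ P.excess ^ 2 := pow_le_pow_left₀ (by norm_num) hexc 2
    refine le_of_mul_le_mul_left ?_ (show 0 < 2 * Gam * (Gam + 2) by positivity)
    rwa [h1, h2]
  have hqCJ : q ≤ P.qCJ - δ := by linarith [hq.2.1]
  have hR : P.InRange := by
    refine ⟨hG, hcv, hE0, he0, ?_, hq0, by change q ≤ P.qCJ; linarith⟩
    change e ≤ 1 / (Gam * (Gam + 1))
    rw [le_div_iff₀ (by positivity)]
    have : 0 ≤ e * (Gam * (Gam + 1)) := by positivity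
    linarith
  exact ⟨hR, by linarith, h P rfl hR (le_max_left _ _) (hE.1.1.trans (le_max_right _ _))
    (he.1.1.trans (le_max_right _ _)) hqCJ hq.2.2⟩

end ZND

end

/-- Spectral stability of ZND detonations in the small heat release limit and in the high
overdrive limit. -/
theorem mainTheorem1 (cv : ℝ) (hcv : 0 < cv) :
    -- small heat release limit: `Γ`, `ℰ`, `e₊` bounded, `q` bounded away from `q_cj`
    (∀ M δ : ℝ, 0 < δ → ∃ qStar : ℝ, 0 < qStar ∧
      ∀ P : ZND.Params, P.cv = cv → P.InRange → P.Gam ≤ M → P.actE ≤ M → P.ePlus ≤ M →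
        P.q ≤ P.qCJ - δ → P.q ≤ qStar → ZND.DetonationStable P) ∧
    -- high overdrive limit, in the form `q, ℰ, e₊ → 0`
    (∀ Gam : ℝ, 0 < Gam → ∃ ε : ℝ, 0 < ε ∧
      ∀ ePlus q actE : ℝ, 0 ≤ ePlus → ePlus ≤ ε → 0 ≤ q → q ≤ ε → 0 ≤ actE → actE ≤ ε →
        (ZND.Params.mk ePlus q actE Gam cv).InRange ∧
        q < (ZND.Params.mk ePlus q actE Gam cv).qCJ ∧
        ZND.DetonationStable (ZND.Params.mk ePlus q actE Gam cv)) ∧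
    -- high overdrive limit in Erpenbeck's scaling `q = q₀ e₊`, `ℰ = ℰ₀ e₊`, `e₊ → 0⁺`
    (∀ Gam q₀ actE₀ : ℝ, 0 < Gam → 0 ≤ q₀ → 0 ≤ actE₀ → ∀ᶠ ePlus : ℝ in 𝓝[>] 0,
        (ZND.Params.mk ePlus (q₀ * ePlus) (actE₀ * ePlus) Gam cv).InRange ∧
        q₀ * ePlus < (ZND.Params.mk ePlus (q₀ * ePlus) (actE₀ * ePlus) Gam cv).qCJ ∧
        ZND.DetonationStable (ZND.Params.mk ePlus (q₀ * ePlus) (actE₀ * ePlus) Gam cv)) := by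
  refine ⟨fun M δ hδ => ZND.exists_forall_detonationStable hcv M hδ, fun Gam hG =>
    ZND.exists_forall_overdriven_detonationStable hcv hG, fun Gam q₀ actE₀ hG hq₀ hE₀ => ?_⟩
  obtain ⟨ε, hε, h⟩ := ZND.exists_forall_overdriven_detonationStable hcv hG
  have hsmall : ∀ k : ℝ, ∀ᶠ e : ℝ in 𝓝[>] 0, k * e ≤ ε := fun k => by
    have h1 : Tendsto (fun e : ℝ => k * e) (𝓝[>] 0) (𝓝 (k * 0)) :=
      (tendsto_id.const_mul k).mono_left nhdsWithin_le_nhds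
    rw [mul_zero] at h1
    exact h1.eventually_le_const hε
  filter_upwards [self_mem_nhdsWithin, hsmall 1, hsmall q₀, hsmall actE₀] with e he h1 h2 h3
  have he0 : 0 ≤ e := le_of_lt he
  exact h e _ _ he0 (by linarith) (mul_nonneg hq₀ he0) h2 (mul_nonneg hE₀ he0) h3
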